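/- Let $F$ be a non-archimedean local field of odd residue characteristic $p$ and residue field $k_F$ of cardinality $q$ (no assumption on $\operatorname{char} F$), let $E/F$ be the unramified quadratic extension, with non-trivial conjugation $x\mapsto\bar x$, ring of integers $\mathfrak o_E$, maximal ideal $\mathfrak p_E$ and residue field $k_E$, and let $\varpi$ be a uniformizer of $F$ (hence of $E$). Let $\beta$ be the antidiagonal $3\times 3$ matrix with entries $1$, $\mathrm h(v,w)=v^{T}\beta\bar w$ on $E^3$, and $$G=U(2,1)(E/F)=\{g\in \mathrm{GL}_3(E): \mathrm h(gv,gw)=\mathrm h(v,w)\ \ \forall v,w\in E^3\}.$$ Put $\alpha=\operatorname{diag}(\varpi^{-1},1,\varpi)$ and $h(x)=\operatorname{diag}(x,-\bar x x^{-1},\bar x^{-1})$ for $x\in E^\times$. Let $K\in\{K_0,K_1\}$, where $$K_0=\mathrm{GL}_3(\mathfrak o_E)\cap G,\qquad K_1=\begin{pmatrix}\mathfrak o_E&\mathfrak o_E&\mathfrak p_E^{-1}\\ \mathfrak p_E&\mathfrak o_E&\mathfrak o_E\\ \mathfrak p_E&\mathfrak p_E&\mathfrak o_E\end{pmatrix}\cap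 G$$ (up to conjugacy, these are the maximal compact open subgroups of $G$), and let $\beta_K=\beta$ if $K=K_0$ and $\beta_K=\beta\alpha^{-1}$ if $K=K_1$. Let $K^1$ be the maximal normal pro-$p$ subgroup of $K$ and $\Gamma_K=K/K^1$. Let $I_K$, $I_{1,K}$ and $I'_{1,K}$ be the preimages in $K$ of the upper triangular, the upper triangular unipotent and the lower triangular unipotent subgroup of $\Gamma_K$. Representations are smooth and over $\overline{\mathbf F}_p$; a weight of $K$ is an irreducible smooth representation $\sigma$ of $K$. For a weight $\sigma$, $\sigma^{I_{1,K}}$ is a line, on which $I_K$ acts by a character $\chi_\sigma$, and $\sigma^{I_{1,K}}\to\sigma_{I'_{1,K}}$ (coinvariants) is bijective; let $j_\sigma\in\operatorname{End}(\sigma)$ be the composite of $\sigma\twoheadrightarrow\sigma_{I'_{1,K}}$ with the inverse of this bijection. Let $\operatorname{ind}_K^G\sigma$ be the space of smooth compactly supported functions $f:G\to\sigma$ with $f(\kappa g)=\sigma(\kappa)f(g)$ for $\kappa\in K$, with $G$ acting by right translation. Let $T\in\operatorname{End}_G(\operatorname{ind}_K^G\sigma)$ be the Hecke operator $(Tf)(g)=\sum_{x\in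 G/K}\varphi(x)f(x^{-1}g)$, where $\varphi:G\to\operatorname{End}(\sigma)$ is the function supported on $K\alpha K$ with $\varphi(\kappa g\kappa')=\sigma(\kappa)\varphi(g)\sigma(\kappa')$ for $\kappa,\kappa'\in K$ and $\varphi(\alpha)=j_\sigma$. Put $$T_\sigma=T-\sum_{(x,t)}\chi_\sigma(h(t)),$$ where $(x,t)$ runs over the pairs in $k_E\times k_E^\times$ with $x=0$ and $t+\bar t=0$ if $K=K_0$, and over those with $x\bar x+t+\bar t=0$ if $K=K_1$; here $\chi_\sigma(h(t))$ means $\chi_\sigma(h(\tilde t))$ for any lift $\tilde t\in\mathfrak o_E^\times$ of $t$. An irreducible smooth representation of $G$ is called supersingular if it is a quotient of $\operatorname{ind}_K^G\sigma/(T_\sigma)$ for some weight $\sigma$ of $K$. For $0\ne v_0\in\sigma^{I_{1,K}}$ and $n\in\mathbf Z$ let $f_n\in(\operatorname{ind}_K^G\sigma)^{I_{1,K}}$ be the function supported on $K\alpha^{-n}I_{1,K}$ with $f_n(\alpha^{-n})=\beta_K v_0$ if $n>0$ and $f_n(\alpha^{-n})=v_0$ if $n\le 0$. The Steinberg weight $\mathrm{St}$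 of $K$ is the space of functions $K/I_K\to\overline{\mathbf F}_p$ modulo the constant functions. **Theorem.** (1) If $\sigma$ is (isomorphic to) the Steinberg weight of $K$, $0\neq v_0\in\sigma^{I_{1,K}}$, and $\pi$ is any irreducible quotient of $\operatorname{ind}_K^G\sigma/(T_\sigma)$, then the images of $f_0$ and $f_1$ in $\pi$ are not proportional, i.e. they are linearly independent. (2) Every supersingular representation $\pi$ of $G$ whose restriction to $K$ contains the Steinberg weight of $K$ satisfies $\dim_{\overline{\mathbf F}_p}\pi^{I_{1,K}}\ge 2$. -/

import Mathlib

open ValuativeRel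

/-! ### Smooth representations, compact induction and spherical Hecke operators

`k` is the coefficient field and `G` a topological group. -/

section Representations

variable {k G V W : Type*} [Field k] [Group G] [TopologicalSpace G]
  [AddCommGroup V] [Module k V] [AddCommGroup W] [Module k W]

/-- A representation is smooth if every vector is fixed by an open subgroup. -/
def IsSmoothRep (ρ : Representation k G V) : Prop :=
  ∀ v : V, ∃ U : Subgroup G, IsOpen (U : Set G) ∧ ∀ u ∈ U, ρ u v = v

/-- The space `V^H` of vectors fixed by a subgroup `H`. -/
noncomputable def fixedVectors (ρ : Representation k G V) (H : Subgroup G) : Submodule k V :=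
  Representation.invariants (ρ.comp H.subtype)

/-- The underlying space `S(G, σ)` of the compact induction of `σ` from `K` to `G`: functions
`f : G → W` with `f (κ g) = σ(κ) f(g)` which are smooth (right invariant under an open subgroup)
and have compact support. -/
def cIndSpace [IsTopologicalGroup G] (K : Subgroup G) (σ : Representation k K W) :
    Submodule k (G → W) where
  carrier := {f | (∀ (κ : K) (g : G), f (κ * g) = σ κ (f g)) ∧
    (∃ U : Subgroup G, IsOpen (U : Set G) ∧ ∀ u ∈ U, ∀ g, f (g * u) = f g) ∧
    HasCompactSupport f}
  add_mem' := by
    rintro f f' ⟨h1, ⟨U, hU, h2⟩, h3⟩ ⟨h1', ⟨U', hU', h2'⟩, h3'⟩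
    refine ⟨fun κ g => by simp [h1, h1'], ⟨U ⊓ U', hU.inter hU', fun u hu g => ?_⟩, ?_⟩
    · simp [h2 u hu.1, h2' u hu.2]
    · exact (h3.isCompact.union h3'.isCompact).of_isClosed_subset isClosed_closure
        ((closure_mono (Function.support_add f f')).trans closure_union.le)
  zero_mem' := ⟨by simp, ⟨⊤, isOpen_univ, by simp⟩, HasCompactSupport.zero⟩
  smul_mem' := by
    rintro c f ⟨h1, ⟨U, hU, h2⟩, h3⟩
    refine ⟨fun κ g => by simp [h1], ⟨U, hU, fun u hu g => by simp [h2 u hu]⟩, ?_⟩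
    exact h3.mono (fun x hx hfx => hx (by simp [hfx]))

/-- The compact induction `ind_K^G σ`: the group `G` acts on `S(G, σ)` by right translation. -/
def cInd [IsTopologicalGroup G] (K : Subgroup G) (σ : Representation k K W) :
    Representation k G (cIndSpace K σ) where
  toFun g := (LinearMap.funLeft k W (· * g)).restrict (by
    rintro f ⟨h1, ⟨U, hU, h2⟩, h3⟩
    refine ⟨fun κ x => by simp [LinearMap.funLeft_apply, mul_assoc, h1],
      ⟨U.comap (MulAut.conj g⁻¹).toMonoidHom, ?_, ?_⟩, ?_⟩
    · have hc : Continuous fun x : G => (MulAut.conj g⁻¹) x := by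
        simp only [MulAut.conj_apply]; fun_prop
      exact hU.preimage hc
    · intro u hu x
      have hu' : g⁻¹ * u * g ∈ U := by simpa using! hu
      have := h2 _ hu' (x * g)
      simpa [LinearMap.funLeft_apply, mul_assoc] using this
    · exact h3.comp_homeomorph (Homeomorph.mulRight g))
  map_one' := by ext; simp [LinearMap.funLeft_apply]
  map_mul' x y := by ext; simp [LinearMap.funLeft_apply, mul_assoc]

/-- Membership in `𝓗_K(σ)`: functions `φ : G → End(W)` with
`φ (κ g κ') = σ(κ) φ(g) σ(κ')` which are smooth with compact support. -/
structure IsHeckeFunction (K : Subgroup G) (σ : Representation k K W)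
    (φ : G → Module.End k W) : Prop where
  bi_equivariant : ∀ (κ κ' : K) (g : G), φ (κ * g * κ') = σ κ * φ g * σ κ'
  smooth : IsLocallyConstant φ
  compact_support : HasCompactSupport φ

/-- The convolution `(φ * f)(g) = ∑_{x ∈ G / K} φ(x) f(x⁻¹ g)`, through which `𝓗_K(σ)` acts on
`ind_K^G σ`. The summand does not depend on the representative of `x`, and almost all summands
vanish. -/
noncomputable def heckeConvolution (K : Subgroup G)
    (φ : G → Module.End k W) (f : G → W) (g : G) : W :=
  ∑ᶠ x : G ⧸ K, φ x.out (f (x.out⁻¹ * g))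

/-- `j` is the endomorphism `j_σ` of `σ`: the composite of `σ ↠ σ_{J'}` with the inverse of
`σ^J ↪ σ ↠ σ_{J'}`. As these spaces are lines and the latter map is bijective, `j_σ` is the only
map which factors through the coinvariants `σ_{J'}`, takes values in `σ^J` and is the identity
on `σ^J`. -/
structure IsProjectionJ {K : Subgroup G} (σ : Representation k K W) (J J' : Subgroup G)
    (j : Module.End k W) : Prop where
  coinvariant : ∀ κ : K, (κ : G) ∈ J' → ∀ w, j (σ κ w) = j w
  mem_fixed : ∀ w, j w ∈ fixedVectors σ (J.subgroupOf K)
  eq_self : ∀ w ∈ fixedVectors σ (J.subgroupOf K), j w = w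

/-- `T ∈ End_G(ind_K^G σ)` is given by the function `φ ∈ 𝓗_K(σ)` which is supported on `K a K`
and satisfies `φ(a) = j_σ`. -/
def IsHeckeOperatorAt [IsTopologicalGroup G] {K : Subgroup G} (σ : Representation k K W)
    (J J' : Subgroup G) (a : G)
    (T : Representation.IntertwiningMap (cInd K σ) (cInd K σ)) : Prop :=
  ∃ φ : G → Module.End k W, IsHeckeFunction K σ φ ∧
    (∀ g, φ g ≠ 0 → ∃ κ κ' : K, g = κ * a * κ') ∧
    IsProjectionJ σ J J' (φ a) ∧
    ∀ (f : cIndSpace K σ) (g : G), (T f).1 g = heckeConvolution K φ f.1 g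

open Classical in
/-- The Hecke operator with the above property (unique, as `φ` is determined by `φ(a)`). -/
noncomputable def heckeOperatorAt [IsTopologicalGroup G] {K : Subgroup G}
    (σ : Representation k K W) (J J' : Subgroup G) (a : G) :
    Representation.IntertwiningMap (cInd K σ) (cInd K σ) :=
  if h : ∃ T, IsHeckeOperatorAt σ J J' a T then h.choose else 0

open Classical in
/-- The eigenvalue of `g ∈ K` on the line `σ^J`, when `g` acts on it by a scalar. -/
noncomputable def eigenvalueOn {K : Subgroup G} (σ : Representation k K W) (J : Subgroup G)
    (g : G) : k :=
  if h : ∃ c : k, ∃ κ : K, (κ : G) = g ∧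
    ∀ v ∈ fixedVectors σ (J.subgroupOf K), σ κ v = c • v then h.choose else 0

/-- A weight of `K`: an irreducible smooth representation of `K`. -/
def IsWeight {K : Subgroup G} (σ : Representation k K W) : Prop :=
  σ.IsIrreducible ∧ IsSmoothRep σ

/-- The restriction of `ρ` to `K` contains `σ` as a subrepresentation. -/
def ContainsRep {K : Subgroup G} (ρ : Representation k G V) (σ : Representation k K W) : Prop :=
  ∃ i : Representation.IntertwiningMap σ (ρ.comp K.subtype), Function.Injective i

end Representations

section PermutationRep

variable (k : Type*) {A : Type*} [Field k] [Group A] (I : Subgroup A)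

/-- The representation of `A` on the functions on `A / I`, by `(a f)(x) = f(a⁻¹ x)`. -/
def functionsRep : Representation k A (A ⧸ I → k) where
  toFun a := LinearMap.funLeft k k (a⁻¹ • ·)
  map_one' := by ext; simp [LinearMap.funLeft_apply]
  map_mul' x y := by
    ext; simp [LinearMap.funLeft_apply, mul_smul]

/-- The representation of `A` on the functions on `A / I` modulo the constant functions. -/
def functionsModConstants :
    Representation k A ((A ⧸ I → k) ⧸ (Submodule.span k {(1 : A ⧸ I → k)})) :=
  (functionsRep k I).quotient _ (fun g => by
    rw [Submodule.span_le, Set.singleton_subset_iff]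
    exact Submodule.subset_span rfl)

end PermutationRep

/-! ### The unramified unitary group in three variables -/

/-- A uniformizer of the non-archimedean local field `F`. -/
structure Uniformizer (F : Type*) [Field F] [ValuativeRel F] where
  val : 𝒪[F]
  irreducible : Irreducible val

/-- The extension `E / F` of local fields is unramified: every uniformizer of `F` is a uniformizer
of `E` (the residue fields are finite, so the residue extension is separable). -/
def IsUnramifiedExtension (F E : Type*) [Field F] [ValuativeRel F] [Field E] [ValuativeRel E]
    [Algebra F E] : Prop :=
  ∀ ϖ : Uniformizer F, ∃ ϖ' : Uniformizer E, (ϖ'.val : E) = algebraMap F E (ϖ.val : F)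

/-- The non-trivial Galois conjugation `x ↦ x̄` of a quadratic extension `E / F`. -/
structure QuadraticConjugation (F E : Type*) [Field F] [Field E] [Algebra F E] where
  toAlgEquiv : E ≃ₐ[F] E
  ne_refl : toAlgEquiv ≠ AlgEquiv.refl
  involutive : ∀ x, toAlgEquiv (toAlgEquiv x) = x

/-- The two conjugacy classes of maximal compact open subgroups of `G`. -/
inductive MaxCompactKind
  | hyperspecial
  | nonhyperspecial

namespace U21

variable {F E : Type*} [Field F] [Field E] [Algebra F E]

/-- The matrix `β` of the Hermitian form. -/
def betaMatrix (E : Type*) [Field E] : Matrix (Fin 3) (Fin 3) E := !![0, 0, 1; 0, 1, 0; 1, 0, 0]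

/-- The Hermitian form `h(v, w) = vᵀ β w̄` on `E³`. -/
def herm (c : QuadraticConjugation F E) (v w : Fin 3 → E) : E :=
  v ⬝ᵥ (betaMatrix E).mulVec (fun i => c.toAlgEquiv (w i))

lemma herm_eq (c : QuadraticConjugation F E) (v w : Fin 3 → E) :
    herm c v w =
      v 0 * c.toAlgEquiv (w 2) + v 1 * c.toAlgEquiv (w 1) + v 2 * c.toAlgEquiv (w 0) := by
  simp [herm, betaMatrix, Matrix.mulVec, dotProduct, Fin.sum_univ_three]

/-- The unitary group `G = U(2,1)(E/F)`; its topology is the one induced from `GL(3, E)`. -/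
def unitaryGroup (c : QuadraticConjugation F E) : Subgroup (GL (Fin 3) E) where
  carrier := {g | ∀ v w : Fin 3 → E,
    herm c (g.val.mulVec v) (g.val.mulVec w) = herm c v w}
  one_mem' := by simp
  mul_mem' := by
    intro g g' hg hg' v w
    simp only [Units.val_mul, ← Matrix.mulVec_mulVec]
    rw [hg, hg']
  inv_mem' := by
    intro g hg v w
    have := hg ((g⁻¹).val.mulVec v) ((g⁻¹).val.mulVec w)
    simpa [Matrix.mulVec_mulVec] using this.symm

/-- The diagonal matrix with entries `d`. -/
def diagGL (d : Fin 3 → Eˣ) : GL (Fin 3) E where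
  val := Matrix.diagonal fun i => (d i : E)
  inv := Matrix.diagonal fun i => ((d i)⁻¹ : E)
  val_inv := by simp [Matrix.diagonal_mul_diagonal]
  inv_val := by simp [Matrix.diagonal_mul_diagonal]

/-- The conjugation on `Eˣ`. -/
def unitsConj (c : QuadraticConjugation F E) : Eˣ →* Eˣ :=
  Units.map (c.toAlgEquiv : E →* E)

/-- `h(x) = diag(x, -x̄ x⁻¹, x̄⁻¹)` for `x ∈ Eˣ`. -/
def hElt (c : QuadraticConjugation F E) (x : Eˣ) : unitaryGroup c :=
  ⟨diagGL ![x, -(unitsConj c x) * x⁻¹, (unitsConj c x)⁻¹], by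
    intro v w
    have h1 : (x : E) ≠ 0 := x.ne_zero
    have h2 : c.toAlgEquiv (x : E) ≠ 0 := by simp
    simp [herm_eq, diagGL, unitsConj, Matrix.mulVec_diagonal, c.involutive]
    field_simp⟩

/-- The element `β` of `G`. -/
def betaElt (c : QuadraticConjugation F E) : unitaryGroup c :=
  ⟨⟨betaMatrix E, betaMatrix E,
      by ext i j; fin_cases i <;> fin_cases j <;> simp [betaMatrix],
      by ext i j; fin_cases i <;> fin_cases j <;> simp [betaMatrix]⟩, by
    intro v w
    simp [herm_eq, betaMatrix, dotProduct, Fin.sum_univ_three]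
    ring⟩

section Valued

variable [ValuativeRel F]

/-- The uniformizer `ϖ` of `F`, viewed in `Eˣ`. -/
def unifUnit (E : Type*) [Field E] [Algebra F E] (ϖ : Uniformizer F) : Eˣ :=
  Units.mk0 (algebraMap F E ϖ.val) (by
    have := ϖ.irreducible.ne_zero
    simpa using this)

/-- `α = diag(ϖ⁻¹, 1, ϖ)`. -/
def alphaElt (c : QuadraticConjugation F E) (ϖ : Uniformizer F) : unitaryGroup c :=
  ⟨diagGL ![(unifUnit E ϖ)⁻¹, 1, unifUnit E ϖ], by
    intro v w
    have h1 : algebraMap F E (ϖ.val : F) ≠ 0 := (unifUnit E ϖ).ne_zero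
    simp [herm_eq, diagGL, unifUnit, Matrix.mulVec_diagonal]
    field_simp⟩

/-- `β_K` is `β` for `K_0` and `β' = β α⁻¹` for `K_1`. -/
def betaK (c : QuadraticConjugation F E) (ϖ : Uniformizer F) (κ : MaxCompactKind) : unitaryGroup c :=
  match κ with
  | .hyperspecial => betaElt c
  | .nonhyperspecial => betaElt c * (alphaElt c ϖ)⁻¹

lemma betaK_val_nonhyperspecial (c : QuadraticConjugation F E) (ϖ : Uniformizer F) :
    (betaK c ϖ .nonhyperspecial).1.val =
    !![0, 0, (algebraMap F E ϖ.val)⁻¹; 0, 1, 0; algebraMap F E ϖ.val, 0, 0] := by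
  have h : (betaK c ϖ .nonhyperspecial).1.val =
      betaMatrix E * Matrix.diagonal fun i =>
        ((![(unifUnit E ϖ)⁻¹, 1, unifUnit E ϖ] i)⁻¹ : E) := rfl
  rw [h]
  ext i j
  rw [Matrix.mul_diagonal]
  fin_cases i <;> fin_cases j <;> simp [betaMatrix, unifUnit]

lemma betaK_mul_self (c : QuadraticConjugation F E) (ϖ : Uniformizer F) (κ : MaxCompactKind) :
    betaK c ϖ κ * betaK c ϖ κ = 1 := by
  have h0 : algebraMap F E (ϖ.val : F) ≠ 0 := (unifUnit E ϖ).ne_zero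
  apply Subtype.ext
  apply Units.ext
  cases κ
  · ext i j
    fin_cases i <;> fin_cases j <;> simp [betaK, betaElt, betaMatrix]
  · have h : ((betaK c ϖ .nonhyperspecial * betaK c ϖ .nonhyperspecial).1.val) =
      (betaK c ϖ .nonhyperspecial).1.val * (betaK c ϖ .nonhyperspecial).1.val := rfl
    rw [h, betaK_val_nonhyperspecial]
    generalize algebraMap F E (ϖ.val : F) = z at h0
    ext i j
    fin_cases i <;> fin_cases j <;> simp [h0]

variable [ValuativeRel E]

/-- The matrices `A` with `A i j ∈ 𝔭_E ^ (e i j)` for all `i, j`. -/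
def InLattice (ϖ : Uniformizer F) (e : Fin 3 → Fin 3 → ℤ) (A : Matrix (Fin 3) (Fin 3) E) : Prop :=
  ∀ i j, valuation E (A i j) ≤ valuation E (unifUnit E ϖ : E) ^ (e i j)

lemma InLattice.add {ϖ : Uniformizer F} {e : Fin 3 → Fin 3 → ℤ} {A B : Matrix (Fin 3) (Fin 3) E}
    (hA : InLattice ϖ e A) (hB : InLattice ϖ e B) : InLattice ϖ e (A + B) :=
  fun i j => (valuation E).map_add_le (hA i j) (hB i j)

lemma valuation_unifUnit_le_one [ValuativeExtension F E] (ϖ : Uniformizer F) :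
    valuation E (unifUnit E ϖ : E) ≤ 1 := by
  have h : (ϖ.val : F) ≤ᵥ 1 := by
    rw [(valuation F).vle_iff_le, map_one]
    exact ϖ.val.2
  have h' : algebraMap F E (ϖ.val : F) ≤ᵥ algebraMap F E 1 :=
    (ValuativeExtension.vle_iff_vle _ _).2 h
  rw [map_one, (valuation E).vle_iff_le, map_one] at h'
  exact h'

lemma InLattice.mul [ValuativeExtension F E] {ϖ : Uniformizer F} {e : Fin 3 → Fin 3 → ℤ}
    (he : ∀ i j l, e i l ≤ e i j + e j l) {A B : Matrix (Fin 3) (Fin 3) E}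
    (hA : InLattice ϖ e A) (hB : InLattice ϖ e B) : InLattice ϖ e (A * B) := by
  intro i l
  rw [Matrix.mul_apply]
  refine (valuation E).map_sum_le fun j _ => ?_
  have h0 : valuation E (unifUnit E ϖ : E) ≠ 0 := by simp
  rw [map_mul]
  calc valuation E (A i j) * valuation E (B j l)
      ≤ valuation E (unifUnit E ϖ : E) ^ (e i j) * valuation E (unifUnit E ϖ : E) ^ (e j l) :=
        mul_le_mul' (hA i j) (hB j l)
    _ = valuation E (unifUnit E ϖ : E) ^ (e i j + e j l) := (zpow_add₀ h0 _ _).symm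
    _ ≤ valuation E (unifUnit E ϖ : E) ^ (e i l) :=
        zpow_le_zpow_right_of_le_one₀ (zero_lt_iff.2 h0) (valuation_unifUnit_le_one ϖ) (he i j l)

/-- The subgroup of those `g ∈ G` for which `g - 1` has entries in the ideals `𝔭_E ^ (e i j)`.
The condition on `g⁻¹ = β ḡᵀ β` follows from the one on `g` for the `e` used below, which are
symmetric under reflection in the antidiagonal. -/
def congruenceSubgroup [ValuativeExtension F E] (c : QuadraticConjugation F E) (ϖ : Uniformizer F)
    (e : Fin 3 → Fin 3 → ℤ) (he : ∀ i j l, e i l ≤ e i j + e j l) :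
    Subgroup (unitaryGroup c) where
  carrier := {g | InLattice ϖ e (g.1.val - 1) ∧ InLattice ϖ e ((g⁻¹).1.val - 1)}
  one_mem' := by constructor <;> intro i j <;> simp
  mul_mem' := by
    have key : ∀ A B : Matrix (Fin 3) (Fin 3) E, InLattice ϖ e (A - 1) → InLattice ϖ e (B - 1) →
        InLattice ϖ e (A * B - 1) := by
      intro A B hA hB
      have : A * B - 1 = (A - 1) * (B - 1) + ((A - 1) + (B - 1)) := by noncomm_ring
      rw [this]
      exact (hA.mul he hB).add (hA.add hB)
    rintro g g' ⟨h1, h2⟩ ⟨h1', h2'⟩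
    refine ⟨key _ _ h1 h1', ?_⟩
    have : (((g * g')⁻¹ : unitaryGroup c).1.val) = (g'⁻¹).1.val * (g⁻¹).1.val := by
      rw [mul_inv_rev]; rfl
    rw [this]
    exact key _ _ h2' h2
  inv_mem' := by
    rintro g ⟨h1, h2⟩
    exact ⟨h2, by simpa using h1⟩

/-- Exponents of `K`: `K_0 = GL(3, 𝔬_E) ∩ G`, and `K_1` is the other maximal compact subgroup. -/
def expK : MaxCompactKind → Fin 3 → Fin 3 → ℤ
  | .hyperspecial => !![0, 0, 0; 0, 0, 0; 0, 0, 0]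
  | .nonhyperspecial => !![0, 0, -1; 1, 0, 0; 1, 1, 0]

/-- Exponents of the Iwahori subgroup `I_K`, the preimage in `K` of the upper triangular subgroup
of `Γ_K = K / K¹`, where
`K_0¹ = (1 + ϖ M_3(𝔬_E)) ∩ G` and `K_1¹` has exponents `[1, 0, 0; 1, 1, 0; 2, 1, 1]`. -/
def expI : MaxCompactKind → Fin 3 → Fin 3 → ℤ
  | .hyperspecial => !![0, 0, 0; 1, 0, 0; 1, 1, 0]
  | .nonhyperspecial => !![0, 0, -1; 1, 0, 0; 2, 1, 0]

/-- Exponents of the pro-`p` Iwahori subgroup `I_{1,K}`, the preimage in `K` of the upper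
triangular unipotent subgroup of `Γ_K`. -/
def expI1 : MaxCompactKind → Fin 3 → Fin 3 → ℤ
  | .hyperspecial => !![1, 0, 0; 1, 1, 0; 1, 1, 1]
  | .nonhyperspecial => !![1, 0, -1; 1, 1, 0; 2, 1, 1]

/-- Exponents of `I'_{1,K}`, the preimage in `K` of the lower triangular unipotent subgroup
of `Γ_K`. -/
def expI1' : MaxCompactKind → Fin 3 → Fin 3 → ℤ
  | .hyperspecial => !![1, 1, 1; 0, 1, 1; 0, 0, 1]
  | .nonhyperspecial => !![1, 0, 0; 1, 1, 0; 1, 1, 1]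

variable [ValuativeExtension F E] (c : QuadraticConjugation F E) (ϖ : Uniformizer F)
  (κ : MaxCompactKind)

/-- The maximal compact subgroup `K ∈ {K_0, K_1}`. -/
def maxCompact : Subgroup (unitaryGroup c) :=
  congruenceSubgroup c ϖ (expK κ) (by cases κ <;> decide)

/-- The Iwahori subgroup `I_K`. -/
def iwahori : Subgroup (unitaryGroup c) :=
  congruenceSubgroup c ϖ (expI κ) (by cases κ <;> decide)

/-- The pro-`p` Iwahori subgroup `I_{1,K}`. -/
def proPIwahori : Subgroup (unitaryGroup c) :=
  congruenceSubgroup c ϖ (expI1 κ) (by cases κ <;> decide)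

/-- The opposite pro-`p` Iwahori subgroup `I'_{1,K}`. -/
def proPIwahori' : Subgroup (unitaryGroup c) :=
  congruenceSubgroup c ϖ (expI1' κ) (by cases κ <;> decide)

lemma betaK_mem : betaK c ϖ κ ∈ maxCompact c ϖ κ := by
  have hinv : (betaK c ϖ κ)⁻¹ = betaK c ϖ κ := inv_eq_of_mul_eq_one_left (betaK_mul_self c ϖ κ)
  suffices h : InLattice ϖ (expK κ) ((betaK c ϖ κ).1.val - 1) from ⟨h, by rwa [hinv]⟩
  cases κ
  · have h : (betaK c ϖ .hyperspecial).1.val = betaMatrix E := rfl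
    rw [h]
    intro i j
    fin_cases i <;> fin_cases j <;> simp [betaMatrix, expK]
  · rw [betaK_val_nonhyperspecial]
    intro i j
    fin_cases i <;> fin_cases j <;> simp [expK, unifUnit]

/-- `β_K` as an element of `K`. -/
def betaKmem : maxCompact c ϖ κ := ⟨betaK c ϖ κ, betaK_mem c ϖ κ⟩

section Weights

variable {k W V : Type*} [Field k] [AddCommGroup W] [Module k W] [AddCommGroup V] [Module k V]

/-- The Steinberg weight of `K`: the functions on `K / I_K = Γ_K / 𝔹` modulo the constants. -/
def steinberg (k : Type*) [Field k] :=
  functionsModConstants k ((iwahori c ϖ κ).subgroupOf (maxCompact c ϖ κ))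

variable {c ϖ κ}

/-- The defining property of `f_n ∈ (ind_K^G σ)^{I_{1,K}}`: it is `I_{1,K}`-invariant, supported on
`K α^{-n} I_{1,K}`, and `f_n(α^{-n})` equals `β_K v₀` if `n > 0` and `v₀` if `n ≤ 0`. -/
structure IsInvariantFunction [TopologicalSpace E] [IsTopologicalRing E]
    (σ : Representation k (maxCompact c ϖ κ) W) (v₀ : W) (n : ℤ)
    (f : cIndSpace (maxCompact c ϖ κ) σ) : Prop where
  invariant : f ∈ fixedVectors (cInd _ σ) (proPIwahori c ϖ κ)
  support : ∀ g, f.1 g ≠ 0 → ∃ x ∈ maxCompact c ϖ κ, ∃ y ∈ proPIwahori c ϖ κ,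
    g = x * alphaElt c ϖ ^ (-n) * y
  value : f.1 (alphaElt c ϖ ^ (-n)) = if 0 < n then σ (betaKmem c ϖ κ) v₀ else v₀

open Classical in
/-- The function `f_n` (it is determined by its properties). -/
noncomputable def invariantFunction [TopologicalSpace E] [IsTopologicalRing E]
    (σ : Representation k (maxCompact c ϖ κ) W) (v₀ : W) (n : ℤ) :
    cIndSpace (maxCompact c ϖ κ) σ :=
  if h : ∃ f, IsInvariantFunction σ v₀ n f then h.choose else 0

/-- The Hecke operator `T`, with function supported on `K α K` and of value `j_σ` at `α`. -/
noncomputable def heckeT [TopologicalSpace E] [IsTopologicalRing E]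
    (σ : Representation k (maxCompact c ϖ κ) W) :
    Representation.IntertwiningMap (cInd _ σ) (cInd _ σ) :=
  heckeOperatorAt σ (proPIwahori c ϖ κ) (proPIwahori' c ϖ κ) (alphaElt c ϖ)

/-- Membership of `(x, t)` in `L_{q^{4 - t_K}}`, for `x, t` in the residue field `k_E`. This is
`L_q = {(0, t) | t + t̄ = 0}` if `K` is hyperspecial and
`L_{q³} = {(x, t) | x x̄ + t + t̄ = 0}` otherwise; the conjugation of `k_E` over the field `k_F`
with `q` elements is `x ↦ x ^ q`. -/
def InL {R : Type*} [Field R] (κ : MaxCompactKind) (q : ℕ) (x t : R) : Prop :=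
  match κ with
  | .hyperspecial => x = 0 ∧ t + t ^ q = 0
  | .nonhyperspecial => x * x ^ q + t + t ^ q = 0

/-- A lift to `𝔬_Eˣ ⊆ Eˣ` of a nonzero element of the residue field. -/
noncomputable def unitLift (t : 𝓀[E]ˣ) : Eˣ :=
  Units.map (𝒪[E].subtype : 𝒪[E] →* E)
    (Function.surjInv (IsLocalRing.surjective_units_map_of_local_ringHom
      (IsLocalRing.residue 𝒪[E]) IsLocalRing.residue_surjective inferInstance) t)

/-- The constant `∑_{(x, t) ∈ L_{q^{4 - t_K}}^×} χ_σ(h(t))`, where `L^×` is the set of non-identity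
elements of `L`, i.e. those with `t ≠ 0`. -/
noncomputable def heckeConstant (σ : Representation k (maxCompact c ϖ κ) W) : k :=
  ∑ᶠ y : {y : 𝓀[E] × 𝓀[E]ˣ // InL κ (Nat.card 𝓀[F]) y.1 (y.2 : 𝓀[E])},
    eigenvalueOn σ (proPIwahori c ϖ κ) (hElt c (unitLift y.1.2))

/-- The Hecke operator `T_σ = T - ∑_{(x, t) ∈ L_{q^{4 - t_K}}^×} χ_σ(h(t))`. -/
noncomputable def heckeTσ [TopologicalSpace E] [IsTopologicalRing E]
    (σ : Representation k (maxCompact c ϖ κ) W) :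
    Representation.IntertwiningMap (cInd _ σ) (cInd _ σ) :=
  heckeT σ - heckeConstant σ • Representation.IntertwiningMap.id (cInd _ σ)

/-- The universal module `ind_K^G σ / (T_σ)`. -/
noncomputable def universalModule [TopologicalSpace E] [IsTopologicalRing E]
    (σ : Representation k (maxCompact c ϖ κ) W) :
    Representation k (unitaryGroup c)
      (cIndSpace (maxCompact c ϖ κ) σ ⧸ (heckeTσ σ).range.toSubmodule) :=
  (cInd _ σ).quotient _ (heckeTσ σ).range.apply_mem_toSubmodule

end Weights

/-- A supersingular representation of `G`: an irreducible smooth representation which is a quotient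
of `ind_K^G σ / (T_σ)` for some weight `σ` of `K`. (Weights are finite dimensional, so spaces `W`
in the universe of `k` suffice.) -/
def IsSupersingular.{u, v} {k : Type u} {V : Type v} [Field k] [AddCommGroup V] [Module k V]
    [TopologicalSpace E] [IsTopologicalRing E] (ρ : Representation k (unitaryGroup c) V) : Prop :=
  ρ.IsIrreducible ∧ IsSmoothRep ρ ∧
    ∃ (W : Type u) (_ : AddCommGroup W) (_ : Module k W)
      (σ : Representation k (maxCompact c ϖ κ) W), IsWeight σ ∧
      ∃ q : Representation.IntertwiningMap (universalModule σ) ρ, Function.Surjective q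

end Valued

end U21

/-! Everything happens along one edge of the tree of `G`. Let `P` be the stabilizer of a vertex
adjacent to the one fixed by `K`, so that `I_K = K ∩ P`. Let `s = β_K ∈ K` and `s' ∈ P` be the
reflections at the two ends, so that `α = s' s`. For the Steinberg weight, `v₀` is fixed by `I_K`,
its translates over `K / I_K` sum to zero, and it generates `σ`. Writing `Σ_K`, `Σ_P` for sums of
translates over `K / I_K` and `P / I_K`, one has `f₁ = Σ_P f₀ - f₀`.

The computation that carries the proof is `T f₀ = Σ_K f₁ - f₁` (`IsEdgeDatum.heckeOperator_f₀`). It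
is checked cell by cell with the Bruhat decomposition of `K`, and uses that `j_σ` kills `s v₀`
(`proj_s_eq_zero`). Moreover the constant in `T_σ` is `-1` (`heckeConstant_eq_neg_one`), so `T` acts
by `-1` on a quotient of `ind σ / (T_σ)`.

Suppose `f₁ = r f₀` in a nonzero quotient. There `f₀ ≠ 0`, because `f₀` generates. Since `Σ_K f₀ =
0`, also `Σ_K f₁ = 0`, and the formula for `T f₀` gives `r = 1`. Hence `Σ_P f₀ = 2 f₀`. The left
side is `P`-invariant and `2` is invertible, so `f₀` is `P`-invariant, and then `Σ_P f₀ = |P / I_K|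
f₀ = f₀`, because the number of edges at a vertex is `1` modulo `p` (`card_quotient_modEq_one`). So
`2 f₀ = f₀`, a contradiction (`IsEdgeDatum.linearIndependent`).

For the second part, let `π` be a quotient of `ind σ / (T_σ)` containing the Steinberg weight. Both
`σ` and the Steinberg weight embed in `π`, and both have nonzero vectors fixed by the pro-`p` group
`I_{1,K}`. If `π^{I_{1,K}}` had dimension at most one, these vectors would be proportional and would
generate the same `K`-subrepresentation. Then `σ` would be Steinberg, and the first part would
produce two independent fixed vectors anyway. -/

set_option linter.unusedSectionVars false

namespace U21

/-! ### Arithmetic of the unramified quadratic extension. -/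

section Arithmetic

variable {F E : Type*} [Field F] [ValuativeRel F] [Field E] [ValuativeRel E] [Algebra F E]

/-- The arithmetic of an unramified quadratic extension that is used below: conjugation is an
isometry, `ϖ` generates the value group of `E`, and `E` contains a unit of trace zero. -/
structure IsUnramifiedConjugation (c : QuadraticConjugation F E) (ϖ : Uniformizer F) : Prop where
  val_conj : ∀ x, valuation E (c.toAlgEquiv x) = valuation E x
  val_unif_lt : valuation E (unifUnit E ϖ : E) < 1
  exists_zpow : ∀ x : E, x ≠ 0 → ∃ n : ℤ, valuation E x = valuation E (unifUnit E ϖ : E) ^ n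
  exists_traceZero : ∃ δ : E, valuation E δ = 1 ∧ c.toAlgEquiv δ = -δ

section

variable [ValuativeExtension F E]

lemma val_algebraMap_le_iff (a b : F) :
    valuation E (algebraMap F E a) ≤ valuation E (algebraMap F E b) ↔
      valuation F a ≤ valuation F b := by
  rw [← (valuation E).vle_iff_le, ← (valuation F).vle_iff_le, ValuativeExtension.vle_iff_vle]

lemma val_algebraMap_le_one_iff (a : F) :
    valuation E (algebraMap F E a) ≤ 1 ↔ valuation F a ≤ 1 := by
  simpa using val_algebraMap_le_iff (E := E) a 1

lemma val_algebraMap_lt_one_iff (a : F) :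
    valuation E (algebraMap F E a) < 1 ↔ valuation F a < 1 := by
  have := val_algebraMap_le_iff (E := E) 1 a
  simp only [map_one] at this
  rw [← not_le, this, not_le]

end

lemma mem_maximalIdeal_iff_val_lt_one (x : 𝒪[E]) :
    x ∈ 𝓂[E] ↔ valuation E (x : E) < 1 := by
  rw [IsLocalRing.mem_maximalIdeal, mem_nonunits_iff,
    (Valuation.integer.integers (valuation E)).isUnit_iff_valuation_eq_one]
  exact ⟨fun h => lt_of_le_of_ne x.2 h, fun h => h.ne⟩

/-- In degree two there is no proper intermediate subalgebra, so the fixed subalgebra of a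
non-trivial automorphism is `F` itself. -/
lemma _root_.QuadraticConjugation.mem_range_of_fixed (hdeg : Module.finrank F E = 2)
    (c : QuadraticConjugation F E) {x : E} (hx : c.toAlgEquiv x = x) :
    ∃ a : F, algebraMap F E a = x := by
  have := Subalgebra.isSimpleOrder_of_finrank hdeg
  rcases eq_bot_or_eq_top
    (AlgHom.equalizer (c.toAlgEquiv : E →ₐ[F] E) (AlgHom.id F E)) with h | h
  · have : x ∈ AlgHom.equalizer (c.toAlgEquiv : E →ₐ[F] E) (AlgHom.id F E) := by
      simpa using hx
    rw [h] at this
    exact Algebra.mem_bot.1 this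
  · exact absurd (AlgEquiv.ext fun y => by
      have : y ∈ AlgHom.equalizer (c.toAlgEquiv : E →ₐ[F] E) (AlgHom.id F E) := by
        rw [h]; trivial
      simpa using this) c.ne_refl

/-- Hensel's lemma at the residual root `0`, which is simple because the derivative there is `-1`.
-/
lemma exists_root_of_val_lt_one [TopologicalSpace F] [IsNonarchimedeanLocalField F] (a : F)
    (ha : valuation F a < 1) : ∃ y : F, y ^ 2 - y + a = 0 := by
  let _ := IsTopologicalAddGroup.rightUniformSpace F
  have := isUniformAddGroup_of_addCommGroup (G := F)
  have hens : HenselianRing 𝒪[F] 𝓂[F] := inferInstance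
  let a' : 𝒪[F] := ⟨a, ha.le⟩
  let f : Polynomial 𝒪[F] := Polynomial.X ^ 2 - Polynomial.X + Polynomial.C a'
  have hf : f.Monic := by
    have : f = Polynomial.X ^ 2 + (- Polynomial.X + Polynomial.C a') := by ring
    rw [this]
    apply Polynomial.monic_X_pow_add
    compute_degree!
  obtain ⟨y, hy, -⟩ := hens.is_henselian f hf 0 (by
    simp only [f, Polynomial.eval_add, Polynomial.eval_sub, Polynomial.eval_pow,
      Polynomial.eval_X, Polynomial.eval_C]
    rw [mem_maximalIdeal_iff_val_lt_one]
    simpa [a'] using ha) (by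
    simp [f])
  refine ⟨y, ?_⟩
  have := congrArg (Subtype.val : 𝒪[F] → F) hy
  simpa [f, Polynomial.IsRoot, a'] using this

variable [ValuativeExtension F E]

/-- If `x` were integral and `x̄` not, the trace `t` would have the size of `x̄` and `norm / t²`
would have valuation less than one. The characteristic polynomial of `x`, rescaled by `t`, would
then have a root in `F` by Hensel. Then `x` lies in `F`, so `x̄ = x`, which is absurd. -/
lemma _root_.QuadraticConjugation.val_le_one [TopologicalSpace F] [IsNonarchimedeanLocalField F]
    (hdeg : Module.finrank F E = 2) (c : QuadraticConjugation F E) {x : E}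
    (hx : valuation E x ≤ 1) : valuation E (c.toAlgEquiv x) ≤ 1 := by
  by_contra! hcx
  obtain ⟨t, ht⟩ := c.mem_range_of_fixed hdeg (x := x + c.toAlgEquiv x) (by
    rw [map_add, c.involutive, add_comm])
  obtain ⟨n, hn⟩ := c.mem_range_of_fixed hdeg (x := x * c.toAlgEquiv x) (by
    rw [map_mul, c.involutive, mul_comm])
  have hvt : valuation E (algebraMap F E t) = valuation E (c.toAlgEquiv x) := by
    rw [ht]
    exact Valuation.map_add_eq_of_lt_right _ (hx.trans_lt hcx)
  have hc0 : 0 < valuation E (c.toAlgEquiv x) := zero_lt_one.trans hcx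
  have ht0 : t ≠ 0 := by
    rintro rfl
    rw [map_zero, map_zero] at hvt
    exact hc0.ne hvt
  have hlt : valuation F (n / t ^ 2) < 1 := by
    rw [← val_algebraMap_lt_one_iff (E := E), map_div₀, map_pow, map_div₀, map_pow, hvt, hn,
      map_mul, div_lt_one₀ (pow_pos hc0 2), sq]
    exact mul_lt_mul_of_pos_right (hx.trans_lt hcx) hc0
  obtain ⟨y, hy⟩ := exists_root_of_val_lt_one _ hlt
  have hy' : (t * y) ^ 2 - t * (t * y) + n = 0 := by
    field_simp at hy
    linear_combination hy
  have h2 := congrArg (algebraMap F E) hy'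
  simp only [map_add, map_sub, map_mul, map_pow, map_zero] at h2
  rw [ht, hn, ← ht, ← map_mul] at h2
  have h3 : (algebraMap F E (t * y) - x) * (algebraMap F E (t * y) - c.toAlgEquiv x) = 0 := by
    rw [ht] at h2
    linear_combination h2
  have h4 : c.toAlgEquiv x = x := by
    rcases mul_eq_zero.1 h3 with h | h
    · rw [← sub_eq_zero.1 h, AlgEquiv.commutes]
    · have := congrArg c.toAlgEquiv (sub_eq_zero.1 h)
      rw [AlgEquiv.commutes, c.involutive] at this
      rw [← this, AlgEquiv.commutes]
  rw [h4] at hcx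
  exact absurd hx (not_le.2 hcx)

lemma exists_zpow_of_uniformizer [TopologicalSpace E] [IsNonarchimedeanLocalField E]
    (ϖ : Uniformizer E) {x : E} (hx : x ≠ 0) :
    ∃ n : ℤ, valuation E x = valuation E (ϖ.val : E) ^ n := by
  have key : ∀ y : 𝒪[E], y ≠ 0 → ∃ n : ℕ, valuation E (y : E) = valuation E (ϖ.val : E) ^ n := by
    intro y hy
    obtain ⟨n, u, hu⟩ := IsDiscreteValuationRing.associated_pow_irreducible hy ϖ.irreducible
    refine ⟨n, ?_⟩
    have h1 : valuation E ((u : 𝒪[E]) : E) = 1 :=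
      ((Valuation.integer.integers (valuation E)).isUnit_iff_valuation_eq_one).1 u.isUnit
    have := congrArg (fun z : 𝒪[E] => valuation E (z : E)) hu
    simpa [h1] using this
  rcases le_total (valuation E x) 1 with h | h
  · obtain ⟨n, hn⟩ := key ⟨x, h⟩ (by simpa [Subtype.ext_iff] using hx)
    exact ⟨n, by simpa using hn⟩
  · have h' : valuation E x⁻¹ ≤ 1 := by
      rw [map_inv₀]
      exact inv_le_one_of_one_le₀ h
    obtain ⟨n, hn⟩ := key ⟨x⁻¹, h'⟩ (by simpa [Subtype.ext_iff] using hx)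
    refine ⟨-n, ?_⟩
    rw [map_inv₀] at hn
    rw [zpow_neg, zpow_natCast, ← hn, inv_inv]

/-- Powers of `ϖ` are fixed by conjugation and exhaust the value group, so everything can be
rescaled to units. Conjugation is an isometry because it preserves integrality, and a trace-zero
unit is a rescaled difference `x - x̄ ≠ 0`. -/
lemma isUnramifiedConjugation [TopologicalSpace F] [IsNonarchimedeanLocalField F]
    [TopologicalSpace E] [IsNonarchimedeanLocalField E]
    (hdeg : Module.finrank F E = 2) (hunr : IsUnramifiedExtension F E)
    (c : QuadraticConjugation F E) (ϖ : Uniformizer F) : IsUnramifiedConjugation c ϖ := by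
  obtain ⟨ϖ', hϖ'⟩ := hunr ϖ
  have hz : ∀ x : E, x ≠ 0 → ∃ n : ℤ, valuation E x = valuation E (unifUnit E ϖ : E) ^ n := by
    intro x hx
    obtain ⟨n, hn⟩ := exists_zpow_of_uniformizer ϖ' hx
    exact ⟨n, by rw [hn, hϖ']; rfl⟩
  have hcz : ∀ n : ℤ, c.toAlgEquiv ((unifUnit E ϖ : E) ^ n) = (unifUnit E ϖ : E) ^ n := by
    intro n
    rw [map_zpow₀]
    simp [unifUnit]
  have hle : ∀ x, valuation E (c.toAlgEquiv x) ≤ valuation E x := by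
    intro x
    rcases eq_or_ne x 0 with rfl | hx
    · simp
    obtain ⟨n, hn⟩ := hz x hx
    have h1 : valuation E (x * (unifUnit E ϖ : E) ^ (-n)) ≤ 1 := by
      rw [map_mul, hn, map_zpow₀, ← zpow_add₀ (by simp)]
      simp
    have h2 := c.val_le_one hdeg h1
    rw [map_mul, hcz, map_mul, map_zpow₀, zpow_neg, ← div_eq_mul_inv, ← hn] at h2
    exact (div_le_one₀ (zero_lt_iff.2 (by simpa using hx))).1 h2
  refine ⟨fun x => le_antisymm (hle x) ?_, ?_, hz, ?_⟩
  · simpa [c.involutive] using hle (c.toAlgEquiv x)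
  · have := (mem_maximalIdeal_iff_val_lt_one ϖ'.val).1
      ((IsLocalRing.mem_maximalIdeal _).2 (mem_nonunits_iff.2 ϖ'.irreducible.not_isUnit))
    rw [hϖ'] at this
    exact this
  · obtain ⟨x, hx⟩ : ∃ x, c.toAlgEquiv x ≠ x := by
      by_contra! h
      exact c.ne_refl (AlgEquiv.ext h)
    have hd : x - c.toAlgEquiv x ≠ 0 := sub_ne_zero.2 hx.symm
    obtain ⟨n, hn⟩ := hz _ hd
    refine ⟨(x - c.toAlgEquiv x) * (unifUnit E ϖ : E) ^ (-n), ?_, ?_⟩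
    · rw [map_mul, hn, map_zpow₀, ← zpow_add₀ (by simp)]
      simp
    · rw [map_mul, hcz, map_sub, c.involutive]
      ring

lemma val_natCast_lt_one (p : ℕ) [CharP 𝓀[F] p] : valuation E (p : E) < 1 := by
  have h : ((p : 𝒪[F]) : 𝒪[F]) ∈ 𝓂[F] := by
    rw [← IsLocalRing.residue_eq_zero_iff, map_natCast, CharP.cast_eq_zero]
  rw [mem_maximalIdeal_iff_val_lt_one] at h
  have := (val_algebraMap_lt_one_iff (E := E) _).2 h
  simpa using this

lemma charP_residueField (p : ℕ) [hp : Fact p.Prime] [CharP 𝓀[F] p] : CharP 𝓀[E] p := by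
  apply (CharP.charP_iff_prime_eq_zero hp.out).2
  rw [← map_natCast (IsLocalRing.residue 𝒪[E]), IsLocalRing.residue_eq_zero_iff,
    mem_maximalIdeal_iff_val_lt_one]
  simpa using val_natCast_lt_one (F := F) (E := E) p

lemma val_two_eq_one (p : ℕ) [hp : Fact p.Prime] (hp2 : p ≠ 2) [CharP 𝓀[F] p] :
    valuation E (2 : E) = 1 := by
  have := charP_residueField (F := F) (E := E) p
  have h2 : (2 : 𝓀[E]) ≠ 0 := by
    have : Fact (2 < p) := ⟨lt_of_le_of_ne hp.out.two_le hp2.symm⟩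
    exact Ring.two_ne_zero (by rw [ringChar.eq 𝓀[E] p]; exact hp2)
  rw [← map_ofNat (IsLocalRing.residue 𝒪[E]), Ne, IsLocalRing.residue_eq_zero_iff,
    mem_maximalIdeal_iff_val_lt_one, not_lt] at h2
  exact le_antisymm (2 : 𝒪[E]).2 h2

/-- The residue of the trace-zero unit `δ` works. Its square `a` lies in `F`, and its residue is not
a square: if `a ≡ b²`, then `δ - b` and its conjugate `-(δ + b)` would both be small, against `2 δ`
being a unit. Euler's criterion gives `a^((q-1)/2) ≡ -1`, that is, `δ^q ≡ -δ`. -/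
lemma exists_residue_traceZero [TopologicalSpace F] [IsNonarchimedeanLocalField F]
    (p : ℕ) [hp : Fact p.Prime] (hp2 : p ≠ 2) [CharP 𝓀[F] p]
    (hdeg : Module.finrank F E = 2)
    {c : QuadraticConjugation F E} {ϖ : Uniformizer F} (h : IsUnramifiedConjugation c ϖ) :
    ∃ t : 𝓀[E], t ≠ 0 ∧ t + t ^ Nat.card 𝓀[F] = 0 := by
  classical
  obtain ⟨δ, hδ, hcδ⟩ := h.exists_traceZero
  obtain ⟨a, ha⟩ := c.mem_range_of_fixed hdeg (x := δ ^ 2) (by rw [map_pow, hcδ]; ring)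
  have hva : valuation E (algebraMap F E a) = 1 := by rw [ha, map_pow, hδ, one_pow]
  let a' : 𝒪[F] := ⟨a, (val_algebraMap_le_one_iff (E := E) a).1 hva.le⟩
  let d : 𝒪[E] := ⟨δ, hδ.le⟩
  have ha0 : IsLocalRing.residue 𝒪[F] a' ≠ 0 := by
    rw [Ne, IsLocalRing.residue_eq_zero_iff, mem_maximalIdeal_iff_val_lt_one,
      ← val_algebraMap_lt_one_iff (E := E), hva]
    exact lt_irrefl _
  let _ : Fintype 𝓀[F] := Fintype.ofFinite _
  have hchar : ringChar 𝓀[F] ≠ 2 := by rwa [ringChar.eq 𝓀[F] p]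
  have hnsq : ¬ IsSquare (IsLocalRing.residue 𝒪[F] a') := by
    rintro ⟨r, hr⟩
    obtain ⟨b, rfl⟩ := IsLocalRing.residue_surjective r
    rw [← map_mul, ← sub_eq_zero, ← map_sub, IsLocalRing.residue_eq_zero_iff,
      mem_maximalIdeal_iff_val_lt_one, ← val_algebraMap_lt_one_iff (E := E)] at hr
    have e1 : algebraMap F E ((a' - b * b : 𝒪[F]) : F) =
        (δ - algebraMap F E b) * (δ + algebraMap F E b) := by
      simp [a', ha]
      ring
    have e2 : c.toAlgEquiv (δ - algebraMap F E b) = -(δ + algebraMap F E b) := by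
      rw [map_sub, hcδ, AlgEquiv.commutes]; ring
    have e3 := h.val_conj (δ - algebraMap F E b)
    rw [e2, Valuation.map_neg] at e3
    rw [e1, map_mul, e3, ← sq] at hr
    have hlt : valuation E (δ - algebraMap F E b) < 1 := by
      by_contra! hge
      exact absurd hr (not_lt.2 (one_le_pow₀ hge))
    have := (valuation E).map_add_lt hlt (e3 ▸ hlt)
    rw [show δ - algebraMap F E b + (δ + algebraMap F E b) = 2 * δ by ring, map_mul, hδ,
      val_two_eq_one (F := F) p hp2, one_mul] at this
    exact lt_irrefl _ this
  rw [FiniteField.isSquare_iff hchar ha0] at hnsq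
  have hm1 := (FiniteField.pow_dichotomy hchar ha0).resolve_left hnsq
  refine ⟨IsLocalRing.residue 𝒪[E] d, ?_, ?_⟩
  · rw [Ne, IsLocalRing.residue_eq_zero_iff, mem_maximalIdeal_iff_val_lt_one]
    simp [d, hδ]
  · rw [← map_pow, ← sub_eq_zero, sub_zero, ← map_add, IsLocalRing.residue_eq_zero_iff,
      mem_maximalIdeal_iff_val_lt_one]
    rw [← sub_eq_zero, sub_neg_eq_add, ← map_pow, ← map_one (IsLocalRing.residue 𝒪[F]), ← map_add,
      IsLocalRing.residue_eq_zero_iff, mem_maximalIdeal_iff_val_lt_one,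
      ← val_algebraMap_lt_one_iff (E := E)] at hm1
    have hodd := Nat.two_mul_odd_div_two (FiniteField.odd_card_of_char_ne_two hchar)
    have hpos : 0 < Fintype.card 𝓀[F] := Fintype.card_pos
    have e : ((d + d ^ Nat.card 𝓀[F] : 𝒪[E]) : E) =
        δ * algebraMap F E ((a' ^ (Fintype.card 𝓀[F] / 2) + 1 : 𝒪[F]) : F) := by
      have : Nat.card 𝓀[F] = 2 * (Fintype.card 𝓀[F] / 2) + 1 := by
        rw [Nat.card_eq_fintype_card]; omega
      rw [this]
      simp [d, a', ha]
      ring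
    rw [e, map_mul, hδ, one_mul]
    exact hm1

end Arithmetic

end U21

namespace U21

/-! ### Unipotent elements and reflections in `U(2,1)`. -/

section Matrices

variable {F E : Type*} [Field F] [Field E] [Algebra F E]

lemma herm_single_left (c : QuadraticConjugation F E) (a : Fin 3) (w : Fin 3 → E) :
    herm c (Pi.single a 1) w = c.toAlgEquiv (w a.rev) := by
  rw [herm_eq]
  fin_cases a <;> simp [Fin.rev]

lemma herm_single_right (c : QuadraticConjugation F E) (v : Fin 3 → E) (b : Fin 3) :
    herm c v (Pi.single b 1) = v b.rev := by
  rw [herm_eq]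
  fin_cases b <;> simp [Fin.rev]

lemma coe_mul_val (c : QuadraticConjugation F E) (g g' : unitaryGroup c) :
    (g * g').1.val = g.1.val * g'.1.val := rfl

/-- This is `g⁻¹ = β ḡᵀ β` read entrywise. It turns bounds on `g` into bounds on `g⁻¹`, and
statements on the first column into statements on the last row. -/
lemma inv_apply (c : QuadraticConjugation F E) (g : unitaryGroup c) (i j : Fin 3) :
    (g⁻¹).1.val i j = c.toAlgEquiv (g.1.val j.rev i.rev) := by
  have h := g.2 (Pi.single i.rev 1) ((g⁻¹).1.val.mulVec (Pi.single j 1))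
  rw [Matrix.mulVec_mulVec, ← coe_mul_val, mul_inv_cancel, herm_single_left] at h
  have h1 : ((1 : unitaryGroup c).1.val) = 1 := rfl
  rw [h1, Matrix.one_mulVec, herm_single_right, Matrix.mulVec_single_one,
    Matrix.mulVec_single_one] at h
  simp only [Matrix.col_apply, Fin.rev_rev] at h
  rw [h, c.involutive]

/-- The first basis vector is isotropic, hence so is its image. -/
lemma isotropic_col (c : QuadraticConjugation F E) (g : unitaryGroup c) :
    g.1.val 0 0 * c.toAlgEquiv (g.1.val 2 0) + g.1.val 1 0 * c.toAlgEquiv (g.1.val 1 0) +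
      g.1.val 2 0 * c.toAlgEquiv (g.1.val 0 0) = 0 := by
  have h := g.2 (Pi.single 0 1) (Pi.single 0 1)
  rw [herm_single_left, Matrix.mulVec_single_one, herm_eq] at h
  simpa [Fin.rev] using h

/-- The unipotent element `[1, -x̄, y; 0, 1, x; 0, 0, 1]`. -/
def unip (c : QuadraticConjugation F E) (x y : E)
    (hxy : y + c.toAlgEquiv y + x * c.toAlgEquiv x = 0) : unitaryGroup c :=
  ⟨⟨!![1, -c.toAlgEquiv x, y; 0, 1, x; 0, 0, 1],
    !![1, c.toAlgEquiv x, c.toAlgEquiv y; 0, 1, -x; 0, 0, 1],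
    by
      ext i j
      fin_cases i <;> fin_cases j <;> simp [Matrix.mul_apply, Fin.sum_univ_three]
      linear_combination hxy,
    by
      ext i j
      fin_cases i <;> fin_cases j <;> simp [Matrix.mul_apply, Fin.sum_univ_three]
      linear_combination hxy⟩, by
    intro v w
    simp only [herm_eq, Matrix.mulVec, dotProduct, Fin.sum_univ_three, Matrix.of_apply,
      Matrix.cons_val', Matrix.cons_val_zero, Matrix.cons_val_one, Matrix.cons_val, map_add,
      map_mul, map_neg, map_zero, map_one, c.involutive]
    linear_combination (v 2 * c.toAlgEquiv (w 2)) * hxy⟩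

/-- The elements with `x = 0` are central in the unipotent group. They supply the element used to
count edges modulo `p`. -/
lemma unip_mul_unip_zero (c : QuadraticConjugation F E) {x y z : E}
    (hxy : y + c.toAlgEquiv y + x * c.toAlgEquiv x = 0)
    (hz : z + c.toAlgEquiv z + 0 * c.toAlgEquiv 0 = 0) :
    unip c x y hxy * unip c 0 z hz = unip c 0 z hz * unip c x y hxy := by
  apply Subtype.ext
  apply Units.ext
  change !![1, -c.toAlgEquiv x, y; 0, 1, x; 0, 0, 1] * !![1, -c.toAlgEquiv 0, z; 0, 1, 0; 0, 0, 1]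
    = !![1, -c.toAlgEquiv 0, z; 0, 1, 0; 0, 0, 1] * !![1, -c.toAlgEquiv x, y; 0, 1, x; 0, 0, 1]
  ext i j
  fin_cases i <;> fin_cases j <;> simp [Matrix.mul_apply, Fin.sum_univ_three, add_comm]

lemma unip_zero_pow (c : QuadraticConjugation F E) {z : E}
    (hz : z + c.toAlgEquiv z + 0 * c.toAlgEquiv 0 = 0) (n : ℕ)
    (hz' : (n * z : E) + c.toAlgEquiv (n * z) + 0 * c.toAlgEquiv 0 = 0) :
    unip c 0 z hz ^ n = unip c 0 (n * z) hz' := by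
  induction n with
  | zero =>
    apply Subtype.ext
    apply Units.ext
    ext i j
    fin_cases i <;> fin_cases j <;> simp [unip]
  | succ n ih =>
    rw [pow_succ, ih (by
      have h1 : z + c.toAlgEquiv z = 0 := by simpa using hz
      rw [map_mul, map_natCast]
      linear_combination (n : E) * h1)]
    apply Subtype.ext
    apply Units.ext
    rw [coe_mul_val]
    ext i j
    fin_cases i <;> fin_cases j <;> simp [unip, Matrix.mul_apply, Fin.sum_univ_three]
    ring

section

variable [ValuativeRel F]

/-- The reflection with matrix `[0, 0, ϖ⁻ᵐ; 0, 1, 0; ϖᵐ, 0, 0]`. -/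
def refl (c : QuadraticConjugation F E) (ϖ : Uniformizer F) (m : ℤ) : unitaryGroup c :=
  ⟨⟨!![0, 0, (unifUnit E ϖ : E) ^ (-m); 0, 1, 0; (unifUnit E ϖ : E) ^ m, 0, 0],
    !![0, 0, (unifUnit E ϖ : E) ^ (-m); 0, 1, 0; (unifUnit E ϖ : E) ^ m, 0, 0],
    by
      have h0 : (unifUnit E ϖ : E) ^ m ≠ 0 := zpow_ne_zero _ (unifUnit E ϖ).ne_zero
      ext i j
      fin_cases i <;> fin_cases j <;> simp [Matrix.mul_apply, Fin.sum_univ_three, h0],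
    by
      have h0 : (unifUnit E ϖ : E) ^ m ≠ 0 := zpow_ne_zero _ (unifUnit E ϖ).ne_zero
      ext i j
      fin_cases i <;> fin_cases j <;> simp [Matrix.mul_apply, Fin.sum_univ_three, h0]⟩, by
    intro v w
    have h0 : (unifUnit E ϖ : E) ^ m ≠ 0 := zpow_ne_zero _ (unifUnit E ϖ).ne_zero
    have hc : c.toAlgEquiv (unifUnit E ϖ : E) = (unifUnit E ϖ : E) := by simp [unifUnit]
    simp only [herm_eq, Matrix.mulVec, dotProduct, Fin.sum_univ_three, Matrix.of_apply,
      Matrix.cons_val', Matrix.cons_val_zero, Matrix.cons_val_one, Matrix.cons_val, map_add,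
      map_mul, map_zero, map_one, map_zpow₀, hc, zpow_neg, map_inv₀]
    field_simp
    ring⟩

lemma refl_mul_self (c : QuadraticConjugation F E) (ϖ : Uniformizer F) (m : ℤ) :
    refl c ϖ m * refl c ϖ m = 1 :=
  Subtype.ext (Units.ext (refl c ϖ m).1.val_inv)

lemma refl_inv (c : QuadraticConjugation F E) (ϖ : Uniformizer F) (m : ℤ) :
    (refl c ϖ m)⁻¹ = refl c ϖ m :=
  inv_eq_of_mul_eq_one_left (refl_mul_self c ϖ m)

/-- The translation `α` is the product of the reflections at the two ends of any edge of the
standard apartment, whichever edge is taken. -/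
lemma refl_succ_mul_refl (c : QuadraticConjugation F E) (ϖ : Uniformizer F) (m : ℤ) :
    refl c ϖ (m + 1) * refl c ϖ m = alphaElt c ϖ := by
  have h0 : (unifUnit E ϖ : E) ≠ 0 := (unifUnit E ϖ).ne_zero
  have h1 : (unifUnit E ϖ : E) ^ m ≠ 0 := zpow_ne_zero _ h0
  apply Subtype.ext
  apply Units.ext
  rw [coe_mul_val]
  ext i j
  fin_cases i <;> fin_cases j <;>
    simp [refl, alphaElt, diagGL, Matrix.mul_apply, Fin.sum_univ_three, zpow_add₀, h0]
  all_goals field_simp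

lemma refl_conj_apply (c : QuadraticConjugation F E) (ϖ : Uniformizer F) (m : ℤ)
    (g : unitaryGroup c) (i j : Fin 3) :
    (refl c ϖ m * g * refl c ϖ m).1.val i j =
      (unifUnit E ϖ : E) ^ (((i : ℕ) - (j : ℕ) : ℤ) * m) * g.1.val i.rev j.rev := by
  have h0 : (unifUnit E ϖ : E) ≠ 0 := (unifUnit E ϖ).ne_zero
  have h1 : (unifUnit E ϖ : E) ^ m ≠ 0 := zpow_ne_zero _ h0
  have h2 : (unifUnit E ϖ : E) ^ (2 * m) = (unifUnit E ϖ : E) ^ m * (unifUnit E ϖ : E) ^ m := by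
    rw [two_mul, zpow_add₀ h0]
  rw [coe_mul_val, coe_mul_val]
  simp only [Matrix.mul_apply, Fin.sum_univ_three]
  fin_cases i <;> fin_cases j <;> simp [refl, Fin.rev, -mul_eq_mul_left_iff, -mul_eq_mul_right_iff]
  all_goals (try simp only [h2])
  all_goals field_simp

end

end Matrices

end U21

namespace U21

/-! ### Parahoric subgroups along the standard apartment and the Bruhat decomposition. -/

section Parahoric

variable {F E : Type*} [Field F] [ValuativeRel F] [Field E] [ValuativeRel E] [Algebra F E]
  {c : QuadraticConjugation F E} {ϖ : Uniformizer F}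

/-- Exponents of the parahoric subgroup attached to the point `m / 2` of the standard apartment. -/
def expP (m : ℤ) (i j : Fin 3) : ℤ := -(((j : ℕ) - (i : ℕ) : ℤ) * m / 2)

lemma expP_add_le (m : ℤ) (i j l : Fin 3) : expP m i l ≤ expP m i j + expP m j l := by
  fin_cases i <;> fin_cases j <;> fin_cases l <;> simp [expP] <;> omega

lemma expP_rev (m : ℤ) (i j : Fin 3) : expP m j.rev i.rev = expP m i j := by
  fin_cases i <;> fin_cases j <;> simp [expP, Fin.rev]

/-- The index of the vertex fixed by `K`. -/
def mIdx : MaxCompactKind → ℤ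
  | .hyperspecial => 0
  | .nonhyperspecial => 1

lemma expK_eq (κ : MaxCompactKind) : expK κ = expP (mIdx κ) := by
  cases κ <;> ext i j <;> fin_cases i <;> fin_cases j <;> simp [expK, expP, mIdx]

lemma expI_eq (κ : MaxCompactKind) (i j : Fin 3) :
    expI κ i j = max (expP (mIdx κ) i j) (expP (mIdx κ + 1) i j) := by
  cases κ <;> fin_cases i <;> fin_cases j <;> simp [expI, expP, mIdx]

lemma val_unifUnit_ne_zero : valuation E (unifUnit E ϖ : E) ≠ 0 := by simp

lemma val_unifUnit_pos : 0 < valuation E (unifUnit E ϖ : E) :=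
  zero_lt_iff.2 val_unifUnit_ne_zero

lemma IsUnramifiedConjugation.zpow_le_iff (h : IsUnramifiedConjugation c ϖ) {a b : ℤ} :
    valuation E (unifUnit E ϖ : E) ^ a ≤ valuation E (unifUnit E ϖ : E) ^ b ↔ b ≤ a :=
  zpow_le_zpow_iff_right_of_lt_one₀ val_unifUnit_pos h.val_unif_lt

lemma IsUnramifiedConjugation.zpow_lt_iff (h : IsUnramifiedConjugation c ϖ) {a b : ℤ} :
    valuation E (unifUnit E ϖ : E) ^ a < valuation E (unifUnit E ϖ : E) ^ b ↔ b < a :=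
  zpow_lt_zpow_iff_right_of_lt_one₀ val_unifUnit_pos h.val_unif_lt

lemma InLattice.mono (h : IsUnramifiedConjugation c ϖ) {e e' : Fin 3 → Fin 3 → ℤ}
    (hle : ∀ i j, e' i j ≤ e i j) {A : Matrix (Fin 3) (Fin 3) E} (hA : InLattice ϖ e A) :
    InLattice ϖ e' A :=
  fun i j => (hA i j).trans (h.zpow_le_iff.2 (hle i j))

lemma inLattice_inv_sub_one (h : IsUnramifiedConjugation c ϖ) {e : Fin 3 → Fin 3 → ℤ}
    (hsym : ∀ i j, e j.rev i.rev = e i j) {g : unitaryGroup c}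
    (hg : InLattice ϖ e (g.1.val - 1)) : InLattice ϖ e ((g⁻¹).1.val - 1) := by
  intro i j
  have := hg j.rev i.rev
  rw [hsym] at this
  rw [Matrix.sub_apply, inv_apply]
  have h1 : (1 : Matrix (Fin 3) (Fin 3) E) i j =
      c.toAlgEquiv ((1 : Matrix (Fin 3) (Fin 3) E) j.rev i.rev) := by
    by_cases hij : i = j
    · rw [hij, Matrix.one_apply_eq, Matrix.one_apply_eq, map_one]
    · rw [Matrix.one_apply_ne hij, Matrix.one_apply_ne (by simpa using Ne.symm hij), map_zero]
  rw [h1, ← map_sub, h.val_conj]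
  exact this

variable [ValuativeExtension F E]

lemma mem_congruenceSubgroup_iff (h : IsUnramifiedConjugation c ϖ) {e : Fin 3 → Fin 3 → ℤ}
    (he : ∀ i j l, e i l ≤ e i j + e j l) (hsym : ∀ i j, e j.rev i.rev = e i j)
    {g : unitaryGroup c} :
    g ∈ congruenceSubgroup c ϖ e he ↔ InLattice ϖ e (g.1.val - 1) :=
  ⟨fun hg => hg.1, fun hg => ⟨hg, inLattice_inv_sub_one h hsym hg⟩⟩

lemma inLattice_sub_one_iff {e : Fin 3 → Fin 3 → ℤ} (he : ∀ i, e i i ≤ 0)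
    {A : Matrix (Fin 3) (Fin 3) E} : InLattice ϖ e (A - 1) ↔ InLattice ϖ e A := by
  have h1 : InLattice ϖ e (1 : Matrix (Fin 3) (Fin 3) E) := by
    intro i j
    by_cases hij : i = j
    · subst hij
      rw [Matrix.one_apply_eq, map_one]
      exact one_le_zpow_of_nonpos₀ val_unifUnit_pos (valuation_unifUnit_le_one ϖ) (he i)
    · simp [Matrix.one_apply_ne hij]
  have hn : InLattice ϖ e (-1 : Matrix (Fin 3) (Fin 3) E) := by
    intro i j
    rw [Matrix.neg_apply, Valuation.map_neg]
    exact h1 i j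
  exact ⟨fun h => by simpa using h.add h1, fun h => by simpa [sub_eq_add_neg] using h.add hn⟩

variable (c ϖ) in
/-- The parahoric subgroup attached to the point `m / 2` of the standard apartment. -/
def parahoric (m : ℤ) : Subgroup (unitaryGroup c) :=
  congruenceSubgroup c ϖ (expP m) (expP_add_le m)

lemma mem_parahoric_iff (h : IsUnramifiedConjugation c ϖ) {m : ℤ} {g : unitaryGroup c} :
    g ∈ parahoric c ϖ m ↔ InLattice ϖ (expP m) g.1.val := by
  rw [parahoric, mem_congruenceSubgroup_iff h _ (expP_rev m),
    inLattice_sub_one_iff (by intro i; simp [expP])]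

lemma maxCompact_eq (κ : MaxCompactKind) : maxCompact c ϖ κ = parahoric c ϖ (mIdx κ) := by
  ext g
  simp only [maxCompact, parahoric, expK_eq]

lemma inLattice_max_iff (h : IsUnramifiedConjugation c ϖ) {e e' e'' : Fin 3 → Fin 3 → ℤ}
    (he : ∀ i j, e'' i j = max (e i j) (e' i j)) {A : Matrix (Fin 3) (Fin 3) E} :
    InLattice ϖ e'' A ↔ InLattice ϖ e A ∧ InLattice ϖ e' A := by
  refine ⟨fun hA => ⟨hA.mono h fun i j => ?_, hA.mono h fun i j => ?_⟩, fun hA i j => ?_⟩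
  · rw [he]; exact le_max_left _ _
  · rw [he]; exact le_max_right _ _
  · rw [he]
    rcases max_cases (e i j) (e' i j) with hm | hm <;> rw [hm.1]
    · exact hA.1 i j
    · exact hA.2 i j

/-- The Iwahori subgroup fixes an edge: its exponents are the maxima of those of the two end
vertices. -/
lemma iwahori_eq (h : IsUnramifiedConjugation c ϖ) (κ : MaxCompactKind) :
    iwahori c ϖ κ = parahoric c ϖ (mIdx κ) ⊓ parahoric c ϖ (mIdx κ + 1) := by
  ext g
  have h1 := inLattice_max_iff h (expI_eq κ) (A := g.1.val - 1)
  have h2 := inLattice_max_iff h (expI_eq κ) (A := (g⁻¹).1.val - 1)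
  exact ⟨fun hg => ⟨⟨(h1.1 hg.1).1, (h2.1 hg.2).1⟩, ⟨(h1.1 hg.1).2, (h2.1 hg.2).2⟩⟩,
    fun hg => ⟨h1.2 ⟨hg.1.1, hg.2.1⟩, h2.2 ⟨hg.1.2, hg.2.2⟩⟩⟩

lemma proPIwahori_le_iwahori (h : IsUnramifiedConjugation c ϖ) (κ : MaxCompactKind) :
    proPIwahori c ϖ κ ≤ iwahori c ϖ κ := by
  have : ∀ i j, expI κ i j ≤ expI1 κ i j := by
    intro i j
    cases κ <;> fin_cases i <;> fin_cases j <;> simp [expI1, expI]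
  exact fun g hg => ⟨hg.1.mono h this, hg.2.mono h this⟩

lemma inLattice_refl_conj {e e' : Fin 3 → Fin 3 → ℤ} {m : ℤ}
    (he : ∀ i j : Fin 3, e i j = e' i.rev j.rev + ((i : ℕ) - (j : ℕ) : ℤ) * m)
    {g : unitaryGroup c} (hg : InLattice ϖ e' (g.1.val - 1)) :
    InLattice ϖ e ((refl c ϖ m * g * refl c ϖ m).1.val - 1) := by
  intro i j
  have h1 : ((refl c ϖ m * g * refl c ϖ m).1.val - 1) i j =
      (unifUnit E ϖ : E) ^ (((i : ℕ) - (j : ℕ) : ℤ) * m) * (g.1.val - 1) i.rev j.rev := by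
    rw [Matrix.sub_apply, refl_conj_apply, Matrix.sub_apply, mul_sub]
    congr 1
    by_cases hij : i = j
    · rw [hij, Matrix.one_apply_eq, Matrix.one_apply_eq, sub_self, zero_mul, zpow_zero, one_mul]
    · rw [Matrix.one_apply_ne hij, Matrix.one_apply_ne (by simpa using hij), mul_zero]
  rw [h1, map_mul, map_zpow₀, he, add_comm, zpow_add₀ val_unifUnit_ne_zero]
  gcongr
  exact hg _ _

lemma refl_conj_mem {e e' : Fin 3 → Fin 3 → ℤ} {m : ℤ}
    (he : ∀ i j : Fin 3, e i j = e' i.rev j.rev + ((i : ℕ) - (j : ℕ) : ℤ) * m)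
    {h1 : ∀ i j l, e i l ≤ e i j + e j l} {h2 : ∀ i j l, e' i l ≤ e' i j + e' j l}
    {g : unitaryGroup c} (hg : g ∈ congruenceSubgroup c ϖ e' h2) :
    refl c ϖ m * g * refl c ϖ m ∈ congruenceSubgroup c ϖ e h1 := by
  refine ⟨inLattice_refl_conj he hg.1, ?_⟩
  have : (refl c ϖ m * g * refl c ϖ m)⁻¹ = refl c ϖ m * g⁻¹ * refl c ϖ m := by
    simp [refl_inv, mul_assoc]
  rw [this]
  exact inLattice_refl_conj he hg.2

/-- On the apartment, the reflection at `m` sends the vertex `n` to `2 m - n`. -/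
lemma refl_conj_mem_parahoric {m n n' : ℤ} (hn : n' = 2 * m - n) {g : unitaryGroup c}
    (hg : g ∈ parahoric c ϖ n) : refl c ϖ m * g * refl c ϖ m ∈ parahoric c ϖ n' := by
  refine refl_conj_mem (fun i j => ?_) hg
  subst hn
  fin_cases i <;> fin_cases j <;> simp [expP, Fin.rev] <;> omega

lemma refl_mem_parahoric (h : IsUnramifiedConjugation c ϖ) (m : ℤ) :
    refl c ϖ m ∈ parahoric c ϖ m := by
  rw [mem_parahoric_iff h]
  intro i j
  fin_cases i <;> fin_cases j <;> simp [refl, expP]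
  rw [← zpow_neg]
  exact le_of_eq (congrArg _ (by omega))

lemma refl_conj_mem_proPIwahori' (κ : MaxCompactKind) {g : unitaryGroup c}
    (hg : g ∈ proPIwahori c ϖ κ) :
    refl c ϖ (mIdx κ) * g * refl c ϖ (mIdx κ) ∈ proPIwahori' c ϖ κ := by
  refine refl_conj_mem (fun i j => ?_) hg
  cases κ <;> fin_cases i <;> fin_cases j <;> simp [expI1, expI1', Fin.rev, mIdx]

lemma betaK_eq_refl (κ : MaxCompactKind) : betaK c ϖ κ = refl c ϖ (mIdx κ) := by
  cases κ
  · apply Subtype.ext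
    apply Units.ext
    ext i j
    fin_cases i <;> fin_cases j <;> simp [betaK, betaElt, betaMatrix, refl, mIdx]
  · apply Subtype.ext
    apply Units.ext
    rw [betaK_val_nonhyperspecial]
    ext i j
    fin_cases i <;> fin_cases j <;> simp [refl, mIdx, unifUnit]

/-- The unipotent elements of `parahoric c ϖ m`. -/
structure IsUnipIn (ϖ : Uniformizer F) (m : ℤ) (x y : E) : Prop where
  val_x : valuation E x ≤ valuation E (unifUnit E ϖ : E) ^ (-(m / 2))
  val_y : valuation E y ≤ valuation E (unifUnit E ϖ : E) ^ (-m)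

lemma unip_mem_congruenceSubgroup (h : IsUnramifiedConjugation c ϖ) {m : ℤ} {x y : E}
    (hxy : y + c.toAlgEquiv y + x * c.toAlgEquiv x = 0) (hm : IsUnipIn ϖ m x y)
    {e : Fin 3 → Fin 3 → ℤ} (he : ∀ i j l, e i l ≤ e i j + e j l)
    (hsym : ∀ i j, e j.rev i.rev = e i j) (hx : e 0 1 ≤ -(m / 2)) (hy : e 0 2 ≤ -m) :
    unip c x y hxy ∈ congruenceSubgroup c ϖ e he := by
  rw [mem_congruenceSubgroup_iff h he hsym]
  have hx' := hm.val_x.trans (h.zpow_le_iff.2 hx)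
  have hy' := hm.val_y.trans (h.zpow_le_iff.2 hy)
  have h12 : e 1 2 = e 0 1 := hsym 0 1
  intro i j
  fin_cases i <;> fin_cases j <;> simp [unip, h.val_conj, hx', hy', h12]

lemma unip_mem_proPIwahori (h : IsUnramifiedConjugation c ϖ) {κ : MaxCompactKind} {x y : E}
    (hxy : y + c.toAlgEquiv y + x * c.toAlgEquiv x = 0) (hm : IsUnipIn ϖ (mIdx κ) x y) :
    unip c x y hxy ∈ proPIwahori c ϖ κ := by
  refine unip_mem_congruenceSubgroup h hxy hm _ (fun i j => ?_) ?_ ?_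
  · cases κ <;> fin_cases i <;> fin_cases j <;> simp [expI1, Fin.rev]
  all_goals cases κ <;> simp [expI1, mIdx]

lemma unip_mem_parahoric (h : IsUnramifiedConjugation c ϖ) {m n : ℤ} (hmn : m ≤ n) {x y : E}
    (hxy : y + c.toAlgEquiv y + x * c.toAlgEquiv x = 0) (hm : IsUnipIn ϖ m x y) :
    unip c x y hxy ∈ parahoric c ϖ n := by
  refine unip_mem_congruenceSubgroup h hxy hm _ (expP_rev n) ?_ ?_
  all_goals simp [expP]; omega

/-- Isotropy of the first column expresses the norm of the middle entry through the product of the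
outer ones. Small bottom entry thus forces small middle entry, with the exponent halved and rounded
up, which is exactly what `expP` prescribes. -/
lemma val_col_of_mem (h : IsUnramifiedConjugation c ϖ) {m : ℤ} {g : unitaryGroup c}
    (hg : g ∈ parahoric c ϖ m)
    (h31 : valuation E (g.1.val 2 0) ≤ valuation E (unifUnit E ϖ : E) ^ (m + 1)) :
    valuation E (g.1.val 1 0) ≤ valuation E (unifUnit E ϖ : E) ^ expP (m + 1) 1 0 := by
  rw [mem_parahoric_iff h] at hg
  have h00 : valuation E (g.1.val 0 0) ≤ 1 := by simpa [expP] using hg 0 0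
  have hiso := isotropic_col c g
  have hsq : valuation E (g.1.val 1 0) ^ 2 ≤ valuation E (unifUnit E ϖ : E) ^ (m + 1) := by
    have e1 : g.1.val 1 0 * c.toAlgEquiv (g.1.val 1 0) =
        -(g.1.val 0 0 * c.toAlgEquiv (g.1.val 2 0) + g.1.val 2 0 * c.toAlgEquiv (g.1.val 0 0)) := by
      linear_combination hiso
    have e2 := congrArg (valuation E) e1
    rw [map_mul, h.val_conj, ← sq, Valuation.map_neg] at e2
    rw [e2]
    refine (valuation E).map_add_le ?_ ?_
    · rw [map_mul, h.val_conj]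
      exact (mul_le_of_le_one_left' h00).trans h31
    · rw [map_mul, h.val_conj]
      exact (mul_le_of_le_one_right' h00).trans h31
  rcases eq_or_ne (g.1.val 1 0) 0 with h0 | h0
  · simp [h0]
  · obtain ⟨n, hn⟩ := h.exists_zpow _ h0
    rw [hn, ← zpow_natCast, ← zpow_mul, h.zpow_le_iff] at hsq
    rw [hn, h.zpow_le_iff]
    simp [expP]
    push_cast at hsq
    omega

/-- The bottom left entry is the only obstruction. The two entries just below the diagonal are
controlled by isotropy, applied to `g` and to `g⁻¹`; the conditions on all others only get weaker
from `m` to `m + 1`. -/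
lemma mem_parahoric_succ (h : IsUnramifiedConjugation c ϖ) {m : ℤ} {g : unitaryGroup c}
    (hg : g ∈ parahoric c ϖ m)
    (h31 : valuation E (g.1.val 2 0) ≤ valuation E (unifUnit E ϖ : E) ^ (m + 1)) :
    g ∈ parahoric c ϖ (m + 1) := by
  have h21 := val_col_of_mem h hg h31
  have h32 := val_col_of_mem h (inv_mem hg) (by
    rw [inv_apply, h.val_conj]
    exact h31)
  rw [inv_apply, h.val_conj] at h32
  rw [mem_parahoric_iff h] at hg ⊢
  have key : ∀ i j, expP (m + 1) i j ≤ expP m i j → valuation E (g.1.val i j) ≤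
      valuation E (unifUnit E ϖ : E) ^ expP (m + 1) i j :=
    fun i j hij => (hg i j).trans (h.zpow_le_iff.2 hij)
  intro i j
  fin_cases i <;> fin_cases j
  · exact key 0 0 (by simp [expP])
  · exact key 0 1 (by simp [expP]; try omega)
  · exact key 0 2 (by simp [expP])
  · exact h21
  · exact key 1 1 (by simp [expP])
  · exact key 1 2 (by simp [expP]; omega)
  · have e : expP (m + 1) 2 0 = m + 1 := by
      simp [expP]
      omega
    change _ ≤ _ ^ expP (m + 1) 2 0
    rw [e]
    exact h31
  · exact h32
  · exact key 2 2 (by simp [expP])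

/-- The Bruhat decomposition `K = I ∪ N s I` of a maximal parahoric subgroup. -/
lemma bruhat (h : IsUnramifiedConjugation c ϖ) {m : ℤ} {g : unitaryGroup c}
    (hg : g ∈ parahoric c ϖ m) :
    g ∈ parahoric c ϖ (m + 1) ∨
      ∃ (x y : E) (hxy : y + c.toAlgEquiv y + x * c.toAlgEquiv x = 0), IsUnipIn ϖ m x y ∧
        ∃ i ∈ parahoric c ϖ m ⊓ parahoric c ϖ (m + 1),
          g = unip c x y hxy * refl c ϖ m * i := by
  by_cases h31 : valuation E (g.1.val 2 0) ≤ valuation E (unifUnit E ϖ : E) ^ (m + 1)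
  · exact Or.inl (mem_parahoric_succ h hg h31)
  right
  have hgl := (mem_parahoric_iff h).1 hg
  have hc0 : g.1.val 2 0 ≠ 0 := by
    rintro h0
    simp [h0] at h31
  have hv : valuation E (g.1.val 2 0) = valuation E (unifUnit E ϖ : E) ^ m := by
    obtain ⟨n, hn⟩ := h.exists_zpow _ hc0
    have h1 := hgl 2 0
    rw [hn, h.zpow_le_iff] at h1
    rw [hn, h.zpow_le_iff] at h31
    simp [expP] at h1
    rw [hn]
    congr 1
    omega
  have hcc : c.toAlgEquiv (g.1.val 2 0) ≠ 0 := by simpa using hc0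
  have hiso := isotropic_col c g
  -- The unipotent is chosen so that its last column is the first column of `g` divided by the
  -- bottom entry.
  have hxy : g.1.val 0 0 / g.1.val 2 0 + c.toAlgEquiv (g.1.val 0 0 / g.1.val 2 0) +
      g.1.val 1 0 / g.1.val 2 0 * c.toAlgEquiv (g.1.val 1 0 / g.1.val 2 0) = 0 := by
    rw [map_div₀, map_div₀]
    field_simp
    linear_combination hiso
  have hm : IsUnipIn ϖ m (g.1.val 1 0 / g.1.val 2 0) (g.1.val 0 0 / g.1.val 2 0) := by
    constructor
    · rw [map_div₀, hv, div_le_iff₀ (zpow_pos val_unifUnit_pos _),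
        ← zpow_add₀ val_unifUnit_ne_zero]
      refine (hgl 1 0).trans (h.zpow_le_iff.2 ?_)
      simp [expP]
      omega
    · rw [map_div₀, hv, div_le_iff₀ (zpow_pos val_unifUnit_pos _),
        ← zpow_add₀ val_unifUnit_ne_zero]
      refine (hgl 0 0).trans (h.zpow_le_iff.2 ?_)
      simp [expP]
  -- The inverse unipotent moves the first column of `g` to a multiple of the last basis vector, and
  -- the reflection moves that to a multiple of the first one. The bottom left entry is therefore
  -- zero.
  refine ⟨_, _, hxy, hm, refl c ϖ m * (unip c _ _ hxy)⁻¹ * g, ?_, ?_⟩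
  · have hK : refl c ϖ m * (unip c _ _ hxy)⁻¹ * g ∈ parahoric c ϖ m :=
      mul_mem (mul_mem (refl_mem_parahoric h m) (inv_mem (unip_mem_parahoric h le_rfl hxy hm))) hg
    refine ⟨hK, mem_parahoric_succ h hK ?_⟩
    have : (refl c ϖ m * (unip c _ _ hxy)⁻¹ * g).1.val 2 0 = 0 := by
      rw [mul_assoc, coe_mul_val, coe_mul_val]
      simp only [Matrix.mul_apply, Fin.sum_univ_three, inv_apply]
      simp [refl, unip, Fin.rev, c.involutive]
      right
      rw [map_div₀] at hxy
      field_simp at hxy ⊢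
      linear_combination hiso
    rw [this, map_zero]
    exact zero_le
  · rw [mul_assoc, mul_assoc, ← mul_assoc (refl c ϖ m), refl_mul_self, one_mul,
      mul_inv_cancel_left]

end Parahoric

end U21

namespace U21

/-! ### The opposite Bruhat decomposition and the number of edges at a vertex modulo `p`. -/

section Index

/-- The element `u` permutes `A / B` with `p`-th power trivial, and the base point is its only fixed
point; all other orbits have `p` elements. -/
lemma card_quotient_modEq_one_of_conj {A : Type*} [Group A] (B : Subgroup A) [Finite (A ⧸ B)]
    {p : ℕ} [hp : Fact p.Prime] (u : A) (hup : ∀ g, g⁻¹ * u ^ p * g ∈ B)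
    (hu : ∀ g, g⁻¹ * u * g ∈ B ↔ g ∈ B) : Nat.card (A ⧸ B) ≡ 1 [MOD p] := by
  classical
  let _ : Fintype (A ⧸ B) := Fintype.ofFinite _
  have hfix : ∀ a g : A, a • (QuotientGroup.mk g : A ⧸ B) = QuotientGroup.mk g ↔
      g⁻¹ * a * g ∈ B := by
    intro a g
    rw [eq_comm, MulAction.Quotient.smul_mk, QuotientGroup.eq, smul_eq_mul, mul_assoc]
  have hσp : (MulAction.toPermHom A (A ⧸ B) u) ^ p ^ 1 = 1 := by
    rw [← map_pow, pow_one]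
    ext x
    induction x using QuotientGroup.induction_on with
    | H g => exact (hfix _ _).2 (hup g)
  rw [Nat.card_eq_fintype_card]
  refine (Equiv.Perm.card_compl_support_modEq hσp).symm.trans ?_
  have : (MulAction.toPermHom A (A ⧸ B) u).supportᶜ = {(QuotientGroup.mk 1 : A ⧸ B)} := by
    ext x
    induction x using QuotientGroup.induction_on with
    | H g =>
    rw [Finset.mem_compl, Equiv.Perm.mem_support, not_not, Finset.mem_singleton,
      eq_comm (b := (QuotientGroup.mk 1 : A ⧸ B)), QuotientGroup.eq, inv_one, one_mul, ← hu]
    exact hfix u g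
  rw [this, Finset.card_singleton]

variable {F E : Type*} [Field F] [ValuativeRel F] [Field E] [ValuativeRel E] [Algebra F E]
  {c : QuadraticConjugation F E} {ϖ : Uniformizer F} [ValuativeExtension F E]

lemma refl_conj_unip_mem (h : IsUnramifiedConjugation c ϖ) {k n : ℤ} {x y : E}
    (hxy : y + c.toAlgEquiv y + x * c.toAlgEquiv x = 0) (hm : IsUnipIn ϖ k x y)
    {e : Fin 3 → Fin 3 → ℤ} (he : ∀ i j l, e i l ≤ e i j + e j l)
    (hsym : ∀ i j, e j.rev i.rev = e i j) (hx : e 1 0 ≤ n + -(k / 2)) (hy : e 2 0 ≤ 2 * n + -k) :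
    refl c ϖ n * unip c x y hxy * refl c ϖ n ∈ congruenceSubgroup c ϖ e he := by
  rw [mem_congruenceSubgroup_iff h he hsym]
  have hx' : valuation E (unifUnit E ϖ : E) ^ n * valuation E x ≤
      valuation E (unifUnit E ϖ : E) ^ e 1 0 := by
    refine le_trans ?_ (h.zpow_le_iff.2 hx)
    rw [zpow_add₀ val_unifUnit_ne_zero]
    gcongr
    exact hm.val_x
  have hy' : valuation E (unifUnit E ϖ : E) ^ (2 * n) * valuation E y ≤
      valuation E (unifUnit E ϖ : E) ^ e 2 0 := by
    refine le_trans ?_ (h.zpow_le_iff.2 hy)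
    rw [zpow_add₀ val_unifUnit_ne_zero]
    gcongr
    exact hm.val_y
  have h12 : e 2 1 = e 1 0 := hsym 1 0
  intro i j
  rw [Matrix.sub_apply, refl_conj_apply]
  fin_cases i <;> fin_cases j <;> simp [unip, h.val_conj, hx', hy', h12, Fin.rev]

/-- The reflection `s'` at `m + 1` exchanges the edges towards `m` and `m + 2`. The Bruhat
decomposition relative to the latter, applied to `s' g⁻¹ s'`, therefore gives one relative to the
former. Passing to the inverse puts the unipotent factor on the right, and conjugation by `s'` makes
it lower triangular in `I_{1,K}`. -/
lemma bruhat_opposite (h : IsUnramifiedConjugation c ϖ) {κ : MaxCompactKind} {g : unitaryGroup c}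
    (hg : g ∈ parahoric c ϖ (mIdx κ + 1)) :
    g ∈ parahoric c ϖ (mIdx κ) ∨ ∃ i ∈ iwahori c ϖ κ, ∃ y ∈ proPIwahori c ϖ κ,
      g = i * refl c ϖ (mIdx κ + 1) * y := by
  set m := mIdx κ with hmκ
  set s := refl c ϖ (m + 1) with hs
  have hss : s * s = 1 := refl_mul_self c ϖ (m + 1)
  have hsm : s ∈ parahoric c ϖ (m + 1) := refl_mem_parahoric h _
  rcases bruhat h (mul_mem (mul_mem hsm (inv_mem hg)) hsm) with h1 | ⟨x, y, hxy, hm, i, hi, heq⟩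
  · left
    have := refl_conj_mem_parahoric (m := m + 1) (n' := m) (by ring) h1
    rw [← hs] at this
    have e : s * (s * g⁻¹ * s) * s = g⁻¹ := by
      rw [show s * (s * g⁻¹ * s) * s = (s * s) * g⁻¹ * (s * s) by group, hss, one_mul, mul_one]
    rw [e] at this
    exact inv_mem_iff.1 this
  · right
    refine ⟨(s * i * s)⁻¹, ?_, (s * unip c x y hxy * s)⁻¹, ?_, ?_⟩
    · rw [iwahori_eq h]
      refine inv_mem ⟨?_, mul_mem (mul_mem hsm hi.1) hsm⟩
      exact refl_conj_mem_parahoric (m := m + 1) (by ring) hi.2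
    · refine inv_mem (refl_conj_unip_mem h hxy hm _ (fun i j => ?_) ?_ ?_)
      · cases κ <;> fin_cases i <;> fin_cases j <;> simp [expI1, Fin.rev]
      all_goals rw [hmκ]; cases κ <;> simp [expI1, mIdx]
    · have hsi : s⁻¹ = s := inv_eq_of_mul_eq_one_left hss
      have e : g⁻¹ = s * unip c x y hxy * s * i * s := by
        calc g⁻¹ = (s * s) * g⁻¹ * (s * s) := by rw [hss, one_mul, mul_one]
          _ = s * (s * g⁻¹ * s) * s := by group
          _ = _ := by rw [heq, ← hs]; group
      rw [← inv_inv g, e]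
      simp only [mul_inv_rev, hsi]
      have hss' : ∀ a, s * (s * a) = a := fun a => by rw [← mul_assoc, hss, one_mul]
      simp only [mul_assoc, hss']

lemma refl_conj_unip_mem_parahoric (h : IsUnramifiedConjugation c ϖ) {m : ℤ} {x y : E}
    (hxy : y + c.toAlgEquiv y + x * c.toAlgEquiv x = 0) (hm : IsUnipIn ϖ m x y) :
    refl c ϖ (m + 1) * unip c x y hxy * refl c ϖ (m + 1) ∈ parahoric c ϖ m := by
  refine refl_conj_unip_mem h hxy hm _ (expP_rev m) ?_ ?_
  all_goals simp [expP]; omega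

lemma alphaElt_inv_apply (i j : Fin 3) : ((alphaElt c ϖ)⁻¹).1.val i j =
    if i = j then ![(unifUnit E ϖ : E), 1, (unifUnit E ϖ : E)⁻¹] i else 0 := by
  rw [inv_apply]
  fin_cases i <;> fin_cases j <;> simp [alphaElt, diagGL, unifUnit, Fin.rev]

lemma alphaElt_inv_not_mem (h : IsUnramifiedConjugation c ϖ) {κ : MaxCompactKind} :
    (alphaElt c ϖ)⁻¹ ∉ maxCompact c ϖ κ := by
  rw [maxCompact_eq, mem_parahoric_iff h]
  intro hl
  have := hl 2 2
  rw [alphaElt_inv_apply] at this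
  simp [expP] at this
  exact absurd h.val_unif_lt (not_lt.2 (by
    rwa [inv_le_one₀ val_unifUnit_pos] at this))

/-- Otherwise `α y⁻¹ α` would lie in `K`; but its upper left entry is `ϖ⁻²` times a unit, whereas
diagonal entries of `K` are integral. -/
lemma alphaElt_ne (h : IsUnramifiedConjugation c ϖ) {κ : MaxCompactKind} {k y : unitaryGroup c}
    (hk : k ∈ maxCompact c ϖ κ) (hy : y ∈ proPIwahori c ϖ κ) :
    alphaElt c ϖ ≠ k * (alphaElt c ϖ)⁻¹ * y := by
  intro heq
  have hk' : k = alphaElt c ϖ * y⁻¹ * alphaElt c ϖ := by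
    calc k = k * (alphaElt c ϖ)⁻¹ * y * y⁻¹ * alphaElt c ϖ := by group
      _ = _ := by rw [← heq]
  rw [maxCompact_eq, mem_parahoric_iff h, hk'] at hk
  have h00 := hk 0 0
  have hy00 := (hy.2) 0 0
  have hy1 : valuation E ((y⁻¹).1.val 0 0) = 1 := by
    have e1 : expI1 κ 0 0 = 1 := by cases κ <;> simp [expI1]
    rw [e1, zpow_one, Matrix.sub_apply, Matrix.one_apply_eq] at hy00
    have := Valuation.map_add_eq_of_lt_right (valuation E) (x := (y⁻¹).1.val 0 0 - 1) (y := 1)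
      (by rw [map_one]; exact hy00.trans_lt h.val_unif_lt)
    simpa using this
  have e2 : (alphaElt c ϖ * y⁻¹ * alphaElt c ϖ).1.val 0 0 =
      (unifUnit E ϖ : E)⁻¹ * (y⁻¹).1.val 0 0 * (unifUnit E ϖ : E)⁻¹ := by
    rw [coe_mul_val, coe_mul_val]
    simp [alphaElt, diagGL, Matrix.diagonal_mul, Matrix.mul_diagonal]
  rw [e2] at h00
  have hlt : 1 < (valuation E (unifUnit E ϖ : E))⁻¹ :=
    (one_lt_inv₀ val_unifUnit_pos).2 h.val_unif_lt
  have : 1 < valuation E ((unifUnit E ϖ : E)⁻¹ * (y⁻¹).1.val 0 0 * (unifUnit E ϖ : E)⁻¹) := by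
    rw [map_mul, map_mul, hy1, mul_one, map_inv₀]
    exact one_lt_mul'' hlt hlt
  simp [expP] at h00
  simp at this
  exact absurd h00 (not_le.2 this)

/-- The number of edges at a vertex of the tree is congruent to `1` modulo `p`. -/
lemma card_quotient_modEq_one (h : IsUnramifiedConjugation c ϖ) {p : ℕ} [hp : Fact p.Prime]
    (hpv : valuation E (p : E) < 1) (m : ℤ)
    [Finite (parahoric c ϖ m ⧸ (parahoric c ϖ (m + 1)).subgroupOf (parahoric c ϖ m))] :
    Nat.card (parahoric c ϖ m ⧸ (parahoric c ϖ (m + 1)).subgroupOf (parahoric c ϖ m)) ≡ 1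
      [MOD p] := by
  obtain ⟨δ, hδ, hcδ⟩ := h.exists_traceZero
  set w := (unifUnit E ϖ : E) with hw
  have hcw : ∀ n : ℤ, c.toAlgEquiv (w ^ n) = w ^ n := by
    intro n
    rw [map_zpow₀]
    simp [hw, unifUnit]
  have hz : ∀ a : ℕ, (a * (δ * w ^ (-m)) : E) + c.toAlgEquiv (a * (δ * w ^ (-m))) +
      0 * c.toAlgEquiv 0 = 0 := by
    intro a
    rw [map_mul, map_mul, map_natCast, hcw, hcδ]
    ring
  have hz1 : (δ * w ^ (-m)) + c.toAlgEquiv (δ * w ^ (-m)) + 0 * c.toAlgEquiv 0 = 0 := by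
    simpa using hz 1
  have hv : valuation E (δ * w ^ (-m)) = valuation E w ^ (-m) := by
    rw [map_mul, hδ, one_mul, map_zpow₀]
  have hvp : valuation E (p : E) ≤ valuation E w ^ (1 : ℤ) := by
    rcases eq_or_ne (p : E) 0 with h0 | h0
    · simp [h0]
    · obtain ⟨n, hn⟩ := h.exists_zpow _ h0
      rw [hn] at hpv ⊢
      rw [← zpow_zero (valuation E w), h.zpow_lt_iff] at hpv
      rw [h.zpow_le_iff]
      omega
  -- A central unipotent lying exactly at level `m`: it fixes the base edge and moves every other
  -- edge at the vertex, while its `p`-th power lies one level deeper and fixes them all.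
  set u := unip c 0 _ hz1 with hu
  have hup : u ^ p = unip c 0 _ (hz p) := unip_zero_pow c hz1 p (hz p)
  have huK : u ∈ parahoric c ϖ m := unip_mem_parahoric h le_rfl hz1 ⟨by simp, hv.le⟩
  have huI : u ∈ parahoric c ϖ (m + 1) := unip_mem_parahoric h (by omega) hz1 ⟨by simp, hv.le⟩
  have hupI : u ^ p ∈ parahoric c ϖ (m + 1) := pow_mem huI p
  -- As `u` is central among the unipotents, all points `n s i` of the big cell behave like `s`.
  have hconj : ∀ {x y : E} (hxy : y + c.toAlgEquiv y + x * c.toAlgEquiv x = 0)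
      (k : ℕ) (i : unitaryGroup c), i ∈ parahoric c ϖ (m + 1) →
      ((unip c x y hxy * refl c ϖ m * i)⁻¹ * u ^ k * (unip c x y hxy * refl c ϖ m * i) ∈
        parahoric c ϖ (m + 1) ↔ refl c ϖ m * u ^ k * refl c ϖ m ∈ parahoric c ϖ (m + 1)) := by
    intro x y hxy k i hi
    have hcomm : u ^ k * unip c x y hxy = unip c x y hxy * u ^ k :=
      (Commute.pow_left (unip_mul_unip_zero c hxy hz1).symm k)
    have e : (unip c x y hxy * refl c ϖ m * i)⁻¹ * u ^ k * (unip c x y hxy * refl c ϖ m * i) =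
        i⁻¹ * (refl c ϖ m * u ^ k * refl c ϖ m) * i := by
      calc _ = i⁻¹ * (refl c ϖ m)⁻¹ * (unip c x y hxy)⁻¹ * (u ^ k * unip c x y hxy) *
            refl c ϖ m * i := by group
        _ = _ := by rw [hcomm, refl_inv]; group
    rw [e, Subgroup.mul_mem_cancel_right _ hi, Subgroup.mul_mem_cancel_left _ (inv_mem hi)]
  have hsup : refl c ϖ m * u ^ p * refl c ϖ m ∈ parahoric c ϖ (m + 1) := by
    rw [hup]
    -- The factor `p` gains at least one power of `ϖ` in the corner entry, whence level `m - 1`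
    -- instead of `m`.
    refine refl_conj_unip_mem h (hz p) (k := m - 1) ⟨by simp, ?_⟩ _ (expP_rev (m + 1)) ?_ ?_
    · rw [map_mul, hv]
      calc _ ≤ valuation E w ^ (1 : ℤ) * valuation E w ^ (-m) := by gcongr
        _ = _ := by rw [← zpow_add₀ val_unifUnit_ne_zero]; congr 1; ring
    all_goals simp [expP]; omega
  have hsu : refl c ϖ m * u ^ 1 * refl c ϖ m ∉ parahoric c ϖ (m + 1) := by
    rw [pow_one, mem_parahoric_iff h]
    intro hl
    have := hl 2 0
    rw [refl_conj_apply, map_mul] at this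
    have e0 : u.1.val (Fin.rev 2) (Fin.rev 0) = δ * w ^ (-m) := by simp [hu, unip, Fin.rev]
    rw [e0, hv, map_zpow₀, ← zpow_add₀ val_unifUnit_ne_zero, h.zpow_le_iff] at this
    simp [expP] at this
    omega
  have hA : ∀ g : parahoric c ϖ m, (g : unitaryGroup c)⁻¹ * u ^ p * g ∈ parahoric c ϖ (m + 1) := by
    intro g
    rcases bruhat h g.2 with hg | ⟨x, y, hxy, -, i, hi, hg⟩
    · exact mul_mem (mul_mem (inv_mem hg) hupI) hg
    · have := (hconj hxy p i hi.2).2 hsup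
      rwa [← hg] at this
  have hB : ∀ g : parahoric c ϖ m, (g : unitaryGroup c)⁻¹ * u * g ∈ parahoric c ϖ (m + 1) ↔
      (g : unitaryGroup c) ∈ parahoric c ϖ (m + 1) := by
    intro g
    rcases bruhat h g.2 with hg | ⟨x, y, hxy, -, i, hi, hg⟩
    · exact ⟨fun _ => hg, fun _ => mul_mem (mul_mem (inv_mem hg) huI) hg⟩
    · have hl := (not_congr (hconj hxy 1 i hi.2)).2 hsu
      rw [← hg, pow_one] at hl
      exact ⟨fun hh => absurd hh hl, fun hh =>
        absurd (mul_mem (mul_mem (inv_mem hh) huI) hh) hl⟩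
  exact card_quotient_modEq_one_of_conj _ (⟨u, huK⟩ : parahoric c ϖ m) hA hB

end Index

end U21

namespace U21

/-! ### Open and compact subgroups, and `I_{1,K}` as a pro-`p` group. -/

section Topology

open Filter Topology

variable {F E : Type*} [Field F] [ValuativeRel F] [Field E] [ValuativeRel E]
  [TopologicalSpace E] [IsNonarchimedeanLocalField E] [Algebra F E] [ValuativeExtension F E]
  {c : QuadraticConjugation F E} {ϖ : Uniformizer F}

lemma isClopen_val_le (n : ℤ) :
    IsClopen {x : E | valuation E x ≤ valuation E (unifUnit E ϖ : E) ^ n} := by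
  have h0 : (unifUnit E ϖ : E) ≠ 0 := (unifUnit E ϖ).ne_zero
  have : {x : E | valuation E x ≤ valuation E (unifUnit E ϖ : E) ^ n} =
      (fun x => (unifUnit E ϖ : E) ^ (-n) * x) ⁻¹' ((valuation E).integer : Set E) := by
    ext x
    simp only [Set.mem_ofPred_eq, Set.mem_preimage, SetLike.mem_coe, Valuation.mem_integer_iff]
    rw [map_mul, map_zpow₀, zpow_neg, inv_mul_le_iff₀ (zpow_pos val_unifUnit_pos n), mul_one]
  rw [this]
  exact (Valuation.isClopen_integer (v := valuation E)).preimage (by fun_prop)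

lemma IsUnramifiedConjugation.continuous (h : IsUnramifiedConjugation c ϖ) :
    Continuous c.toAlgEquiv := by
  apply continuous_of_continuousAt_zero c.toAlgEquiv
  rw [ContinuousAt, map_zero]
  refine ((IsValuativeTopology.hasBasis_nhds_zero' E).tendsto_iff
    (IsValuativeTopology.hasBasis_nhds_zero' E)).2 fun γ hγ => ⟨γ, hγ, fun x hx => ?_⟩
  simpa [h.val_conj] using hx

lemma continuous_entry (i j : Fin 3) : Continuous fun g : unitaryGroup c => g.1.val i j :=
  (Units.continuous_val.comp continuous_subtype_val).matrix_elem i j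

lemma isOpen_congruenceSubgroup (e : Fin 3 → Fin 3 → ℤ) (he : ∀ i j l, e i l ≤ e i j + e j l) :
    IsOpen (congruenceSubgroup c ϖ e he : Set (unitaryGroup c)) := by
  have : (congruenceSubgroup c ϖ e he : Set (unitaryGroup c)) =
      ⋂ i, ⋂ j, ((fun g : unitaryGroup c => (g.1.val - 1) i j) ⁻¹'
          {x : E | valuation E x ≤ valuation E (unifUnit E ϖ : E) ^ e i j} ∩
        (fun g : unitaryGroup c => ((g⁻¹).1.val - 1) i j) ⁻¹'
          {x : E | valuation E x ≤ valuation E (unifUnit E ϖ : E) ^ e i j}) := by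
    ext g
    simp only [Set.mem_iInter, Set.mem_inter_iff, Set.mem_preimage, Set.mem_ofPred_eq]
    exact ⟨fun h i j => ⟨h.1 i j, h.2 i j⟩, fun h => ⟨fun i j => (h i j).1, fun i j => (h i j).2⟩⟩
  rw [this]
  refine isOpen_iInter_of_finite fun i => isOpen_iInter_of_finite fun j => ?_
  have h1 : Continuous fun g : unitaryGroup c => (g.1.val - 1) i j :=
    (continuous_entry i j).sub continuous_const
  exact ((isClopen_val_le _).isOpen.preimage h1).inter
    ((isClopen_val_le _).isOpen.preimage (h1.comp continuous_inv))

lemma t2Space_of_isNonarchimedeanLocalField : T2Space E := by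
  let _ := IsTopologicalAddGroup.rightUniformSpace E
  have := isUniformAddGroup_of_addCommGroup (G := E)
  exact inferInstanceAs (T2Space E)

lemma isClosed_unitaryGroup (h : IsUnramifiedConjugation c ϖ) :
    IsClosed (unitaryGroup c : Set (GL (Fin 3) E)) := by
  have := t2Space_of_isNonarchimedeanLocalField (E := E)
  have : (unitaryGroup c : Set (GL (Fin 3) E)) = ⋂ v, ⋂ w, {g : GL (Fin 3) E |
      herm c (g.val.mulVec v) (g.val.mulVec w) = herm c v w} := by
    ext g
    simp only [Set.mem_iInter]
    exact Iff.rfl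
  rw [this]
  refine isClosed_iInter fun v => isClosed_iInter fun w => isClosed_eq ?_ continuous_const
  have hc := h.continuous
  have hv : ∀ (v : Fin 3 → E) i, Continuous fun g : GL (Fin 3) E => g.val.mulVec v i := fun v i =>
    (continuous_apply i).comp (Units.continuous_val.matrix_mulVec continuous_const)
  simp only [herm_eq]
  exact (((hv v 0).mul (hc.comp (hv w 2))).add ((hv v 1).mul (hc.comp (hv w 1)))).add
    ((hv v 2).mul (hc.comp (hv w 0)))

lemma isCompact_inLattice (e : Fin 3 → Fin 3 → ℤ) :
    IsCompact {A : Matrix (Fin 3) (Fin 3) E | InLattice ϖ e A} := by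
  have : {A : Matrix (Fin 3) (Fin 3) E | InLattice ϖ e A} =
      Set.univ.pi fun i => Set.univ.pi fun j =>
        {x : E | valuation E x ≤ valuation E (unifUnit E ϖ : E) ^ e i j} := by
    ext A
    exact ⟨fun h i _ j _ => h i j, fun h i j => h i trivial j trivial⟩
  rw [this]
  exact isCompact_univ_pi fun i => isCompact_univ_pi fun j =>
    IsNonarchimedeanLocalField.isCompact_closedBall E _

/-- Under the closed embedding `g ↦ (g, g⁻¹)` of the unit group, the parahoric is the preimage of a
product of two compact lattices; `unitaryGroup c` is closed in the general linear group. -/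
lemma isCompact_parahoric (h : IsUnramifiedConjugation c ϖ) (m : ℤ) :
    IsCompact (parahoric c ϖ m : Set (unitaryGroup c)) := by
  have := t2Space_of_isNonarchimedeanLocalField (E := E)
  let S : Set (Matrix (Fin 3) (Fin 3) E) := {A | InLattice ϖ (expP m) A}
  have hS : IsCompact S := isCompact_inLattice _
  have h1 : IsCompact (S ×ˢ (MulOpposite.unop ⁻¹' S)) :=
    hS.prod (MulOpposite.opHomeomorph.symm.isClosedEmbedding.isCompact_preimage hS)
  have h2 := (isClosed_unitaryGroup h).isClosedEmbedding_subtypeVal.isCompact_preimage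
    ((Units.isClosedEmbedding_embedProduct (α := Matrix (Fin 3) (Fin 3) E)).isCompact_preimage h1)
  have h3 : ∀ A : Matrix (Fin 3) (Fin 3) E, InLattice ϖ (expP m) (A - 1) ↔
      InLattice ϖ (expP m) A := fun A => inLattice_sub_one_iff (by intro i; simp [expP])
  have h4 : (parahoric c ϖ m : Set (unitaryGroup c)) = Subtype.val ⁻¹'
      (Units.embedProduct (Matrix (Fin 3) (Fin 3) E) ⁻¹' (S ×ˢ (MulOpposite.unop ⁻¹' S))) :=
    Set.ext fun g => and_congr (h3 _) (h3 _)
  rw [h4]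
  exact h2

lemma InLattice.mul' {e e' e'' : Fin 3 → Fin 3 → ℤ} (he : ∀ i j l, e'' i l ≤ e i j + e' j l)
    {A B : Matrix (Fin 3) (Fin 3) E} (hA : InLattice ϖ e A) (hB : InLattice ϖ e' B) :
    InLattice ϖ e'' (A * B) := by
  intro i l
  rw [Matrix.mul_apply]
  refine (valuation E).map_sum_le fun j _ => ?_
  rw [map_mul]
  calc valuation E (A i j) * valuation E (B j l)
      ≤ valuation E (unifUnit E ϖ : E) ^ (e i j) * valuation E (unifUnit E ϖ : E) ^ (e' j l) :=
        mul_le_mul' (hA i j) (hB j l)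
    _ = valuation E (unifUnit E ϖ : E) ^ (e i j + e' j l) :=
        (zpow_add₀ val_unifUnit_ne_zero _ _).symm
    _ ≤ valuation E (unifUnit E ϖ : E) ^ (e'' i l) :=
        zpow_le_zpow_right_of_le_one₀ val_unifUnit_pos (valuation_unifUnit_le_one ϖ) (he i j l)

/-- Exponents of the filtration of the Iwahori order by the powers of its radical, as seen from
the midpoint of an edge. -/
def expFil (m : ℤ) (n : ℕ) (i j : Fin 3) : ℤ :=
  -(-(((i : ℕ) - (j : ℕ) : ℤ) * (2 * m + 1) + n) / 4)

lemma expFil_add_le (m : ℤ) (a b : ℕ) (i j l : Fin 3) :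
    expFil m (a + b) i l ≤ expFil m a i j + expFil m b j l := by
  fin_cases i <;> fin_cases j <;> fin_cases l <;> simp [expFil] <;> omega

/-- Here `(1 + A)^p - 1 = p A + A² C`. Multiplication by `p` raises the filtration by at least `4`,
and `A²` lies in step `2 n ≥ n + 1`. No divisibility of binomial coefficients is needed, so the
characteristic of `F` plays no role. -/
lemma inLattice_expFil_one_add_pow (h : IsUnramifiedConjugation c ϖ) {p : ℕ}
    (hpv : valuation E (p : E) ≤ valuation E (unifUnit E ϖ : E)) {m : ℤ} {n : ℕ} (hn : n ≠ 0)
    {A : Matrix (Fin 3) (Fin 3) E} (hA : InLattice ϖ (expFil m n) A) :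
    InLattice ϖ (expFil m (n + 1)) ((1 + A) ^ p - 1) := by
  have h0 : InLattice ϖ (expFil m 0) A := hA.mono h fun i j => by
    fin_cases i <;> fin_cases j <;> simp [expFil] <;> omega
  have hk : ∀ k : ℕ, ∃ C, InLattice ϖ (expFil m 0) C ∧ (1 + A) ^ k =
      1 + (k : Matrix (Fin 3) (Fin 3) E) * A + A * (A * C) := by
    intro k
    induction k with
    | zero => exact ⟨0, fun i j => by simp, by simp⟩
    | succ k ih =>
      obtain ⟨C, hC, hCk⟩ := ih
      refine ⟨C + C * A + k * 1, ?_, ?_⟩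
      · refine (hC.add (hC.mul' (fun i j l => expFil_add_le m 0 0 i j l) h0)).add ?_
        intro i j
        rw [mul_one, Matrix.natCast_apply]
        split_ifs with hij
        · subst hij
          have : expFil m 0 i i = 0 := by simp [expFil]
          rw [this, zpow_zero]
          have h1 := (valuation E).map_sum_le (s := Finset.range k) (f := fun _ => (1 : E)) (g := 1)
            (fun _ _ => by simp)
          simpa using h1
        · simp
      · rw [pow_succ, hCk]
        push_cast
        have hcomm : (k : Matrix (Fin 3) (Fin 3) E) * A = A * k := (Nat.cast_commute k A).eq
        simp only [mul_add, add_mul, mul_one, one_mul, mul_assoc, hcomm]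
        abel
  obtain ⟨C, hC, hCp⟩ := hk p
  rw [hCp, show 1 + (p : Matrix (Fin 3) (Fin 3) E) * A + A * (A * C) - 1 =
    p * A + A * (A * C) by abel]
  have hAC : InLattice ϖ (expFil m n) (A * C) :=
    hA.mul' (fun i j l => expFil_add_le m n 0 i j l) hC
  refine InLattice.add (fun i j => ?_) ?_
  · have e1 : ((p : Matrix (Fin 3) (Fin 3) E) * A) i j = p * A i j := by
      rw [← nsmul_eq_mul, Matrix.smul_apply, nsmul_eq_mul]
    rw [e1, map_mul]
    calc _ ≤ valuation E (unifUnit E ϖ : E) ^ (1 : ℤ) *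
          valuation E (unifUnit E ϖ : E) ^ (expFil m n i j) := by
          rw [zpow_one]
          exact mul_le_mul' hpv (hA i j)
      _ ≤ _ := by
        rw [← zpow_add₀ val_unifUnit_ne_zero, h.zpow_le_iff]
        fin_cases i <;> fin_cases j <;> simp [expFil] <;> omega
  · refine (hA.mul' (fun i j l => expFil_add_le m n n i j l) hAC).mono h fun i j => ?_
    have : ((n : ℕ) : ℤ) ≠ 0 := by exact_mod_cast hn
    fin_cases i <;> fin_cases j <;> simp [expFil] <;> omega

lemma expFil_le_expI1 (κ : MaxCompactKind) (i j : Fin 3) :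
    expFil (mIdx κ) 1 i j ≤ expI1 κ i j := by
  cases κ <;> fin_cases i <;> fin_cases j <;> simp [expFil, expI1, mIdx]

lemma val_natCast_le (h : IsUnramifiedConjugation c ϖ) {p : ℕ} (hpv : valuation E (p : E) < 1) :
    valuation E (p : E) ≤ valuation E (unifUnit E ϖ : E) := by
  rcases eq_or_ne (p : E) 0 with h0 | h0
  · simp [h0]
  · obtain ⟨n, hn⟩ := h.exists_zpow _ h0
    rw [hn] at hpv ⊢
    rw [← zpow_zero (valuation E (unifUnit E ϖ : E)), h.zpow_lt_iff] at hpv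
    conv_rhs => rw [← zpow_one (valuation E (unifUnit E ϖ : E))]
    rw [h.zpow_le_iff]
    omega

lemma tendsto_matrix_one (h : IsUnramifiedConjugation c ϖ) {m : ℤ}
    {B : ℕ → Matrix (Fin 3) (Fin 3) E} (hB : ∀ n, InLattice ϖ (expFil m (n + 1)) (B n - 1)) :
    Tendsto B atTop (𝓝 1) := by
  refine tendsto_pi_nhds.2 fun i => tendsto_pi_nhds.2 fun j => ?_
  refine (IsValuativeTopology.hasBasis_nhds' _).tendsto_right_iff.2 fun γ hγ => ?_
  obtain ⟨r, rfl⟩ := ValuativeRel.valuation_surjective γ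
  obtain ⟨k, hk⟩ := h.exists_zpow r (by simpa using hγ)
  rw [hk]
  have hev : ∀ᶠ n : ℕ in atTop, k < expFil m (n + 1) i j := by
    filter_upwards [eventually_ge_atTop ((4 * k + 8 - ((i : ℕ) - (j : ℕ) : ℤ) * (2 * m + 1)).toNat)]
      with n hn
    simp only [expFil]
    push_cast
    omega
  filter_upwards [hev] with n hn
  exact (hB n i j).trans_lt (h.zpow_lt_iff.2 hn)

/-- The group `I_{1,K}` is pro-`p`. -/
lemma tendsto_pow_proPIwahori (h : IsUnramifiedConjugation c ϖ) {p : ℕ}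
    (hpv : valuation E (p : E) < 1) {κ : MaxCompactKind} {g : unitaryGroup c}
    (hg : g ∈ proPIwahori c ϖ κ) : Tendsto (fun n => g ^ p ^ n) atTop (𝓝 1) := by
  have key : ∀ g' ∈ proPIwahori c ϖ κ, Tendsto (fun n => (g' ^ p ^ n).1.val) atTop
      (𝓝 (1 : Matrix (Fin 3) (Fin 3) E)) := by
    intro g' hg'
    refine tendsto_matrix_one h (m := mIdx κ) fun n => ?_
    induction n with
    | zero =>
      rw [pow_zero, pow_one]
      exact hg'.1.mono h (expFil_le_expI1 κ)
    | succ n ih =>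
      have := inLattice_expFil_one_add_pow h (val_natCast_le h hpv)
        (Nat.succ_ne_zero n) ih
      rw [add_sub_cancel] at this
      rw [pow_succ, pow_mul]
      exact this
  -- Convergence in the unit group also requires convergence of the inverses, so the matrix
  -- statement is applied to `g` and to `g⁻¹`.
  rw [tendsto_subtype_rng, Units.isEmbedding_embedProduct.tendsto_nhds_iff]
  have h2 := key g⁻¹ (inv_mem hg)
  have h3 : Tendsto (fun n => ((g ^ p ^ n)⁻¹).1.val) atTop
      (𝓝 (1 : Matrix (Fin 3) (Fin 3) E)) := by simpa only [inv_pow] using h2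
  exact Tendsto.prodMk_nhds (key g hg) ((MulOpposite.continuous_op.tendsto 1).comp h3)

end Topology

end U21

/-! ### Sums of translates over a coset space. -/

section OrbitSum

variable {k A V V' : Type*} [Field k] [Group A] [AddCommGroup V] [Module k V]
  [AddCommGroup V'] [Module k V']

/-- The sum of the translates of a `B`-invariant vector over `A / B`. -/
noncomputable def orbitSum (τ : Representation k A V) (B : Subgroup A) (v : V) : V :=
  ∑ᶠ x : A ⧸ B, τ x.out v

variable {τ : Representation k A V} {B : Subgroup A} {v : V}

lemma apply_out_eq (hv : ∀ b ∈ B, τ b v = v) (a : A) :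
    τ (QuotientGroup.mk a : A ⧸ B).out v = τ a v := by
  obtain ⟨b, hb⟩ := QuotientGroup.mk_out_eq_mul B a
  rw [hb, map_mul, Module.End.mul_apply, hv _ b.2]

lemma apply_orbitSum [Finite (A ⧸ B)] (hv : ∀ b ∈ B, τ b v = v) (a : A) :
    τ a (orbitSum τ B v) = orbitSum τ B v := by
  have h1 : τ a (orbitSum τ B v) = ∑ᶠ x : A ⧸ B, τ (a • x).out v := by
    refine ((τ a).toAddMonoidHom.map_finsum (Set.toFinite _)).trans (finsum_congr fun x => ?_)
    rw [LinearMap.toAddMonoidHom_coe, ← Module.End.mul_apply, ← map_mul,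
      ← apply_out_eq hv (a * x.out), ← smul_eq_mul, ← MulAction.Quotient.smul_mk,
      QuotientGroup.out_eq']
  rw [h1]
  exact finsum_comp_equiv (MulAction.toPerm a : Equiv.Perm (A ⧸ B)) (f := fun x => τ x.out v)

lemma map_orbitSum [Finite (A ⧸ B)] {τ' : Representation k A V'} (f : V →ₗ[k] V')
    (hf : ∀ a v, f (τ a v) = τ' a (f v)) : f (orbitSum τ B v) = orbitSum τ' B (f v) :=
  (f.toAddMonoidHom.map_finsum (Set.toFinite _)).trans (finsum_congr fun _ => hf _ _)

lemma orbitSum_of_invariant [Finite (A ⧸ B)] (hv : ∀ a, τ a v = v) :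
    orbitSum τ B v = Nat.card (A ⧸ B) • v := by
  let _ := Fintype.ofFinite (A ⧸ B)
  rw [orbitSum, finsum_eq_sum_of_fintype, Nat.card_eq_fintype_card]
  simp [hv]

lemma orbitSum_smul [Finite (A ⧸ B)] (r : k) : orbitSum τ B (r • v) = r • orbitSum τ B v :=
  (map_orbitSum (τ := τ) (B := B) (v := v) (r • LinearMap.id) fun a v => by simp).symm

end OrbitSum

/-! ### Functions supported on `K` in the compact induction. -/

section CompactInduction

variable {k G V W : Type*} [Field k] [Group G] [TopologicalSpace G] [IsTopologicalGroup G]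
  [AddCommGroup V] [Module k V] [AddCommGroup W] [Module k W] {K : Subgroup G}
  {σ : Representation k K W}

lemma cInd_apply (g : G) (f : cIndSpace K σ) (x : G) : (cInd K σ g f).1 x = f.1 (x * g) := rfl

lemma cIndSpace_mul (f : cIndSpace K σ) {κ : G} (hκ : κ ∈ K) (g : G) :
    f.1 (κ * g) = σ ⟨κ, hκ⟩ (f.1 g) :=
  f.2.1 ⟨κ, hκ⟩ g

open Classical in
/-- The function supported on `K` with value `w` at `1`. -/
noncomputable def cIndSingle (hKo : IsOpen (K : Set G)) (hKc : IsCompact (K : Set G))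
    (hσ : IsSmoothRep σ) : W →ₗ[k] cIndSpace K σ where
  toFun w := ⟨fun x => if hx : x ∈ K then σ ⟨x, hx⟩ w else 0, by
    refine ⟨fun κ g => ?_, ?_, ?_⟩
    · beta_reduce
      by_cases hg : g ∈ K
      · have hκg : (κ : G) * g ∈ K := mul_mem κ.2 hg
        rw [dif_pos hg, dif_pos hκg, ← Module.End.mul_apply, ← map_mul]
        rfl
      · rw [dif_neg hg, dif_neg (by rwa [Subgroup.mul_mem_cancel_left _ κ.2]), map_zero]
    · obtain ⟨U, hU, hUw⟩ := hσ w
      refine ⟨U.map K.subtype, hKo.isOpenMap_subtype_val _ hU, ?_⟩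
      rintro _ ⟨u, hu, rfl⟩ g
      beta_reduce
      by_cases hg : g ∈ K
      · have hgu : g * K.subtype u ∈ K := mul_mem hg u.2
        rw [dif_pos hg, dif_pos hgu]
        have : (⟨g * K.subtype u, hgu⟩ : K) = ⟨g, hg⟩ * u := rfl
        rw [this, map_mul, Module.End.mul_apply, hUw u hu]
      · rw [dif_neg hg, dif_neg (by
          rw [Subgroup.subtype_apply, Subgroup.mul_mem_cancel_right _ u.2]; exact hg)]
    · refine HasCompactSupport.intro' hKc (Subgroup.isClosed_of_isOpen K hKo) fun x hx => ?_
      exact dif_neg hx⟩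
  map_add' w w' := by
    ext x
    by_cases hx : x ∈ K <;> simp [hx]
  map_smul' r w := by
    ext x
    by_cases hx : x ∈ K <;> simp [hx]

variable {hKo : IsOpen (K : Set G)} {hKc : IsCompact (K : Set G)} {hσ : IsSmoothRep σ}

lemma cIndSingle_of_mem (w : W) {x : G} (hx : x ∈ K) :
    (cIndSingle hKo hKc hσ w).1 x = σ ⟨x, hx⟩ w := dif_pos hx

lemma cIndSingle_of_notMem (w : W) {x : G} (hx : x ∉ K) :
    (cIndSingle hKo hKc hσ w).1 x = 0 := dif_neg hx

lemma cInd_cIndSingle (κ : K) (w : W) :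
    cInd K σ κ (cIndSingle hKo hKc hσ w) = cIndSingle hKo hKc hσ (σ κ w) := by
  ext x
  rw [cInd_apply]
  by_cases hx : x ∈ K
  · rw [cIndSingle_of_mem _ hx, cIndSingle_of_mem _ (mul_mem hx κ.2), ← Module.End.mul_apply,
      ← map_mul]
    rfl
  · rw [cIndSingle_of_notMem _ hx,
      cIndSingle_of_notMem _ (by rwa [Subgroup.mul_mem_cancel_right _ κ.2])]

/-- The functions supported on `K` generate the compact induction. -/
lemma eq_top_of_cIndSingle_mem (M : Submodule k (cIndSpace K σ))
    (hM : ∀ g, ∀ f ∈ M, cInd K σ g f ∈ M) (hw : ∀ w, cIndSingle hKo hKc hσ w ∈ M) : M = ⊤ := by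
  classical
  have key : ∀ (A : Finset (G ⧸ K)) (f : cIndSpace K σ),
      (∀ g, f.1 g ≠ 0 → (QuotientGroup.mk g⁻¹ : G ⧸ K) ∈ A) → f ∈ M := by
    intro A
    induction A using Finset.induction_on with
    | empty =>
      intro f hf
      have : f = 0 := by
        ext g
        by_contra h
        simpa using hf g h
      rw [this]
      exact M.zero_mem
    | insert a A _ ih =>
      intro f hf
      -- Induction on the finite set of cosets supporting `f`, with `K \ G` indexed through inverses
      -- by `G / K`. Subtracting a translate of a function supported on `K` removes the coset `K
      -- g₀`.
      set g₀ := a.out⁻¹ with hg₀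
      set f₀ := cInd K σ g₀⁻¹ (cIndSingle hKo hKc hσ (f.1 g₀)) with hf₀
      have hf₀M : f₀ ∈ M := hM _ _ (hw _)
      rw [← sub_add_cancel f f₀]
      refine M.add_mem (ih _ fun g hg => ?_) hf₀M
      have hval : (f - f₀).1 g = f.1 g - f₀.1 g := rfl
      rw [hval, hf₀, cInd_apply] at hg
      by_cases hgK : g * g₀⁻¹ ∈ K
      · rw [cIndSingle_of_mem _ hgK, ← cIndSpace_mul, inv_mul_cancel_right, sub_self] at hg
        exact absurd rfl hg
      · rw [cIndSingle_of_notMem _ hgK, sub_zero] at hg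
        refine (Finset.mem_insert.1 (hf g hg)).resolve_left fun h => hgK ?_
        rw [← QuotientGroup.out_eq' a, QuotientGroup.eq] at h
        simpa [hg₀] using h
  rw [Submodule.eq_top_iff']
  intro f
  have : DiscreteTopology (G ⧸ K) := QuotientGroup.discreteTopology hKo
  have hc : IsCompact ((fun g : G => (QuotientGroup.mk g⁻¹ : G ⧸ K)) '' tsupport f.1) :=
    f.2.2.2.isCompact.image (continuous_quot_mk.comp continuous_inv)
  have hfin := hc.finite_of_discrete
  refine key hfin.toFinset f fun g hg => ?_
  rw [Set.Finite.mem_toFinset]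
  exact ⟨g, subset_tsupport _ hg, rfl⟩

/-- Only the coset `g K` contributes. Consequently the value of `T f₀` at `g` is `φ(g) v₀`. -/
lemma heckeConvolution_cIndSingle {φ : G → Module.End k W} (hφ : IsHeckeFunction K σ φ) (w : W)
    (g : G) : heckeConvolution K φ (cIndSingle hKo hKc hσ w).1 g = φ g w := by
  rw [heckeConvolution, finsum_eq_single _ (QuotientGroup.mk g)]
  · obtain ⟨κ, hκ⟩ := QuotientGroup.mk_out_eq_mul K g
    rw [hκ, mul_inv_rev, mul_assoc, inv_mul_cancel, mul_one,
      cIndSingle_of_mem _ (inv_mem κ.2)]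
    have := hφ.bi_equivariant 1 κ g
    rw [map_one, one_mul, OneMemClass.coe_one, one_mul] at this
    rw [this, Module.End.mul_apply, ← Module.End.mul_apply (σ κ), ← map_mul]
    have : κ * ⟨(κ : G)⁻¹, inv_mem κ.2⟩ = 1 := Subtype.ext (mul_inv_cancel _)
    rw [this, map_one, Module.End.one_apply]
  · intro x hx
    rw [cIndSingle_of_notMem, map_zero]
    intro h
    apply hx
    rw [← QuotientGroup.out_eq' x, QuotientGroup.eq]
    exact h

end CompactInduction

/-! ### The argument on an abstract edge of a tree. -/

/-- The combinatorial properties of two maximal compact subgroups `K` and `P` which stabilize the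
ends of an edge of a tree: `s ∈ K` and `s' ∈ P` are reflections, `J` and `J'` are opposite
pro-`p` subgroups of `K`, and the edges at a vertex are counted modulo `p`. -/
structure IsEdgeDatum {G : Type*} [Group G] [TopologicalSpace G] (p : ℕ) (K P J J' : Subgroup G)
    (s s' : G) : Prop where
  isOpen_K : IsOpen (K : Set G)
  isCompact_K : IsCompact (K : Set G)
  J_le : J ≤ K ⊓ P
  s_mem : s ∈ K
  s_mul_self : s * s = 1
  s'_mem : s' ∈ P
  s'_mul_self : s' * s' = 1
  bruhat : ∀ g ∈ K, g ∈ P ∨ ∃ n ∈ J, s * n * s ∈ J' ∧ s' * n * s' ∈ K ∧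
    ∃ i ∈ K ⊓ P, g = n * s * i
  bruhat' : ∀ g ∈ P, g ∈ K ∨ ∃ i ∈ K ⊓ P, ∃ y ∈ J, g = i * s' * y
  ne : ∀ κ ∈ K, ∀ y ∈ J, s' * s ≠ κ * (s' * s)⁻¹ * y
  notMem : (s' * s)⁻¹ ∉ K
  finite_K : Finite (K ⧸ P.subgroupOf K)
  finite_P : Finite (P ⧸ K.subgroupOf P)
  card_K : Nat.card (K ⧸ P.subgroupOf K) ≡ 1 [MOD p]
  card_P : Nat.card (P ⧸ K.subgroupOf P) ≡ 1 [MOD p]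

/-- The properties of the vector `v₀` of the Steinberg weight of `K` which is fixed by the
Iwahori subgroup `K ⊓ P`. -/
structure IsSteinbergVector {k G W : Type*} [Field k] [Group G] [TopologicalSpace G]
    [AddCommGroup W] [Module k W] {K : Subgroup G} (P : Subgroup G) (σ : Representation k K W)
    (v₀ : W) : Prop where
  smooth : IsSmoothRep σ
  fixed : ∀ κ : K, (κ : G) ∈ P → σ κ v₀ = v₀
  orbitSum_eq_zero : orbitSum σ (P.subgroupOf K) v₀ = 0
  generates : ∀ N : Submodule k W, (∀ κ, ∀ w ∈ N, σ κ w ∈ N) → v₀ ∈ N → N = ⊤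

namespace IsEdgeDatum

variable {k G V W : Type*} [Field k] [Group G] [TopologicalSpace G] [IsTopologicalGroup G]
  [AddCommGroup V] [Module k V] [AddCommGroup W] [Module k W] {p : ℕ} {K P J J' : Subgroup G}
  {s s' : G} {σ : Representation k K W} {v₀ : W}

section

variable (d : IsEdgeDatum p K P J J' s s')
include d

lemma s_inv : s⁻¹ = s := inv_eq_of_mul_eq_one_left d.s_mul_self

lemma s'_inv : s'⁻¹ = s' := inv_eq_of_mul_eq_one_left d.s'_mul_self

lemma s'_notMem : s' ∉ K := fun h => d.notMem (inv_mem (mul_mem h d.s_mem))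

/-- Multiplying the Bruhat decomposition by `s` on the left makes the point cell `s I` and the big
cell `(s N s) I`. The elements of `s N s` lie in `J'`, where the projection `j` is invariant. -/
lemma bruhat_opposite (κ : G) (hκ : κ ∈ K) : (∃ i ∈ K ⊓ P, κ = s * i) ∨
    ∃ n ∈ J, s * n * s ∈ J' ∧ s' * n * s' ∈ K ∧ ∃ i ∈ K ⊓ P, κ = s * n * s * i := by
  have e : κ = s * (s * κ) := by rw [← mul_assoc, d.s_mul_self, one_mul]
  rcases d.bruhat (s * κ) (mul_mem d.s_mem hκ) with h | ⟨n, hn, h1, h2, i, hi, h⟩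
  · exact Or.inl ⟨s * κ, ⟨mul_mem d.s_mem hκ, h⟩, e⟩
  · exact Or.inr ⟨n, hn, h1, h2, i, hi, by rw [e, h]; simp only [mul_assoc]⟩

end

/-- The function `f₀`, supported on `K` and with value `v₀` at `1`. -/
noncomputable def f₀ (d : IsEdgeDatum p K P J J' s s') (hv : IsSteinbergVector P σ v₀) :
    cIndSpace K σ :=
  cIndSingle d.isOpen_K d.isCompact_K hv.smooth v₀

/-- The sum of the translates of `f₀` over the edges at the vertex fixed by `P`. -/
noncomputable def fP (d : IsEdgeDatum p K P J J' s s') (hv : IsSteinbergVector P σ v₀) :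
    cIndSpace K σ :=
  orbitSum ((cInd K σ).comp P.subtype) (K.subgroupOf P) (d.f₀ hv)

/-- The function `f₁`, supported on `K s' J`. -/
noncomputable def f₁ (d : IsEdgeDatum p K P J J' s s') (hv : IsSteinbergVector P σ v₀) :
    cIndSpace K σ :=
  d.fP hv - d.f₀ hv

variable (d : IsEdgeDatum p K P J J' s s') (hv : IsSteinbergVector P σ v₀)
include d hv

lemma cInd_f₀ {g : G} (hg : g ∈ K ⊓ P) : cInd K σ g (d.f₀ hv) = d.f₀ hv := by
  have := cInd_cIndSingle (hKo := d.isOpen_K) (hKc := d.isCompact_K) (hσ := hv.smooth)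
    ⟨g, hg.1⟩ v₀
  rw [hv.fixed ⟨g, hg.1⟩ hg.2] at this
  exact this

lemma f₀_of_mem {x : G} (hx : x ∈ K) : (d.f₀ hv).1 x = σ ⟨x, hx⟩ v₀ := cIndSingle_of_mem _ hx

lemma f₀_of_notMem {x : G} (hx : x ∉ K) : (d.f₀ hv).1 x = 0 := cIndSingle_of_notMem _ hx

lemma cInd_fP {g : G} (hg : g ∈ P) : cInd K σ g (d.fP hv) = d.fP hv := by
  have := d.finite_P
  exact apply_orbitSum (τ := (cInd K σ).comp P.subtype) (B := K.subgroupOf P)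
    (fun b hb => d.cInd_f₀ hv ⟨hb, b.2⟩) ⟨g, hg⟩

lemma fP_apply (g : G) :
    (d.fP hv).1 g = ∑ᶠ x : P ⧸ K.subgroupOf P, (d.f₀ hv).1 (g * x.out) := by
  have := d.finite_P
  let ev : cIndSpace K σ →+ W :=
    ((LinearMap.proj g : (G → W) →ₗ[k] W).comp (cIndSpace K σ).subtype).toAddMonoidHom
  exact (ev.map_finsum (Set.toFinite _))

/-- By `P`-invariance and `K`-equivariance it is enough to evaluate at `1`, where only the trivial
coset contributes. -/
lemma fP_mul {κ q : G} (hκ : κ ∈ K) (hq : q ∈ P) : (d.fP hv).1 (κ * q) = σ ⟨κ, hκ⟩ v₀ := by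
  rw [← cInd_apply, d.cInd_fP hv hq]
  have h1 := cIndSpace_mul (d.fP hv) hκ 1
  rw [mul_one] at h1
  rw [h1]
  congr 1
  rw [fP_apply, finsum_eq_single _ (QuotientGroup.mk 1)]
  · obtain ⟨b, hb⟩ := QuotientGroup.mk_out_eq_mul (K.subgroupOf P) 1
    rw [one_mul, hb, one_mul]
    exact (d.f₀_of_mem hv b.2).trans (hv.fixed _ b.1.2)
  · intro x hx
    rw [one_mul]
    refine d.f₀_of_notMem hv fun h => hx ?_
    rw [← QuotientGroup.out_eq' x, eq_comm, QuotientGroup.eq, inv_one, one_mul]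
    exact h

lemma exists_of_fP_ne_zero {g : G} (hg : (d.fP hv).1 g ≠ 0) : ∃ κ ∈ K, ∃ q ∈ P, g = κ * q := by
  rw [fP_apply] at hg
  obtain ⟨x, hx⟩ : ∃ x : P ⧸ K.subgroupOf P, (d.f₀ hv).1 (g * x.out) ≠ 0 := by
    by_contra! h
    exact hg (by rw [finsum_congr h, finsum_zero])
  have hK : g * x.out ∈ K := by
    by_contra h
    exact hx (d.f₀_of_notMem hv h)
  exact ⟨_, hK, _, inv_mem x.out.2, by group⟩

lemma cInd_f₁ {g : G} (hg : g ∈ K ⊓ P) : cInd K σ g (d.f₁ hv) = d.f₁ hv := by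
  rw [f₁, map_sub, d.cInd_fP hv hg.2, d.cInd_f₀ hv hg]

lemma f₁_mul_of_mem {g i : G} (hi : i ∈ K ⊓ P) : (d.f₁ hv).1 (g * i) = (d.f₁ hv).1 g := by
  rw [← cInd_apply, d.cInd_f₁ hv hi]

lemma f₁_apply (g : G) : (d.f₁ hv).1 g = (d.fP hv).1 g - (d.f₀ hv).1 g := rfl

/-- The function `fP` lives on `K P`, which is `K ∪ K s' J` by the decomposition of `P`; on `K` it
agrees with `f₀`, so the difference vanishes there. -/
lemma exists_of_f₁_ne_zero {g : G} (hg : (d.f₁ hv).1 g ≠ 0) :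
    ∃ κ ∈ K, ∃ y ∈ J, g = κ * s' * y := by
  have hKP : ∃ κ ∈ K, ∃ q ∈ P, g = κ * q := by
    by_cases h : (d.fP hv).1 g = 0
    · rw [f₁_apply, h, zero_sub, neg_ne_zero] at hg
      refine ⟨g, ?_, 1, P.one_mem, (mul_one g).symm⟩
      by_contra h'
      exact hg (d.f₀_of_notMem hv h')
    · exact d.exists_of_fP_ne_zero hv h
  obtain ⟨κ, hκ, q, hq, rfl⟩ := hKP
  rcases d.bruhat' q hq with hqK | ⟨i, hi, y, hy, rfl⟩
  · rw [f₁_apply, d.fP_mul hv hκ hq, cIndSpace_mul _ hκ, d.f₀_of_mem hv hqK, hv.fixed ⟨q, hqK⟩ hq,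
      sub_self] at hg
    exact absurd rfl hg
  · exact ⟨κ * i, mul_mem hκ hi.1, y, hy, by simp only [mul_assoc]⟩

lemma f₁_mul_s' {κ : G} (hκ : κ ∈ K) : (d.f₁ hv).1 (κ * s') = σ ⟨κ, hκ⟩ v₀ := by
  rw [f₁_apply, d.fP_mul hv hκ d.s'_mem, d.f₀_of_notMem hv, sub_zero]
  rw [Subgroup.mul_mem_cancel_left _ hκ]
  exact d.s'_notMem

/-- With `α = s' s`, the support `K s' J` equals `K α⁻¹ J` since `s ∈ K`, and `α` is not in it. -/
lemma f₁_s'_mul_s : (d.f₁ hv).1 (s' * s) = 0 := by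
  by_contra h
  obtain ⟨κ, hκ, y, hy, h⟩ := d.exists_of_f₁_ne_zero hv h
  refine d.ne (κ * s) (mul_mem hκ d.s_mem) y hy ?_
  rw [mul_inv_rev, d.s_inv, d.s'_inv, mul_assoc κ, ← mul_assoc s, d.s_mul_self, one_mul]
  exact h

lemma f₁_alpha_mul_s_mul {i : G} (hi : i ∈ K ⊓ P) : (d.f₁ hv).1 (s' * s * (s * i)) = v₀ := by
  rw [← mul_assoc, mul_assoc s' s s, d.s_mul_self, mul_one, d.f₁_mul_of_mem hv hi]
  have h1 := d.f₁_mul_s' hv K.one_mem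
  have h2 : (⟨1, K.one_mem⟩ : K) = 1 := rfl
  rwa [one_mul, h2, map_one, Module.End.one_apply] at h1

/-- Moving `α = s' s` past the opposite unipotent gives `α (s n s) = (s' n s') α` with `s' n s' ∈
K`, which reduces the claim to the vanishing at `α`. -/
lemma f₁_alpha_mul_unip {n i : G} (hn : s' * n * s' ∈ K) (hi : i ∈ K ⊓ P) :
    (d.f₁ hv).1 (s' * s * (s * n * s * i)) = 0 := by
  have e : s' * s * (s * n * s * i) = s' * n * s' * (s' * s) * i := by
    calc _ = s' * (s * s) * n * s * i := by group
      _ = s' * n * (s' * s') * s * i := by rw [d.s_mul_self, d.s'_mul_self, mul_one, mul_one]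
      _ = _ := by group
  rw [e, d.f₁_mul_of_mem hv hi, cIndSpace_mul _ hn, d.f₁_s'_mul_s hv, map_zero]

/-- All translates of `v₀` over `K / I` except `s v₀` are sent to `v₀` by `j`, since `j` factors
through the `J'`-coinvariants. The translates sum to zero and their number is `1` modulo `p`, so the
remaining value `j(s v₀)` must vanish. -/
lemma proj_s_eq_zero [CharP k p] {j : Module.End k W} (hj : IsProjectionJ σ J J' j) :
    j (σ ⟨s, d.s_mem⟩ v₀) = 0 ∧
      ∀ (n i : G) (hn : n ∈ K) (hi : i ∈ K ⊓ P), n ∈ J' →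
        j (σ ⟨n * i, mul_mem hn hi.1⟩ v₀) = v₀ := by
  have := d.finite_K
  have hfix : v₀ ∈ fixedVectors σ (J.subgroupOf K) := fun x => hv.fixed _ (d.J_le x.2).2
  have h2 : ∀ (n i : G) (hn : n ∈ K) (hi : i ∈ K ⊓ P), n ∈ J' →
        j (σ ⟨n * i, mul_mem hn hi.1⟩ v₀) = v₀ := by
    intro n i hn hi hnJ
    have : (⟨n * i, mul_mem hn hi.1⟩ : K) = ⟨n, hn⟩ * ⟨i, hi.1⟩ := rfl
    rw [this, map_mul, Module.End.mul_apply, hv.fixed ⟨i, hi.1⟩ hi.2, hj.coinvariant _ hnJ,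
      hj.eq_self _ hfix]
  refine ⟨?_, h2⟩
  let _ := Fintype.ofFinite (K ⧸ P.subgroupOf K)
  have hb : ∀ b ∈ P.subgroupOf K, σ b v₀ = v₀ := fun b hb => hv.fixed b hb
  have hsum : ∑ x : K ⧸ P.subgroupOf K, (j (σ x.out v₀) - v₀) =
      j (σ ⟨s, d.s_mem⟩ v₀) - v₀ := by
    rw [← apply_out_eq (B := P.subgroupOf K) hb]
    refine Finset.sum_eq_single _ (fun x _ hx => ?_) (fun h => absurd (Finset.mem_univ _) h)
    rcases d.bruhat_opposite x.out x.out.2 with ⟨i, hi, h⟩ | ⟨n, hn, hnJ, -, i, hi, h⟩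
    · refine absurd ?_ hx
      rw [← QuotientGroup.out_eq' x, eq_comm, QuotientGroup.eq, Subgroup.mem_subgroupOf]
      simpa [h] using hi.2
    · have hsn : s * n * s ∈ K := mul_mem (mul_mem d.s_mem (d.J_le hn).1) d.s_mem
      have : x.out = ⟨s * n * s * i, mul_mem hsn hi.1⟩ := Subtype.ext h
      rw [this, h2 _ _ hsn hi hnJ, sub_self]
  have horb : ∑ x : K ⧸ P.subgroupOf K, σ x.out v₀ = 0 := by
    rw [← finsum_eq_sum_of_fintype]
    exact hv.orbitSum_eq_zero
  have hcard : ((Fintype.card (K ⧸ P.subgroupOf K) : ℕ) : k) = 1 := by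
    have := (CharP.cast_eq_iff_mod_eq k p).2 d.card_K
    rwa [Nat.card_eq_fintype_card, Nat.cast_one] at this
  rw [Finset.sum_sub_distrib, ← map_sum, horb, map_zero, Finset.sum_const, Finset.card_univ,
    ← Nat.cast_smul_eq_nsmul k, hcard, one_smul, zero_sub] at hsum
  simpa using hsum.symm

/-- Among the cosets of `K / I`, only that of `s` gives a nonzero term at `α`, because `α s = s'`.
-/
lemma f₁_sum_eq : (orbitSum ((cInd K σ).comp K.subtype) (P.subgroupOf K) (d.f₁ hv)).1 (s' * s) =
    v₀ := by
  have := d.finite_K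
  let ev : cIndSpace K σ →+ W :=
    ((LinearMap.proj (s' * s) : (G → W) →ₗ[k] W).comp (cIndSpace K σ).subtype).toAddMonoidHom
  have h1 : (orbitSum ((cInd K σ).comp K.subtype) (P.subgroupOf K) (d.f₁ hv)).1 (s' * s) =
      ∑ᶠ x : K ⧸ P.subgroupOf K, (d.f₁ hv).1 (s' * s * x.out) :=
    ev.map_finsum (Set.toFinite _)
  rw [h1, finsum_eq_single _ (QuotientGroup.mk ⟨s, d.s_mem⟩)]
  · obtain ⟨b, hb⟩ := QuotientGroup.mk_out_eq_mul (P.subgroupOf K) ⟨s, d.s_mem⟩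
    rw [hb]
    exact d.f₁_alpha_mul_s_mul hv ⟨b.1.2, b.2⟩
  · intro x hx
    rcases d.bruhat_opposite x.out x.out.2 with ⟨i, hi, h⟩ | ⟨n, -, -, hn, i, hi, h⟩
    · refine absurd ?_ hx
      rw [← QuotientGroup.out_eq' x, eq_comm, QuotientGroup.eq, Subgroup.mem_subgroupOf]
      simpa [h] using hi.2
    · rw [h, d.f₁_alpha_mul_unip hv hn hi]

/-- The action of the Hecke operator on `f₀`. -/
lemma heckeOperator_f₀ [CharP k p] {T : Representation.IntertwiningMap (cInd K σ) (cInd K σ)}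
    (hT : IsHeckeOperatorAt σ J J' (s' * s) T) :
    T (d.f₀ hv) =
      orbitSum ((cInd K σ).comp K.subtype) (P.subgroupOf K) (d.f₁ hv) - d.f₁ hv := by
  obtain ⟨φ, hφ, hsupp, hproj, hTφ⟩ := hT
  have hfin := d.finite_K
  set S := orbitSum ((cInd K σ).comp K.subtype) (P.subgroupOf K) (d.f₁ hv) with hS
  have hSinv : ∀ κ ∈ K, cInd K σ κ S = S := fun κ hκ =>
    apply_orbitSum (τ := (cInd K σ).comp K.subtype) (B := P.subgroupOf K)
      (fun b hb => d.cInd_f₁ hv ⟨b.2, hb⟩) ⟨κ, hκ⟩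
  have hTg : ∀ g, (T (d.f₀ hv)).1 g = φ g v₀ := fun g => by
    rw [hTφ]
    exact heckeConvolution_cIndSingle hφ v₀ g
  ext g
  rw [hTg]
  change φ g v₀ = S.1 g - (d.f₁ hv).1 g
  -- On `K α K`, left equivariance and the `K`-invariance of the orbit sum leave the identity `j(κ'
  -- v₀) = v₀ - f₁(α κ')`. Outside, both sides vanish.
  by_cases hg : ∃ κ ∈ K, ∃ κ' ∈ K, g = κ * (s' * s) * κ'
  · obtain ⟨κ, hκ, κ', hκ', rfl⟩ := hg
    have h1 : φ (κ * (s' * s) * κ') v₀ = σ ⟨κ, hκ⟩ (φ (s' * s) (σ ⟨κ', hκ'⟩ v₀)) := by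
      have := hφ.bi_equivariant ⟨κ, hκ⟩ ⟨κ', hκ'⟩ (s' * s)
      rw [this]
      rfl
    have h2 : S.1 (κ * (s' * s) * κ') = σ ⟨κ, hκ⟩ v₀ := by
      rw [← cInd_apply, hSinv _ hκ', cIndSpace_mul _ hκ, d.f₁_sum_eq hv]
    rw [h1, h2, mul_assoc, cIndSpace_mul _ hκ, ← map_sub]
    congr 1
    have hp := d.proj_s_eq_zero hv hproj
    -- On the cell of `s` the identity reads `0 = v₀ - v₀`, on the other cell `v₀ = v₀ - 0`.
    rcases d.bruhat_opposite κ' hκ' with ⟨i, hi, rfl⟩ | ⟨n, hn, hnJ, hn', i, hi, rfl⟩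
    · rw [d.f₁_alpha_mul_s_mul hv hi, sub_self]
      have : (⟨s * i, hκ'⟩ : K) = ⟨s, d.s_mem⟩ * ⟨i, hi.1⟩ := rfl
      rw [this, map_mul, Module.End.mul_apply, hv.fixed ⟨i, hi.1⟩ hi.2, hp.1]
    · rw [d.f₁_alpha_mul_unip hv hn' hi, sub_zero]
      exact hp.2 _ _ (mul_mem (mul_mem d.s_mem (d.J_le hn).1) d.s_mem) hi hnJ
  · have h1 : φ g = 0 := by
      by_contra h
      obtain ⟨κ, κ', h⟩ := hsupp g h
      exact hg ⟨κ, κ.2, κ', κ'.2, h⟩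
    have h2 : ∀ κ' ∈ K, (d.f₁ hv).1 (g * κ') = 0 := by
      intro κ' hκ'
      by_contra h
      obtain ⟨κ, hκ, y, hy, h⟩ := d.exists_of_f₁_ne_zero hv h
      refine hg ⟨κ, hκ, s * y * κ'⁻¹, mul_mem (mul_mem d.s_mem (d.J_le hy).1) (inv_mem hκ'), ?_⟩
      calc g = g * κ' * κ'⁻¹ := by group
        _ = κ * s' * (s * s) * y * κ'⁻¹ := by rw [h, d.s_mul_self]; group
        _ = _ := by group
    let ev : cIndSpace K σ →+ W :=
      ((LinearMap.proj g : (G → W) →ₗ[k] W).comp (cIndSpace K σ).subtype).toAddMonoidHom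
    have h3 : S.1 g = ∑ᶠ x : K ⧸ P.subgroupOf K, (d.f₁ hv).1 (g * x.out) :=
      ev.map_finsum (Set.toFinite _)
    have h4 := h2 1 K.one_mem
    rw [mul_one] at h4
    rw [h3, h4, h1, finsum_congr fun x => h2 _ x.out.2]
    simp

/-- The vector `v₀` generates `σ` and the functions supported on `K` generate the induction, so `f₀`
generates everything and cannot lie in a proper kernel. -/
lemma map_f₀_ne_zero {ρ : Representation k G V} (q : Representation.IntertwiningMap (cInd K σ) ρ)
    (hq : ∃ f, q f ≠ 0) : q (d.f₀ hv) ≠ 0 := by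
  intro h0
  obtain ⟨f, hf⟩ := hq
  apply hf
  have hker : ∀ g, ∀ f ∈ LinearMap.ker q.toLinearMap,
      cInd K σ g f ∈ LinearMap.ker q.toLinearMap := by
    intro g f hf
    have h1 : q (cInd K σ g f) = ρ g (q f) := q.isIntertwining _ _ g f
    have h2 : q f = 0 := hf
    rw [h2, map_zero] at h1
    exact h1
  have htop := eq_top_of_cIndSingle_mem (hKo := d.isOpen_K) (hKc := d.isCompact_K)
    (hσ := hv.smooth) (LinearMap.ker q.toLinearMap) hker fun w => by
      have := hv.generates ((LinearMap.ker q.toLinearMap).comap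
        (cIndSingle d.isOpen_K d.isCompact_K hv.smooth)) (fun κ w hw => by
          rw [Submodule.mem_comap, ← cInd_cIndSingle]
          exact hker _ _ hw) h0
      exact (Submodule.eq_top_iff'.1 this) w
  exact (Submodule.eq_top_iff'.1 htop) f

/-- If the Hecke operator acts by `-1` on a quotient of `ind_K^G St`, then the images of `f₀`
and `f₁` are linearly independent. -/
theorem linearIndependent [CharP k p] (hp2 : (2 : k) ≠ 0) {ρ : Representation k G V}
    {T : Representation.IntertwiningMap (cInd K σ) (cInd K σ)}
    (hT : IsHeckeOperatorAt σ J J' (s' * s) T)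
    (q : Representation.IntertwiningMap (cInd K σ) ρ) (hq : ∃ f, q f ≠ 0)
    (hqT : ∀ f, q (T f) = -q f) :
    LinearIndependent k ![q (d.f₀ hv), q (d.f₁ hv)] := by
  have hF0 := d.map_f₀_ne_zero hv q hq
  have hfinK := d.finite_K
  have hfinP := d.finite_P
  have hprop : ∀ r : k, q (d.f₁ hv) ≠ r • q (d.f₀ hv) := by
    intro r hr
    have hqK : ∀ f, q (orbitSum ((cInd K σ).comp K.subtype) (P.subgroupOf K) f) =
        orbitSum (ρ.comp K.subtype) (P.subgroupOf K) (q f) := fun f =>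
      map_orbitSum q.toLinearMap fun a v => q.isIntertwining _ _ (a : G) v
    have hqP : q (d.fP hv) = orbitSum (ρ.comp P.subtype) (K.subgroupOf P) (q (d.f₀ hv)) :=
      map_orbitSum q.toLinearMap fun a v => q.isIntertwining _ _ (a : G) v
    have hsum0 : orbitSum ((cInd K σ).comp K.subtype) (P.subgroupOf K) (d.f₀ hv) = 0 := by
      rw [f₀, ← map_orbitSum (τ := σ) (cIndSingle d.isOpen_K d.isCompact_K hv.smooth)
        fun a v => (cInd_cIndSingle a v).symm, hv.orbitSum_eq_zero, map_zero]
    have h1 := hqT (d.f₀ hv)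
    rw [d.heckeOperator_f₀ hv hT, map_sub, hqK, hr, orbitSum_smul, ← hqK, hsum0, map_zero,
      smul_zero, zero_sub, neg_inj] at h1
    -- The orbit sum of `r f₀` over `K` is zero, so `T f₀ = Σ_K f₁ - f₁` becomes `-r f₀`, which must
    -- equal `-f₀`.
    have hr1 : r = 1 := by
      have : (r - 1) • q (d.f₀ hv) = 0 := by rw [sub_smul, one_smul, h1, sub_self]
      exact sub_eq_zero.1 ((smul_eq_zero.1 this).resolve_right hF0)
    have h2 : q (d.fP hv) = (2 : k) • q (d.f₀ hv) := by
      have : d.fP hv = d.f₁ hv + d.f₀ hv := by rw [f₁, sub_add_cancel]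
      rw [this, map_add, hr, hr1, one_smul, two_smul]
    -- Since `fP` is `P`-invariant and maps to twice the image of `f₀`, invertibility of `2` makes
    -- that image `P`-invariant.
    have h3 : ∀ g : P, (ρ.comp P.subtype) g (q (d.f₀ hv)) = q (d.f₀ hv) := by
      intro g
      have h4 : q (cInd K σ g (d.fP hv)) = ρ g (q (d.fP hv)) := q.isIntertwining _ _ g _
      rw [d.cInd_fP hv g.2, h2, map_smul] at h4
      exact (smul_right_injective V hp2 h4).symm
    have hcard : ((Nat.card (P ⧸ K.subgroupOf P) : ℕ) : k) = 1 := by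
      simpa using (CharP.cast_eq_iff_mod_eq k p).2 d.card_P
    -- The orbit sum of an invariant vector is the index times the vector, and the index is `1` in
    -- `k`; comparison with `2 f₀` forces `f₀` to map to zero.
    rw [orbitSum_of_invariant h3, h2, ← Nat.cast_smul_eq_nsmul k, hcard, one_smul, two_smul,
      add_eq_left] at hqP
    exact hF0 hqP
  rw [LinearIndependent.pair_iff]
  intro a b hab
  have hb : b = 0 := by
    by_contra hb
    apply hprop (-(b⁻¹ * a))
    rw [neg_smul, mul_smul, eq_neg_iff_add_eq_zero, ← smul_right_injective V hb |>.eq_iff]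
    rw [smul_add, smul_inv_smul₀ hb, smul_zero, add_comm]
    exact hab
  refine ⟨?_, hb⟩
  rw [hb, zero_smul, add_zero] at hab
  exact (smul_eq_zero.1 hab).resolve_right hF0

end IsEdgeDatum

namespace U21

/-! ### The edge of the tree of `U(2,1)` at the vertex of `K`. -/

section EdgeDatum

variable {F E : Type*} [Field F] [ValuativeRel F] [Field E] [ValuativeRel E]
  [TopologicalSpace E] [IsNonarchimedeanLocalField E] [Algebra F E] [ValuativeExtension F E]
  {c : QuadraticConjugation F E} {ϖ : Uniformizer F}

lemma finite_quotient_parahoric (h : IsUnramifiedConjugation c ϖ) (m n : ℤ) :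
    Finite (parahoric c ϖ m ⧸ (parahoric c ϖ n).subgroupOf (parahoric c ϖ m)) := by
  have : CompactSpace (parahoric c ϖ m) := isCompact_iff_compactSpace.1 (isCompact_parahoric h m)
  exact Subgroup.quotient_finite_of_isOpen _
    ((isOpen_congruenceSubgroup _ (expP_add_le n)).preimage continuous_subtype_val)

lemma map_conj_refl_parahoric {m n n' : ℤ} (hn : n' = 2 * m - n) :
    (parahoric c ϖ n).map (MulAut.conj (refl c ϖ m)).toMonoidHom = parahoric c ϖ n' := by
  have hr := refl_mul_self c ϖ m
  ext g
  constructor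
  · rintro ⟨x, hx, rfl⟩
    have := refl_conj_mem_parahoric (m := m) hn hx
    simpa [MulAut.conj_apply, refl_inv] using this
  · intro hg
    refine ⟨refl c ϖ m * g * refl c ϖ m,
      refl_conj_mem_parahoric (n' := n) (m := m) (by omega) hg, ?_⟩
    rw [MulEquiv.coe_toMonoidHom, MulAut.conj_apply, refl_inv,
      show refl c ϖ m * (refl c ϖ m * g * refl c ϖ m) * refl c ϖ m =
        refl c ϖ m * refl c ϖ m * g * (refl c ϖ m * refl c ϖ m) by group, hr, one_mul, mul_one]

/-- The reflection at `m + 1` exchanges the two neighbouring vertices in the apartment, so the edges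
at `m + 1` may be counted from either side. -/
lemma relIndex_parahoric_pred (m : ℤ) :
    (parahoric c ϖ m).relIndex (parahoric c ϖ (m + 1)) =
      (parahoric c ϖ (m + 1 + 1)).relIndex (parahoric c ϖ (m + 1)) := by
  rw [← map_conj_refl_parahoric (m := m + 1) (n := m + 1 + 1) (n' := m) (by omega)]
  conv_lhs => rw [← map_conj_refl_parahoric (c := c) (ϖ := ϖ) (m := m + 1) (n := m + 1)
    (n' := m + 1) (by omega)]
  exact Subgroup.relIndex_map_map_of_injective _ _ (MulAut.conj (refl c ϖ (m + 1))).injective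

lemma isEdgeDatum (h : IsUnramifiedConjugation c ϖ) {p : ℕ} [hp : Fact p.Prime]
    (hpv : valuation E (p : E) < 1) (κ : MaxCompactKind) :
    IsEdgeDatum p (maxCompact c ϖ κ) (parahoric c ϖ (mIdx κ + 1)) (proPIwahori c ϖ κ)
      (proPIwahori' c ϖ κ) (betaK c ϖ κ) (refl c ϖ (mIdx κ + 1)) := by
  have hα : refl c ϖ (mIdx κ + 1) * betaK c ϖ κ = alphaElt c ϖ := by
    rw [betaK_eq_refl, refl_succ_mul_refl]
  have hI : maxCompact c ϖ κ ⊓ parahoric c ϖ (mIdx κ + 1) = iwahori c ϖ κ := by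
    rw [maxCompact_eq, iwahori_eq h]
  refine
    { isOpen_K := isOpen_congruenceSubgroup _ _
      isCompact_K := ?_
      J_le := ?_
      s_mem := betaK_mem c ϖ κ
      s_mul_self := betaK_mul_self c ϖ κ
      s'_mem := refl_mem_parahoric h _
      s'_mul_self := refl_mul_self c ϖ _
      bruhat := ?_
      bruhat' := ?_
      ne := fun k hk y hy => ?_
      notMem := ?_
      finite_K := ?_
      finite_P := ?_
      card_K := ?_
      card_P := ?_ }
  · rw [maxCompact_eq]
    exact isCompact_parahoric h _
  · rw [hI]
    exact proPIwahori_le_iwahori h κ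
  · intro g hg
    rw [maxCompact_eq] at hg ⊢
    rw [betaK_eq_refl]
    rcases bruhat h hg with h1 | ⟨x, y, hxy, hm, i, hi, h1⟩
    · exact Or.inl h1
    · exact Or.inr ⟨_, unip_mem_proPIwahori h hxy hm,
        refl_conj_mem_proPIwahori' κ (unip_mem_proPIwahori h hxy hm),
        refl_conj_unip_mem_parahoric h hxy hm, i, hi, h1⟩
  · intro g hg
    rw [hI]
    nth_rw 1 [maxCompact_eq]
    exact U21.bruhat_opposite h hg
  · rw [hα]
    exact alphaElt_ne h hk hy
  · rw [hα]
    exact alphaElt_inv_not_mem h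
  · rw [maxCompact_eq]
    exact finite_quotient_parahoric h _ _
  · rw [maxCompact_eq]
    exact finite_quotient_parahoric h _ _
  · rw [maxCompact_eq]
    have := finite_quotient_parahoric h (mIdx κ) (mIdx κ + 1)
    exact card_quotient_modEq_one h hpv _
  · rw [maxCompact_eq]
    have := finite_quotient_parahoric h (mIdx κ + 1) (mIdx κ + 1 + 1)
    have h1 := card_quotient_modEq_one h hpv (mIdx κ + 1)
    -- The count at the second vertex is known relative to the edge pointing away from `K`, and is
    -- transported to the edge pointing back.
    change (parahoric c ϖ (mIdx κ + 1 + 1)).relIndex (parahoric c ϖ (mIdx κ + 1)) ≡ 1 [MOD p] at h1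
    rw [← relIndex_parahoric_pred] at h1
    exact h1

end EdgeDatum

end U21

/-! ### Functions on a finite coset space modulo constants. -/

section Steinberg

variable {k A : Type*} [Field k] [Group A] {B : Subgroup A}

/-- The image of the characteristic function of the base point in the functions modulo constants. -/
noncomputable def baseVector (k : Type*) [Field k] (B : Subgroup A) :
    (A ⧸ B → k) ⧸ (Submodule.span k {(1 : A ⧸ B → k)}) := by
  classical exact Submodule.Quotient.mk (Pi.single (QuotientGroup.mk 1) 1)

open Classical in
lemma functionsModConstants_baseVector (a : A) :
    functionsModConstants k B a (baseVector k B) =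
      Submodule.Quotient.mk (Pi.single (QuotientGroup.mk a) 1) := by
  have : functionsRep k B a (Pi.single (QuotientGroup.mk 1) 1) =
      Pi.single (QuotientGroup.mk a) 1 := by
    ext x
    change (Pi.single (QuotientGroup.mk 1) 1 : A ⧸ B → k) (a⁻¹ • x) = _
    rw [Pi.single_apply, Pi.single_apply]
    refine if_congr ?_ rfl rfl
    rw [inv_smul_eq_iff, MulAction.Quotient.smul_mk, smul_eq_mul, mul_one]
  exact congrArg Submodule.Quotient.mk this

lemma functionsModConstants_baseVector_of_mem {b : A} (hb : b ∈ B) :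
    functionsModConstants k B b (baseVector k B) = baseVector k B := by
  classical
  rw [functionsModConstants_baseVector]
  have : (QuotientGroup.mk b : A ⧸ B) = QuotientGroup.mk 1 := by
    rw [eq_comm, QuotientGroup.eq, inv_one, one_mul]
    exact hb
  rw [this]
  rfl

/-- The point masses add up to the constant function `1`. -/
lemma orbitSum_baseVector [Finite (A ⧸ B)] :
    orbitSum (functionsModConstants k B) B (baseVector k B) = 0 := by
  classical
  let _ := Fintype.ofFinite (A ⧸ B)
  rw [orbitSum, finsum_eq_sum_of_fintype]
  simp only [functionsModConstants_baseVector, QuotientGroup.out_eq']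
  change ∑ x : A ⧸ B, Submodule.mkQ (Submodule.span k {(1 : A ⧸ B → k)}) (Pi.single x 1) = 0
  rw [← map_sum, Submodule.mkQ_apply, Submodule.Quotient.mk_eq_zero]
  refine Submodule.subset_span ?_
  rw [Set.mem_singleton_iff]
  ext x
  simp [Finset.sum_apply, Pi.single_apply]

lemma baseVector_generates [Finite (A ⧸ B)]
    (N : Submodule k ((A ⧸ B → k) ⧸ (Submodule.span k {(1 : A ⧸ B → k)})))
    (hN : ∀ a, ∀ w ∈ N, functionsModConstants k B a w ∈ N) (h0 : baseVector k B ∈ N) : N = ⊤ := by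
  classical
  let _ := Fintype.ofFinite (A ⧸ B)
  rw [Submodule.eq_top_iff']
  intro w
  obtain ⟨f, rfl⟩ := Submodule.mkQ_surjective _ w
  rw [pi_eq_sum_univ' f, map_sum]
  refine N.sum_mem fun x _ => ?_
  rw [map_smul]
  refine N.smul_mem _ ?_
  induction x using QuotientGroup.induction_on with
  | H a =>
  have := hN a _ h0
  rw [functionsModConstants_baseVector] at this
  convert this using 1
  rw [Submodule.mkQ_apply]

lemma baseVector_ne_zero (hB : B ≠ ⊤) : baseVector k B ≠ 0 := by
  classical
  intro h
  obtain ⟨a, ha⟩ : ∃ a, a ∉ B := by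
    by_contra! h'
    exact hB ((Subgroup.eq_top_iff' B).2 h')
  have h' := (Submodule.Quotient.mk_eq_zero _).1 h
  obtain ⟨r, hr⟩ := Submodule.mem_span_singleton.1 h'
  have h1 := congrFun hr (QuotientGroup.mk 1)
  have h2 := congrFun hr (QuotientGroup.mk a)
  have hne : (QuotientGroup.mk a : A ⧸ B) ≠ QuotientGroup.mk 1 := by
    rw [Ne, eq_comm, QuotientGroup.eq, inv_one, one_mul]
    exact ha
  simp [hne] at h1 h2
  exact one_ne_zero (h1.symm.trans h2)

/-- If `J ⊆ B` acts transitively on the complement of the base point, then the functions modulo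
constants which are fixed by `J` form a line. -/
lemma eq_smul_baseVector {J : Subgroup A} (hJ : J ≤ B)
    (htrans : ∀ a, a ∉ B → ∀ a', a' ∉ B → ∃ n ∈ J, (QuotientGroup.mk (n * a) : A ⧸ B) = a')
    {v : (A ⧸ B → k) ⧸ (Submodule.span k {(1 : A ⧸ B → k)})}
    (hv : ∀ n ∈ J, functionsModConstants k B n v = v) : ∃ r : k, v = r • baseVector k B := by
  classical
  obtain ⟨f, rfl⟩ := Submodule.mkQ_surjective _ v
  have hinv : ∀ n ∈ J, ∀ x : A ⧸ B, f (n⁻¹ • x) = f x := by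
    intro n hn
    have h1 : (Submodule.Quotient.mk (functionsRep k B n f) : _ ⧸ _) = Submodule.Quotient.mk f :=
      hv n hn
    rw [Submodule.Quotient.eq] at h1
    obtain ⟨r, hr⟩ := Submodule.mem_span_singleton.1 h1
    have h2 : ∀ x, r = f (n⁻¹ • x) - f x := fun x => by
      have := congrFun hr x
      rw [Pi.smul_apply, Pi.one_apply, smul_eq_mul, mul_one] at this
      exact this
    have h3 : n⁻¹ • (QuotientGroup.mk 1 : A ⧸ B) = QuotientGroup.mk 1 := by
      rw [MulAction.Quotient.smul_mk, eq_comm, QuotientGroup.eq, inv_one, one_mul, smul_eq_mul,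
        mul_one]
      exact inv_mem (hJ hn)
    -- Invariance modulo constants becomes true invariance: the discrepancy is a constant, and it
    -- can be read off at the base point, which `J` fixes.
    have hr0 : r = 0 := by rw [h2 (QuotientGroup.mk 1), h3, sub_self]
    intro x
    have := h2 x
    rw [hr0] at this
    exact (sub_eq_zero.1 this.symm)
  by_cases hB : ∃ a, a ∉ B
  · obtain ⟨a, ha⟩ := hB
    refine ⟨f (QuotientGroup.mk 1) - f (QuotientGroup.mk a), ?_⟩
    rw [baseVector, Submodule.mkQ_apply, ← Submodule.Quotient.mk_smul, Submodule.Quotient.eq]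
    refine Submodule.mem_span_singleton.2 ⟨f (QuotientGroup.mk a), ?_⟩
    ext x
    induction x using QuotientGroup.induction_on with
    | H b =>
    by_cases hb : b ∈ B
    · have : (QuotientGroup.mk b : A ⧸ B) = QuotientGroup.mk 1 := by
        rw [eq_comm, QuotientGroup.eq, inv_one, one_mul]
        exact hb
      rw [this]
      simp
    · obtain ⟨n, hn, hna⟩ := htrans a ha b hb
      have h1 := hinv n hn (QuotientGroup.mk (n * a))
      rw [MulAction.Quotient.smul_mk, smul_eq_mul, inv_mul_cancel_left, hna] at h1
      have hne : (QuotientGroup.mk b : A ⧸ B) ≠ QuotientGroup.mk 1 := by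
        rw [Ne, eq_comm, QuotientGroup.eq, inv_one, one_mul]
        exact hb
      simp [h1, hne]
  · push Not at hB
    refine ⟨0, ?_⟩
    rw [zero_smul, Submodule.mkQ_apply, Submodule.Quotient.mk_eq_zero]
    refine Submodule.mem_span_singleton.2 ⟨f (QuotientGroup.mk 1), ?_⟩
    ext x
    induction x using QuotientGroup.induction_on with
    | H b =>
    have : (QuotientGroup.mk b : A ⧸ B) = QuotientGroup.mk 1 := by
      rw [eq_comm, QuotientGroup.eq, inv_one, one_mul]
      exact hB b
    rw [this]
    simp

/-- The smooth vectors form a subrepresentation, and they contain the generator `baseVector`, which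
is fixed by the open subgroup `B`. -/
lemma functionsModConstants_isSmoothRep [TopologicalSpace A] [IsTopologicalGroup A]
    [Finite (A ⧸ B)] (hB : IsOpen (B : Set A)) : IsSmoothRep (functionsModConstants k B) := by
  classical
  let N : Submodule k ((A ⧸ B → k) ⧸ (Submodule.span k {(1 : A ⧸ B → k)})) :=
    { carrier := {v | ∃ U : Subgroup A, IsOpen (U : Set A) ∧
        ∀ u ∈ U, functionsModConstants k B u v = v}
      add_mem' := by
        rintro v w ⟨U, hU, hv⟩ ⟨U', hU', hw⟩
        exact ⟨U ⊓ U', hU.inter hU', fun u hu => by rw [map_add, hv u hu.1, hw u hu.2]⟩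
      zero_mem' := ⟨⊤, isOpen_univ, fun u _ => map_zero _⟩
      smul_mem' := by
        rintro r v ⟨U, hU, hv⟩
        exact ⟨U, hU, fun u hu => by rw [map_smul, hv u hu]⟩ }
  have hN : N = ⊤ := by
    refine baseVector_generates N ?_ ⟨B, hB, fun u hu =>
      functionsModConstants_baseVector_of_mem hu⟩
    rintro a w ⟨U, hU, hw⟩
    refine ⟨U.comap (MulAut.conj a⁻¹).toMonoidHom, ?_, fun u hu => ?_⟩
    · have hc : Continuous fun x : A => (MulAut.conj a⁻¹) x := by
        simp only [MulAut.conj_apply]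
        fun_prop
      exact hU.preimage hc
    · have hu' : a⁻¹ * u * a ∈ U := by simpa using! hu
      rw [← Module.End.mul_apply, ← map_mul, show u * a = a * (a⁻¹ * u * a) by group, map_mul,
        Module.End.mul_apply, hw _ hu']
  intro v
  exact (Submodule.eq_top_iff'.1 hN) v

end Steinberg

namespace U21

/-! ### Counting the solutions of the equation of `L` modulo `p`. -/

section Residue

variable {F E : Type*} [Field F] [ValuativeRel F] [TopologicalSpace F]
  [IsNonarchimedeanLocalField F] [Field E] [ValuativeRel E]
  [TopologicalSpace E] [IsNonarchimedeanLocalField E] [Algebra F E] [ValuativeExtension F E]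

lemma natCard_residueField_eq_pow (p : ℕ) [CharP 𝓀[F] p] :
    ∃ n : ℕ, Nat.card 𝓀[F] = p ^ n := by
  let _ := Fintype.ofFinite 𝓀[F]
  obtain ⟨n, -, hn⟩ := FiniteField.card 𝓀[F] p
  exact ⟨n, by rw [Nat.card_eq_fintype_card, hn]⟩

/-- Translation by a vector of trace zero preserves the defining equation of `L`. -/
lemma InL.add_right {R : Type*} [Field R] {p n : ℕ} [Fact p.Prime] [CharP R p]
    (κ : MaxCompactKind) {d x t : R} (hd : d + d ^ p ^ n = 0) (h : InL κ (p ^ n) x t) :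
    InL κ (p ^ n) x (t + d) := by
  cases κ
  · refine ⟨h.1, ?_⟩
    rw [add_pow_char_pow]
    linear_combination h.2 + hd
  · have h' : x * x ^ p ^ n + t + t ^ p ^ n = 0 := h
    change x * x ^ p ^ n + (t + d) + (t + d) ^ p ^ n = 0
    rw [add_pow_char_pow]
    linear_combination h' + hd

/-- Translation of the second coordinate by `d ≠ 0` is a permutation of order `p` without fixed
points. -/
lemma dvd_card_of_translation {R : Type*} [Field R] [Finite R] {p : ℕ} [hp : Fact p.Prime]
    [CharP R p] {d : R} (hd0 : d ≠ 0) (S : R → R → Prop) (hS : ∀ x t, S x t → S x (t + d)) :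
    p ∣ Nat.card {y : R × R // S y.1 y.2} := by
  classical
  let _ := Fintype.ofFinite {y : R × R // S y.1 y.2}
  let f : {y : R × R // S y.1 y.2} → {y : R × R // S y.1 y.2} :=
    fun y => ⟨(y.1.1, y.1.2 + d), hS _ _ y.2⟩
  have hiter : ∀ n y, (f^[n] y).1 = (y.1.1, y.1.2 + n * d) := by
    intro n
    induction n with
    | zero => intro y; simp
    | succ n ih =>
      intro y
      rw [Function.iterate_succ_apply, ih]
      simp only [f]
      push_cast
      ext
      · rfl
      · change y.1.2 + d + n * d = y.1.2 + (n + 1) * d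
        ring
  have hfp : ∀ y, f^[p] y = y := by
    intro y
    apply Subtype.ext
    rw [hiter, CharP.cast_eq_zero, zero_mul, add_zero]
  have hp0 : p = (p - 1) + 1 := (Nat.succ_pred_prime hp.out).symm
  let σ : Equiv.Perm {y : R × R // S y.1 y.2} :=
    { toFun := f
      invFun := f^[p - 1]
      left_inv := fun y => by
        rw [← Function.iterate_succ_apply f, Nat.succ_eq_add_one, ← hp0, hfp]
      right_inv := fun y => by
        rw [← Function.iterate_succ_apply' f, Nat.succ_eq_add_one, ← hp0, hfp] }
  have hσ : σ ^ p ^ 1 = 1 := by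
    ext1 y
    rw [pow_one, Equiv.Perm.one_apply, ← Equiv.Perm.iterate_eq_pow]
    exact hfp y
  have h := Equiv.Perm.card_compl_support_modEq hσ
  have hsupp : σ.supportᶜ = ∅ := by
    rw [Finset.eq_empty_iff_forall_notMem]
    intro y hy
    rw [Finset.mem_compl, Equiv.Perm.mem_support, not_not] at hy
    have : y.1.2 + d = y.1.2 := congrArg (fun z => z.1.2) hy
    exact hd0 (by simpa using this)
  rw [hsupp, Finset.card_empty] at h
  rw [Nat.card_eq_fintype_card]
  exact (Nat.modEq_zero_iff_dvd).1 h.symm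

/-- A solution with `t = 0` also has `x = 0`, so restricting to `t ≠ 0` removes a single point. -/
lemma card_InL_units {R : Type*} [Field R] [Finite R] (κ : MaxCompactKind) {q : ℕ} (hq : q ≠ 0) :
    Nat.card {y : R × R // InL κ q y.1 y.2} =
      Nat.card {y : R × Rˣ // InL κ q y.1 (y.2 : R)} + 1 := by
  classical
  have h00 : InL κ q (0 : R) 0 := by
    cases κ <;> simp [InL, hq]
  have hx : ∀ x : R, InL κ q x 0 → x = 0 := by
    intro x hx
    cases κ
    · exact hx.1
    · have : x * x ^ q + 0 + 0 ^ q = 0 := hx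
      rw [zero_pow hq, add_zero, add_zero, ← pow_succ'] at this
      exact pow_eq_zero_iff (Nat.succ_ne_zero q) |>.1 this
  let e : {y : R × R // InL κ q y.1 y.2} ≃ Option {y : R × Rˣ // InL κ q y.1 (y.2 : R)} :=
    { toFun := fun y => if h : y.1.2 = 0 then none else
        some ⟨(y.1.1, Units.mk0 y.1.2 h), y.2⟩
      invFun := fun y => match y with
        | none => ⟨(0, 0), h00⟩
        | some y => ⟨(y.1.1, y.1.2), y.2⟩
      left_inv := by
        rintro ⟨⟨x, t⟩, h⟩
        by_cases ht : t = 0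
        · subst ht
          have := hx x h
          subst this
          simp
        · simp [ht]
      right_inv := by
        rintro (_ | ⟨⟨x, t⟩, h⟩)
        · simp
        · simp }
  rw [Nat.card_congr e, Finite.card_option]

/-- Translation by a residual element of trace zero preserves the solutions, so their total number
vanishes in `k`; omitting the trivial one leaves `-1`. -/
lemma card_InL_cast (p : ℕ) [hp : Fact p.Prime] (hp2 : p ≠ 2) [CharP 𝓀[F] p]
    (hdeg : Module.finrank F E = 2) {c : QuadraticConjugation F E} {ϖ : Uniformizer F}
    (h : IsUnramifiedConjugation c ϖ) (κ : MaxCompactKind) (k : Type*) [Field k] [CharP k p] :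
    ((Nat.card {y : 𝓀[E] × 𝓀[E]ˣ // InL κ (Nat.card 𝓀[F]) y.1 (y.2 : 𝓀[E])} : ℕ) : k) = -1 := by
  have := charP_residueField (F := F) (E := E) p
  obtain ⟨d, hd0, hd⟩ := exists_residue_traceZero p hp2 hdeg h
  obtain ⟨n, hn⟩ := natCard_residueField_eq_pow (F := F) p
  have hdvd := dvd_card_of_translation (p := p) hd0 (InL κ (Nat.card 𝓀[F])) fun x t hxt => by
    rw [hn] at hd hxt ⊢
    exact InL.add_right κ hd hxt
  rw [card_InL_units κ Nat.card_pos.ne', ← CharP.cast_eq_zero_iff k p, Nat.cast_add,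
    Nat.cast_one] at hdvd
  exact eq_neg_of_add_eq_zero_left hdvd

end Residue

/-! ### The Steinberg weight and its `I_{1,K}`-fixed line. -/

section Weights

variable {F E : Type*} [Field F] [ValuativeRel F]
  [Field E] [ValuativeRel E]
  [TopologicalSpace E] [IsNonarchimedeanLocalField E] [Algebra F E] [ValuativeExtension F E]
  {c : QuadraticConjugation F E} {ϖ : Uniformizer F} {κ : MaxCompactKind}
  {k W V : Type*} [Field k] [AddCommGroup W] [Module k W] [AddCommGroup V] [Module k V]
  {σ : Representation k (maxCompact c ϖ κ) W}

lemma iwahori_subgroupOf (h : IsUnramifiedConjugation c ϖ) (κ : MaxCompactKind) :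
    (iwahori c ϖ κ).subgroupOf (maxCompact c ϖ κ) =
      (parahoric c ϖ (mIdx κ + 1)).subgroupOf (maxCompact c ϖ κ) := by
  ext g
  rw [Subgroup.mem_subgroupOf, Subgroup.mem_subgroupOf, iwahori_eq h, ← maxCompact_eq]
  exact ⟨fun hg => hg.2, fun hg => ⟨g.2, hg⟩⟩

lemma finite_quotient_iwahori (h : IsUnramifiedConjugation c ϖ) (κ : MaxCompactKind) :
    Finite (maxCompact c ϖ κ ⧸ (iwahori c ϖ κ).subgroupOf (maxCompact c ϖ κ)) := by
  rw [iwahori_subgroupOf h, maxCompact_eq]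
  exact finite_quotient_parahoric h _ _

lemma isSmoothRep_steinberg (h : IsUnramifiedConjugation c ϖ) :
    IsSmoothRep (steinberg c ϖ κ k) := by
  have := finite_quotient_iwahori h κ
  exact functionsModConstants_isSmoothRep
    ((isOpen_congruenceSubgroup (expI κ) (by cases κ <;> decide)).preimage continuous_subtype_val)

/-- By the Bruhat decomposition, `I_{1,K}` acts transitively on the complement of the base point in
`K / I_K`. -/
lemma eq_smul_baseVector_of_mem_fixedVectors (h : IsUnramifiedConjugation c ϖ) {v}
    (hv : v ∈ fixedVectors (steinberg c ϖ κ k)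
      ((proPIwahori c ϖ κ).subgroupOf (maxCompact c ϖ κ))) :
    ∃ r : k, v = r • baseVector k ((iwahori c ϖ κ).subgroupOf (maxCompact c ϖ κ)) := by
  refine eq_smul_baseVector (J := (proPIwahori c ϖ κ).subgroupOf (maxCompact c ϖ κ))
    (fun g hg => proPIwahori_le_iwahori h κ hg) (fun a ha a' ha' => ?_) fun n hn => hv ⟨n, hn⟩
  have key : ∀ a : maxCompact c ϖ κ, a ∉ (iwahori c ϖ κ).subgroupOf (maxCompact c ϖ κ) →
      ∃ n : maxCompact c ϖ κ, (n : unitaryGroup c) ∈ proPIwahori c ϖ κ ∧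
        ∃ i : maxCompact c ϖ κ, (i : unitaryGroup c) ∈ iwahori c ϖ κ ∧
          a = n * betaKmem c ϖ κ * i := by
    intro a ha
    have haK := (SetLike.ext_iff.1 (maxCompact_eq (c := c) (ϖ := ϖ) κ) _).1 a.2
    rcases bruhat h haK with h1 | ⟨x, y, hxy, hm, i, hi, h1⟩
    · refine absurd ?_ ha
      rw [iwahori_subgroupOf h]
      exact h1
    · refine ⟨⟨unip c x y hxy, ?_⟩, unip_mem_proPIwahori h hxy hm, ⟨i, ?_⟩, ?_, ?_⟩
      · rw [maxCompact_eq]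
        exact unip_mem_parahoric h le_rfl hxy hm
      · rw [maxCompact_eq]
        exact hi.1
      · rw [iwahori_eq h]
        exact hi
      · apply Subtype.ext
        rw [h1, ← betaK_eq_refl]
        rfl
  obtain ⟨n, hn, i, hi, rfl⟩ := key a ha
  obtain ⟨n', hn', i', hi', rfl⟩ := key a' ha'
  refine ⟨n' * n⁻¹, mul_mem hn' (inv_mem hn), ?_⟩
  rw [QuotientGroup.eq]
  have e : (n' * n⁻¹ * (n * betaKmem c ϖ κ * i))⁻¹ * (n' * betaKmem c ϖ κ * i') = i⁻¹ * i' := by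
    group
  rw [e]
  exact mul_mem (inv_mem hi) hi'

lemma baseVector_steinberg_ne_zero (h : IsUnramifiedConjugation c ϖ) :
    baseVector k ((iwahori c ϖ κ).subgroupOf (maxCompact c ϖ κ)) ≠ 0 := by
  refine baseVector_ne_zero fun htop => ?_
  have h1 : betaKmem c ϖ κ ∈ (iwahori c ϖ κ).subgroupOf (maxCompact c ϖ κ) := by
    rw [htop]; trivial
  rw [iwahori_subgroupOf h, Subgroup.mem_subgroupOf] at h1
  have h2 : betaK c ϖ κ ∈ parahoric c ϖ (mIdx κ + 1) := h1
  rw [betaK_eq_refl, mem_parahoric_iff h] at h2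
  have h3 := h2 2 0
  simp [refl, expP, -zpow_neg] at h3
  rw [h.zpow_le_iff] at h3
  omega

lemma baseVector_mem_fixedVectors (h : IsUnramifiedConjugation c ϖ) :
    baseVector k ((iwahori c ϖ κ).subgroupOf (maxCompact c ϖ κ)) ∈
      fixedVectors (steinberg c ϖ κ k) ((proPIwahori c ϖ κ).subgroupOf (maxCompact c ϖ κ)) :=
  fun n => functionsModConstants_baseVector_of_mem (proPIwahori_le_iwahori h κ n.2)

lemma exists_baseVector_of_equiv (h : IsUnramifiedConjugation c ϖ)
    (e : σ.Equiv (steinberg c ϖ κ k)) {v : W}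
    (hv : v ∈ fixedVectors σ ((proPIwahori c ϖ κ).subgroupOf (maxCompact c ϖ κ))) :
    ∃ r : k, e v = r • baseVector k ((iwahori c ϖ κ).subgroupOf (maxCompact c ϖ κ)) :=
  eq_smul_baseVector_of_mem_fixedVectors h fun n => by
    have h1 : e (σ n v) = steinberg c ϖ κ k n (e v) := e.toIntertwiningMap.isIntertwining _ _ n v
    have h2 : σ n v = v := hv n
    rw [h2] at h1
    exact h1.symm

/-- The fixed line is spanned by the image of a point mass whose stabilizer contains the Iwahori
subgroup, so the character `χ_σ` is trivial for the Steinberg weight. -/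
lemma apply_eq_self_of_mem_iwahori (h : IsUnramifiedConjugation c ϖ)
    (e : σ.Equiv (steinberg c ϖ κ k)) {v : W}
    (hv : v ∈ fixedVectors σ ((proPIwahori c ϖ κ).subgroupOf (maxCompact c ϖ κ)))
    {g : maxCompact c ϖ κ} (hg : (g : unitaryGroup c) ∈ iwahori c ϖ κ) : σ g v = v := by
  obtain ⟨r, hr⟩ := exists_baseVector_of_equiv h e hv
  apply EquivLike.injective e
  have h1 : e (σ g v) = steinberg c ϖ κ k g (e v) := e.toIntertwiningMap.isIntertwining _ _ g v
  rw [h1, hr, map_smul]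
  exact congrArg _ (functionsModConstants_baseVector_of_mem hg)

lemma isSteinbergVector (h : IsUnramifiedConjugation c ϖ)
    (e : σ.Equiv (steinberg c ϖ κ k)) {v : W}
    (hv : v ∈ fixedVectors σ ((proPIwahori c ϖ κ).subgroupOf (maxCompact c ϖ κ)))
    (hv0 : v ≠ 0) : IsSteinbergVector (parahoric c ϖ (mIdx κ + 1)) σ v := by
  have hfin := finite_quotient_iwahori h κ
  have he : ∀ g w, e (σ g w) = steinberg c ϖ κ k g (e w) :=
    fun g w => e.toIntertwiningMap.isIntertwining _ _ g w
  obtain ⟨r, hr⟩ := exists_baseVector_of_equiv h e hv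
  have hr0 : r ≠ 0 := by
    rintro rfl
    rw [zero_smul] at hr
    exact hv0 (EquivLike.injective e (by rw [hr, map_zero]))
  refine ⟨fun w => ?_, fun g hg => ?_, ?_, fun N hN hvN => ?_⟩
  · obtain ⟨U, hU, hw⟩ := isSmoothRep_steinberg (k := k) h (e w)
    exact ⟨U, hU, fun u hu => EquivLike.injective e (by rw [he, hw u hu])⟩
  · refine apply_eq_self_of_mem_iwahori h e hv ?_
    have : g ∈ (iwahori c ϖ κ).subgroupOf (maxCompact c ϖ κ) := by
      rw [iwahori_subgroupOf h]
      exact hg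
    exact this
  · rw [← iwahori_subgroupOf h]
    apply EquivLike.injective e
    have h1 : e (orbitSum σ ((iwahori c ϖ κ).subgroupOf (maxCompact c ϖ κ)) v) =
        orbitSum (steinberg c ϖ κ k) ((iwahori c ϖ κ).subgroupOf (maxCompact c ϖ κ)) (e v) :=
      map_orbitSum e.toLinearEquiv.toLinearMap he
    rw [h1, hr, orbitSum_smul, map_zero]
    exact (congrArg _ orbitSum_baseVector).trans (smul_zero r)
  · have h1 := baseVector_generates (N.map e.toLinearEquiv.toLinearMap) (by
      rintro a _ ⟨w, hw, rfl⟩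
      exact ⟨σ a w, hN a w hw, he a w⟩) (by
      have : e v ∈ N.map e.toLinearEquiv.toLinearMap := ⟨v, hvN, rfl⟩
      rw [hr] at this
      exact (Submodule.smul_mem_iff _ hr0).1 this)
    rw [Submodule.eq_top_iff']
    intro w
    obtain ⟨w', hw', hww'⟩ := (Submodule.eq_top_iff'.1 h1) (e w)
    exact EquivLike.injective e hww' ▸ hw'

end Weights

end U21

/-! ### Fixed vectors of pro-`p` groups in characteristic `p`. -/

section ProP

open Filter Topology

variable {k A V : Type*} [Field k] [Group A] [TopologicalSpace A] [IsTopologicalGroup A]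
  [CompactSpace A] [AddCommGroup V] [Module k V]

/-- A nonzero smooth representation of a pro-`p` group in characteristic `p` has a nonzero fixed
vector. -/
theorem exists_fixed_ne_zero_of_tendsto_pow (p : ℕ) [hp : Fact p.Prime] [CharP k p]
    (hA : ∀ g : A, Tendsto (fun n => g ^ p ^ n) atTop (𝓝 1)) {ρ : Representation k A V}
    (hρ : IsSmoothRep ρ) [Nontrivial V] : ∃ v : V, v ≠ 0 ∧ ∀ g, ρ g v = v := by
  obtain ⟨v, hv⟩ := exists_ne (0 : V)
  obtain ⟨U, hU, hUv⟩ := hρ v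
  have hpV : ∀ x : V, p • x = 0 := fun x => by
    rw [← Nat.cast_smul_eq_nsmul k, CharP.cast_eq_zero, zero_smul]
  have : Finite (A ⧸ U) := Subgroup.quotient_finite_of_isOpen U hU
  have horb : (Set.range fun a => ρ a v).Finite := by
    refine (Set.finite_range fun x : A ⧸ U => ρ x.out v).subset ?_
    rintro _ ⟨a, rfl⟩
    exact ⟨QuotientGroup.mk a, apply_out_eq hUv a⟩
  -- The additive group generated by the finite orbit of `v` is finitely generated and killed by
  -- `p`, hence finite, even if `k` is infinite.
  let S := AddSubgroup.closure (Set.range fun a => ρ a v)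
  have hS : ∀ a, ∀ x ∈ S, ρ a x ∈ S := fun a => by
    refine (AddSubgroup.closure_le (S.comap (ρ a).toAddMonoidHom)).2 ?_
    rintro _ ⟨b, rfl⟩
    exact AddSubgroup.subset_closure ⟨a * b, by simp [map_mul]⟩
  have hfg : AddGroup.FG S :=
    (AddGroup.fg_iff_addSubgroup_fg S).2 ((AddSubgroup.fg_iff S).2 ⟨_, rfl, horb⟩)
  have hfin : Finite S := AddCommGroup.finite_of_fg_isAddTorsion S fun x =>
    isOfFinAddOrder_iff_nsmul_eq_zero.2 ⟨p, hp.out.pos, Subtype.ext (hpV x)⟩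
  let _ : MulAction A S :=
    { smul := fun a x => ⟨ρ a x, hS a x x.2⟩
      one_smul := fun x => Subtype.ext (by change ρ 1 x.1 = x.1; simp)
      mul_smul := fun a b x => Subtype.ext (by change ρ (a * b) x.1 = ρ a (ρ b x.1); simp) }
  have hsmul : ∀ (a : A) (x : S), ((a • x : S) : V) = ρ a x := fun _ _ => rfl
  -- The finitely many generators of `S` have open stabilizers, so a sufficiently high `p`-power of
  -- any element acts trivially on all of them.
  have hP : IsPGroup p (MulAction.toPermHom A S).range := by
    rintro ⟨_, g, rfl⟩
    have h1 : ∀ x ∈ Set.range fun a => ρ a v, ∀ᶠ n in atTop, ρ (g ^ p ^ n) x = x := by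
      intro x _
      obtain ⟨U', hU', hx⟩ := hρ x
      filter_upwards [(hA g).eventually (hU'.mem_nhds U'.one_mem)] with n hn using hx _ hn
    obtain ⟨n, hn⟩ := ((eventually_all_finite horb).2 h1).exists
    refine ⟨n, Subtype.ext (Equiv.ext fun x => ?_)⟩
    change ((MulAction.toPermHom A S g) ^ p ^ n) x = x
    rw [← map_pow]
    refine Subtype.ext ?_
    change ρ (g ^ p ^ n) x = x
    refine AddSubgroup.closure_induction (p := fun y _ => ρ (g ^ p ^ n) y = y) hn (map_zero _)
      (fun y z _ _ hy hz => by rw [map_add, hy, hz]) (fun y _ hy => by rw [map_neg, hy]) x.2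
  have hvS : v ∈ S := AddSubgroup.subset_closure ⟨1, by simp⟩
  have hdvd : p ∣ Nat.card S := by
    rw [← addOrderOf_eq_prime (x := (⟨v, hvS⟩ : S)) (Subtype.ext (hpV v))
      fun h => hv (congrArg Subtype.val h)]
    exact addOrderOf_dvd_natCard _
  -- The zero vector is fixed and `p` divides the order of `S`, so there is a second fixed point.
  obtain ⟨b, hb, hb0⟩ := hP.exists_fixed_point_of_prime_dvd_card_of_fixed_point S hdvd
    (a := 0) fun g => by
      obtain ⟨_, g, rfl⟩ := g
      exact Subtype.ext (map_zero (ρ g))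
  exact ⟨b, fun h => hb0 (Subtype.ext h.symm), fun g =>
    congrArg Subtype.val (hb ⟨_, g, rfl⟩)⟩

end ProP

namespace U21

/-! ### The constant in `T_σ` for the Steinberg weight. -/

section HeckeConstant

variable {F E : Type*} [Field F] [ValuativeRel F]
  [Field E] [ValuativeRel E]
  [TopologicalSpace E] [IsNonarchimedeanLocalField E] [Algebra F E] [ValuativeExtension F E]
  {c : QuadraticConjugation F E} {ϖ : Uniformizer F} {κ : MaxCompactKind}
  {k W V : Type*} [Field k] [AddCommGroup W] [Module k W] [AddCommGroup V] [Module k V]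
  {σ : Representation k (maxCompact c ϖ κ) W}

lemma val_unitLift (t : 𝓀[E]ˣ) : valuation E (unitLift t : E) = 1 := by
  set u : 𝒪[E]ˣ := Function.surjInv (IsLocalRing.surjective_units_map_of_local_ringHom
      (IsLocalRing.residue 𝒪[E]) IsLocalRing.residue_surjective inferInstance) t
  have h1 : valuation E ((u : 𝒪[E]) : E) ≤ 1 := (u : 𝒪[E]).2
  have h2 : valuation E (((u⁻¹ : 𝒪[E]ˣ) : 𝒪[E]) : E) ≤ 1 := ((u⁻¹ : 𝒪[E]ˣ) : 𝒪[E]).2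
  have h3 : valuation E ((u : 𝒪[E]) : E) * valuation E (((u⁻¹ : 𝒪[E]ˣ) : 𝒪[E]) : E) = 1 := by
    rw [← map_mul]
    have : ((u : 𝒪[E]) : E) * (((u⁻¹ : 𝒪[E]ˣ) : 𝒪[E]) : E) = 1 :=
      congrArg Subtype.val u.mul_inv
    rw [this, map_one]
  change valuation E ((u : 𝒪[E]) : E) = 1
  refine le_antisymm h1 ?_
  rw [← h3]
  exact mul_le_of_le_one_right' h2

lemma hElt_mem_iwahori (h : IsUnramifiedConjugation c ϖ) {u : Eˣ} (hu : valuation E (u : E) = 1) :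
    hElt c u ∈ iwahori c ϖ κ := by
  have hd : ∀ i, valuation E ((![u, -(unitsConj c u) * u⁻¹, (unitsConj c u)⁻¹] i : Eˣ) : E) = 1 := by
    intro i
    fin_cases i <;> simp [unitsConj, h.val_conj, hu]
  refine (mem_congruenceSubgroup_iff h _ ?_).2 fun i j => ?_
  · cases κ <;> decide
  change valuation E ((Matrix.diagonal
    fun i => ((![u, -(unitsConj c u) * u⁻¹, (unitsConj c u)⁻¹] i : Eˣ) : E)) i j -
      (1 : Matrix (Fin 3) (Fin 3) E) i j) ≤ _
  by_cases hij : i = j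
  · subst hij
    rw [Matrix.diagonal_apply_eq, Matrix.one_apply_eq,
      show expI κ i i = 0 by cases κ <;> fin_cases i <;> rfl, zpow_zero]
    exact ((valuation E).map_sub _ _).trans (by rw [hd, map_one, max_self])
  · rw [Matrix.diagonal_apply_ne _ hij, Matrix.one_apply_ne hij, sub_zero, map_zero]
    exact zero_le

lemma eigenvalueOn_hElt (h : IsUnramifiedConjugation c ϖ) (e : σ.Equiv (steinberg c ϖ κ k))
    {v : W} (hv : v ∈ fixedVectors σ ((proPIwahori c ϖ κ).subgroupOf (maxCompact c ϖ κ)))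
    (hv0 : v ≠ 0) {u : Eˣ} (hu : valuation E (u : E) = 1) :
    eigenvalueOn σ (proPIwahori c ϖ κ) (hElt c u) = 1 := by
  have hI : hElt c u ∈ iwahori c ϖ κ := hElt_mem_iwahori h hu
  have hK : hElt c u ∈ maxCompact c ϖ κ := by
    rw [iwahori_eq h, ← maxCompact_eq] at hI
    exact hI.1
  have hex : ∃ r : k, ∃ g : maxCompact c ϖ κ, (g : unitaryGroup c) = hElt c u ∧
      ∀ v ∈ fixedVectors σ ((proPIwahori c ϖ κ).subgroupOf (maxCompact c ϖ κ)),
        σ g v = r • v :=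
    ⟨1, ⟨_, hK⟩, rfl, fun v hv => by rw [one_smul, apply_eq_self_of_mem_iwahori h e hv hI]⟩
  rw [eigenvalueOn, dif_pos hex]
  obtain ⟨g, hg, hgv⟩ := hex.choose_spec
  have h1 := hgv v hv
  rw [apply_eq_self_of_mem_iwahori h e hv (hg ▸ hI)] at h1
  -- The chosen eigenvalue is pinned down because the fixed space contains a nonzero vector.
  have h2 : (hex.choose - 1) • v = 0 := by rw [sub_smul, one_smul, ← h1, sub_self]
  exact sub_eq_zero.1 ((smul_eq_zero.1 h2).resolve_right hv0)

end HeckeConstant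

section Constant

variable {F E : Type*} [Field F] [ValuativeRel F] [TopologicalSpace F]
  [IsNonarchimedeanLocalField F] [Field E] [ValuativeRel E]
  [TopologicalSpace E] [IsNonarchimedeanLocalField E] [Algebra F E] [ValuativeExtension F E]
  {c : QuadraticConjugation F E} {ϖ : Uniformizer F} {κ : MaxCompactKind}
  {k W V : Type*} [Field k] [AddCommGroup W] [Module k W] [AddCommGroup V] [Module k V]
  {σ : Representation k (maxCompact c ϖ κ) W}

/-- All summands are `1`, as `χ_σ` is trivial, and their number is `-1` in `k`. -/
lemma heckeConstant_eq_neg_one (p : ℕ) [Fact p.Prime] (hp2 : p ≠ 2) [CharP 𝓀[F] p] [CharP k p]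
    (hdeg : Module.finrank F E = 2)
    (h : IsUnramifiedConjugation c ϖ) (e : σ.Equiv (steinberg c ϖ κ k))
    {v : W} (hv : v ∈ fixedVectors σ ((proPIwahori c ϖ κ).subgroupOf (maxCompact c ϖ κ)))
    (hv0 : v ≠ 0) : heckeConstant σ = -1 := by
  rw [← card_InL_cast p hp2 hdeg h κ k]
  refine (finsum_congr fun y : {y : 𝓀[E] × 𝓀[E]ˣ // InL κ (Nat.card 𝓀[F]) y.1 (y.2 : 𝓀[E])} =>
    eigenvalueOn_hElt h e hv hv0 (val_unitLift y.1.2)).trans ?_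
  let _ := Fintype.ofFinite
    {y : 𝓀[E] × 𝓀[E]ˣ // InL κ (Nat.card 𝓀[F]) y.1 (y.2 : 𝓀[E])}
  rw [finsum_eq_sum_of_fintype, Finset.sum_const, Finset.card_univ, ← Nat.card_eq_fintype_card,
    nsmul_eq_mul, mul_one]

end Constant

/-! ### Comparison of `f₀` and `f₁` with their characterization on `U(2,1)`. -/

section InvariantFunctions

variable {F E : Type*} [Field F] [ValuativeRel F] [Field E] [ValuativeRel E]
  [TopologicalSpace E] [IsNonarchimedeanLocalField E] [Algebra F E] [ValuativeExtension F E]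
  {c : QuadraticConjugation F E} {ϖ : Uniformizer F} {κ : MaxCompactKind}
  {k W V : Type*} [Field k] [AddCommGroup W] [Module k W] [AddCommGroup V] [Module k V]
  {σ : Representation k (maxCompact c ϖ κ) W} {v : W}

lemma IsInvariantFunction.apply {n : ℤ} {f : cIndSpace (maxCompact c ϖ κ) σ}
    (hf : IsInvariantFunction σ v n f) {x y : unitaryGroup c} (hx : x ∈ maxCompact c ϖ κ)
    (hy : y ∈ proPIwahori c ϖ κ) : f.1 (x * alphaElt c ϖ ^ (-n) * y) =
      σ ⟨x, hx⟩ (if 0 < n then σ (betaKmem c ϖ κ) v else v) := by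
  have h1 : cInd (maxCompact c ϖ κ) σ y f = f := hf.invariant ⟨y, hy⟩
  rw [← cInd_apply, h1, cIndSpace_mul _ hx, hf.value]

lemma IsInvariantFunction.unique {n : ℤ} {f f' : cIndSpace (maxCompact c ϖ κ) σ}
    (hf : IsInvariantFunction σ v n f) (hf' : IsInvariantFunction σ v n f') : f = f' := by
  ext g
  by_cases h0 : f.1 g = 0
  · by_cases h0' : f'.1 g = 0
    · exact h0.trans h0'.symm
    · obtain ⟨x, hx, y, hy, rfl⟩ := hf'.support g h0'
      exact (hf.apply hx hy).trans (hf'.apply hx hy).symm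
  · obtain ⟨x, hx, y, hy, rfl⟩ := hf.support g h0
    exact (hf.apply hx hy).trans (hf'.apply hx hy).symm

lemma IsInvariantFunction.eq {n : ℤ} {f : cIndSpace (maxCompact c ϖ κ) σ}
    (hf : IsInvariantFunction σ v n f) : invariantFunction σ v n = f := by
  have hex : ∃ f, IsInvariantFunction σ v n f := ⟨f, hf⟩
  rw [invariantFunction, dif_pos hex]
  exact hex.choose_spec.unique hf

variable {p : ℕ}
  (d : IsEdgeDatum p (maxCompact c ϖ κ) (parahoric c ϖ (mIdx κ + 1)) (proPIwahori c ϖ κ)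
      (proPIwahori' c ϖ κ) (betaK c ϖ κ) (refl c ϖ (mIdx κ + 1)))
  (hv : IsSteinbergVector (parahoric c ϖ (mIdx κ + 1)) σ v)
include d hv

lemma isInvariantFunction_f₀ : IsInvariantFunction σ v 0 (d.f₀ hv) := by
  refine ⟨fun n => d.cInd_f₀ hv (d.J_le n.2), fun g hg => ?_, ?_⟩
  · refine ⟨g, ?_, 1, one_mem _, by simp⟩
    by_contra h
    exact hg (d.f₀_of_notMem hv h)
  · rw [if_neg (lt_irrefl 0), neg_zero, zpow_zero, d.f₀_of_mem hv (one_mem _)]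
    exact congrFun (congrArg DFunLike.coe (map_one σ)) v

/-- Since `α⁻¹ = β_K s'` with `β_K ∈ K`, the double coset `K s' I_{1,K}` is that of `α⁻¹`, and the
value `v` at `s'` becomes `β_K v` at `α⁻¹`. -/
lemma isInvariantFunction_f₁ : IsInvariantFunction σ v 1 (d.f₁ hv) := by
  have hα : alphaElt c ϖ ^ (-1 : ℤ) = betaK c ϖ κ * refl c ϖ (mIdx κ + 1) := by
    rw [zpow_neg_one, ← refl_succ_mul_refl c ϖ (mIdx κ), mul_inv_rev, refl_inv, refl_inv,
      betaK_eq_refl]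
  refine ⟨fun n => d.cInd_f₁ hv (d.J_le n.2), fun g hg => ?_, ?_⟩
  · obtain ⟨x, hx, y, hy, rfl⟩ := d.exists_of_f₁_ne_zero hv hg
    refine ⟨x * betaK c ϖ κ, mul_mem hx d.s_mem, y, hy, ?_⟩
    rw [hα, mul_assoc x (betaK c ϖ κ), ← mul_assoc (betaK c ϖ κ) (betaK c ϖ κ), d.s_mul_self, one_mul]
  · rw [if_pos one_pos, hα, d.f₁_mul_s' hv d.s_mem]
    rfl

end InvariantFunctions

/-! ### Quotients of the universal module of the Steinberg weight. -/

section SteinbergQuotient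

variable {F E : Type*} [Field F] [ValuativeRel F] [TopologicalSpace F]
  [IsNonarchimedeanLocalField F] [Field E] [ValuativeRel E]
  [TopologicalSpace E] [IsNonarchimedeanLocalField E] [Algebra F E] [ValuativeExtension F E]
  {c : QuadraticConjugation F E} {ϖ : Uniformizer F} {κ : MaxCompactKind}
  {k W V : Type*} [Field k] [AddCommGroup W] [Module k W] [AddCommGroup V] [Module k V]
  {σ : Representation k (maxCompact c ϖ κ) W}

/-- The composite of the projection to `ind_K^G σ / (T_σ)` with a quotient of that module. -/
noncomputable def liftUniversalModule {π : Representation k (unitaryGroup c) V}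
    (q : Representation.IntertwiningMap (universalModule σ) π) :
    Representation.IntertwiningMap (cInd (maxCompact c ϖ κ) σ) π :=
  LinearMap.intertwiningMap_of_isIntertwiningMap _ _
    (q.toLinearMap.comp (heckeTσ σ).range.toSubmodule.mkQ)
    fun g f => q.isIntertwining _ _ g (Submodule.Quotient.mk f)

lemma liftUniversalModule_apply {π : Representation k (unitaryGroup c) V}
    (q : Representation.IntertwiningMap (universalModule σ) π)
    (f : cIndSpace (maxCompact c ϖ κ) σ) :
    liftUniversalModule q f = q (Submodule.Quotient.mk f) := rfl

lemma liftUniversalModule_heckeTσ {π : Representation k (unitaryGroup c) V}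
    (q : Representation.IntertwiningMap (universalModule σ) π)
    (f : cIndSpace (maxCompact c ϖ κ) σ) : liftUniversalModule q (heckeTσ σ f) = 0 := by
  have : (Submodule.Quotient.mk (heckeTσ σ f) :
      cIndSpace (maxCompact c ϖ κ) σ ⧸ (heckeTσ σ).range.toSubmodule) = 0 :=
    (Submodule.Quotient.mk_eq_zero _).2 ⟨f, rfl⟩
  rw [liftUniversalModule_apply, this, map_zero]

lemma exists_liftUniversalModule_ne_zero [Nontrivial V]
    {π : Representation k (unitaryGroup c) V}
    (q : Representation.IntertwiningMap (universalModule σ) π) (hq : Function.Surjective q) :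
    ∃ f, liftUniversalModule q f ≠ 0 := by
  obtain ⟨v, hv⟩ := exists_ne (0 : V)
  obtain ⟨x, rfl⟩ := hq v
  obtain ⟨f, rfl⟩ := Submodule.Quotient.mk_surjective _ x
  exact ⟨f, hv⟩

/-- The images of `f₀` and `f₁` in a nonzero quotient of `ind_K^G St / (T_St)` are linearly
independent. -/
theorem linearIndependent_invariantFunction (p : ℕ) [hp : Fact p.Prime] (hp2 : p ≠ 2)
    [CharP 𝓀[F] p] [CharP k p] (hdeg : Module.finrank F E = 2)
    (h : IsUnramifiedConjugation c ϖ) (e : σ.Equiv (steinberg c ϖ κ k)) {v : W}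
    (hv : v ∈ fixedVectors σ ((proPIwahori c ϖ κ).subgroupOf (maxCompact c ϖ κ))) (hv0 : v ≠ 0)
    [Nontrivial V] {π : Representation k (unitaryGroup c) V}
    (q : Representation.IntertwiningMap (universalModule σ) π) (hq : Function.Surjective q) :
    LinearIndependent k ![q (Submodule.Quotient.mk (invariantFunction σ v 0)),
      q (Submodule.Quotient.mk (invariantFunction σ v 1))] := by
  have d := isEdgeDatum h (val_natCast_lt_one (F := F) (E := E) p) κ
  have hst := isSteinbergVector h e hv hv0
  rw [(isInvariantFunction_f₀ d hst).eq, (isInvariantFunction_f₁ d hst).eq]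
  have hq0 := exists_liftUniversalModule_ne_zero q hq
  -- The constant is `-1`, so `T_σ = T + 1` and killing `T_σ` means that `T` acts by `-1`.
  have hT : ∀ f, liftUniversalModule q (heckeT σ f) = -liftUniversalModule q f := by
    intro f
    have h1 : heckeTσ σ f = heckeT σ f - heckeConstant σ • f := rfl
    have h2 := liftUniversalModule_heckeTσ q f
    rw [h1, map_sub, map_smul, heckeConstant_eq_neg_one p hp2 hdeg h e hv hv0, neg_smul, one_smul,
      sub_neg_eq_add] at h2
    exact eq_neg_of_add_eq_zero_left h2
  have h2 : (2 : k) ≠ 0 := fun h0 => by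
    have := (CharP.cast_eq_zero_iff k p 2).1 (by exact_mod_cast h0)
    exact hp2 ((Nat.prime_dvd_prime_iff_eq hp.out Nat.prime_two).1 this)
  by_cases hex : ∃ T, IsHeckeOperatorAt σ (proPIwahori c ϖ κ) (proPIwahori' c ϖ κ)
      (alphaElt c ϖ) T
  · have hspec := hex.choose_spec
    have hTe : heckeT σ = hex.choose := dif_pos hex
    rw [← hTe, ← refl_succ_mul_refl c ϖ (mIdx κ), ← betaK_eq_refl] at hspec
    exact d.linearIndependent hst h2 hspec (liftUniversalModule q) hq0 hT
  -- With the default value `T = 0`, the relation `T = -1` would make the quotient zero, so this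
  -- case does not arise and the existence of the Hecke operator need not be shown separately.
  · obtain ⟨f, hf⟩ := hq0
    have hTe : heckeT σ = 0 := dif_neg hex
    refine absurd ?_ hf
    have := hT f
    rw [hTe] at this
    exact neg_eq_zero.1 (this.symm.trans (map_zero _))

end SteinbergQuotient

end U21

/-! ### Fixed vectors, generation and isomorphism of subrepresentations. -/

section FixedVectors

variable {k G V V' : Type*} [Field k] [Group G] [TopologicalSpace G]
  [AddCommGroup V] [Module k V] [AddCommGroup V'] [Module k V']

lemma mem_fixedVectors {ρ : Representation k G V} {H : Subgroup G} {v : V} :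
    v ∈ fixedVectors ρ H ↔ ∀ g ∈ H, ρ g v = v :=
  ⟨fun h g hg => h ⟨g, hg⟩, fun h g => h g g.2⟩

lemma map_mem_fixedVectors {ρ : Representation k G V} {ρ' : Representation k G V'}
    (f : Representation.IntertwiningMap ρ ρ') {H : Subgroup G} {v : V}
    (hv : v ∈ fixedVectors ρ H) : f v ∈ fixedVectors ρ' H :=
  mem_fixedVectors.2 fun g hg => by
    have h1 : f (ρ g v) = ρ' g (f v) := f.isIntertwining _ _ g v
    rw [← h1, mem_fixedVectors.1 hv g hg]

lemma mem_fixedVectors_of_comp_subtype {ρ : Representation k G V} {H K : Subgroup G} (hH : H ≤ K)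
    {v : V} (hv : v ∈ fixedVectors (ρ.comp K.subtype : Representation k K V) (H.subgroupOf K)) :
    v ∈ fixedVectors ρ H :=
  mem_fixedVectors.2 fun g hg => mem_fixedVectors.1 hv ⟨g, hH hg⟩ hg

lemma nontrivial_of_isIrreducible {ρ : Representation k G V} (hρ : ρ.IsIrreducible) :
    Nontrivial V := by
  by_contra h
  rw [not_nontrivial_iff_subsingleton] at h
  obtain ⟨N, N', hN⟩ := hρ.exists_pair_ne
  refine hN (Subrepresentation.toSubmodule_injective ?_)
  exact Subsingleton.elim _ _

/-- A compact subgroup which is pro-`p` fixes a nonzero vector of a nonzero smooth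
representation in characteristic `p`. -/
lemma exists_mem_fixedVectors_ne_zero [IsTopologicalGroup G] (p : ℕ) [Fact p.Prime] [CharP k p]
    {H : Subgroup G} (hH : IsCompact (H : Set G))
    (hpow : ∀ g ∈ H, Filter.Tendsto (fun n => g ^ p ^ n) Filter.atTop (nhds 1))
    {ρ : Representation k G V} (hρ : IsSmoothRep ρ) [Nontrivial V] :
    ∃ v ∈ fixedVectors ρ H, v ≠ 0 := by
  have : CompactSpace H := isCompact_iff_compactSpace.1 hH
  obtain ⟨v, hv0, hv⟩ := exists_fixed_ne_zero_of_tendsto_pow (ρ := ρ.comp H.subtype) p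
    (fun g => tendsto_subtype_rng.2 (hpow g g.2)) fun v => by
      obtain ⟨U, hU, hUv⟩ := hρ v
      exact ⟨U.subgroupOf H, hU.preimage continuous_subtype_val, fun u hu => hUv u hu⟩
  exact ⟨v, hv, hv0⟩

namespace Representation

variable {W W' : Type*} [AddCommGroup W] [Module k W] [AddCommGroup W'] [Module k W']
  {ρ : Representation k G V} {σ : Representation k G W} {τ : Representation k G W'}

/-- Two representations which embed into a third one with the same image are isomorphic. -/
lemma nonempty_equiv_of_range_eq (f : IntertwiningMap σ ρ) (g : IntertwiningMap τ ρ)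
    (hf : Function.Injective f) (hg : Function.Injective g)
    (hfg : LinearMap.range f.toLinearMap = LinearMap.range g.toLinearMap) :
    Nonempty (σ.Equiv τ) := by
  let e : W ≃ₗ[k] W' := (LinearEquiv.ofInjective f.toLinearMap hf).trans
    ((LinearEquiv.ofEq _ _ hfg).trans (LinearEquiv.ofInjective g.toLinearMap hg).symm)
  have he : ∀ w, g (e w) = f w := fun w =>
    congrArg Subtype.val ((LinearEquiv.ofInjective g.toLinearMap hg).apply_symm_apply _)
  refine ⟨(LinearMap.intertwiningMap_of_isIntertwiningMap σ τ e.toLinearMap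
    fun a w => hg ?_).ofBijective e.bijective⟩
  have h1 : g (τ a (e w)) = ρ a (g (e w)) := g.isIntertwining _ _ a _
  have h2 : f (σ a w) = ρ a (f w) := f.isIntertwining _ _ a _
  change g (e (σ a w)) = g (τ a (e w))
  rw [h1, he, he, h2]

/-- The preimage under `f` of the image of `g` is a stable subspace containing a generator. -/
lemma range_le_range_of_generates (f : IntertwiningMap σ ρ) (g : IntertwiningMap τ ρ) {w : W}
    (hw : ∀ N : Submodule k W, (∀ a, ∀ x ∈ N, σ a x ∈ N) → w ∈ N → N = ⊤) {w' : W'}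
    (h : g w' = f w) : LinearMap.range f.toLinearMap ≤ LinearMap.range g.toLinearMap := by
  have htop := hw ((LinearMap.range g.toLinearMap).comap f.toLinearMap) (by
    rintro a x ⟨y, hy⟩
    have h1 : g (τ a y) = ρ a (g y) := g.isIntertwining _ _ a _
    have h2 : f (σ a x) = ρ a (f x) := f.isIntertwining _ _ a _
    have h3 : g y = f x := hy
    exact ⟨τ a y, by change g (τ a y) = f (σ a x); rw [h1, h2, h3]⟩) ⟨w', h⟩
  rintro _ ⟨x, rfl⟩
  exact (Submodule.eq_top_iff'.1 htop) x

lemma IsIrreducible.generates (hσ : σ.IsIrreducible) {w : W} (hw : w ≠ 0) (N : Submodule k W)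
    (hN : ∀ a, ∀ x ∈ N, σ a x ∈ N) (hwN : w ∈ N) : N = ⊤ := by
  let N' : Subrepresentation σ := ⟨N, fun a x hx => hN a x hx⟩
  rcases hσ.eq_bot_or_eq_top N' with h | h
  · have : N = ⊥ := congrArg Subrepresentation.toSubmodule h
    rw [this] at hwN
    exact absurd ((Submodule.mem_bot k).1 hwN) hw
  · exact congrArg Subrepresentation.toSubmodule h

end Representation

lemma two_le_rank_of_linearIndependent_pair {x y : V} (h : LinearIndependent k ![x, y]) :
    2 ≤ Module.rank k V := by
  simpa using h.cardinal_lift_le_rank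

end FixedVectors

/-! ### Dimension of the `I_{1,K}`-invariants of a representation containing the Steinberg weight.
-/

namespace U21

variable {F E : Type*} [Field F] [ValuativeRel F] [TopologicalSpace F]
  [IsNonarchimedeanLocalField F] [Field E] [ValuativeRel E]
  [TopologicalSpace E] [IsNonarchimedeanLocalField E] [Algebra F E] [ValuativeExtension F E]
  {c : QuadraticConjugation F E} {ϖ : Uniformizer F} {κ : MaxCompactKind}
  {k W V : Type*} [Field k] [AddCommGroup W] [Module k W] [AddCommGroup V] [Module k V]
  {σ : Representation k (maxCompact c ϖ κ) W}

lemma proPIwahori_le_maxCompact (h : IsUnramifiedConjugation c ϖ) (κ : MaxCompactKind) :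
    proPIwahori c ϖ κ ≤ maxCompact c ϖ κ := by
  refine (proPIwahori_le_iwahori h κ).trans ?_
  rw [iwahori_eq h, maxCompact_eq]
  exact inf_le_left

lemma isCompact_proPIwahori (h : IsUnramifiedConjugation c ϖ) (κ : MaxCompactKind) :
    IsCompact (proPIwahori c ϖ κ : Set (unitaryGroup c)) := by
  have h1 := isCompact_parahoric h (mIdx κ)
  rw [← maxCompact_eq] at h1
  exact h1.of_isClosed_subset
    (Subgroup.isClosed_of_isOpen _ (isOpen_congruenceSubgroup (expI1 κ) (by cases κ <;> decide)))
    (proPIwahori_le_maxCompact h κ)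

lemma exists_mem_fixedVectors_proPIwahori (h : IsUnramifiedConjugation c ϖ) (p : ℕ)
    [Fact p.Prime] [CharP 𝓀[F] p] [CharP k p] (hσ : IsSmoothRep σ) [Nontrivial W] :
    ∃ w ∈ fixedVectors σ ((proPIwahori c ϖ κ).subgroupOf (maxCompact c ϖ κ)), w ≠ 0 := by
  refine exists_mem_fixedVectors_ne_zero p ?_ (fun g hg => ?_) hσ
  · have h1 := isCompact_parahoric h (mIdx κ)
    rw [← maxCompact_eq] at h1
    have hemb : Topology.IsClosedEmbedding (Subtype.val : maxCompact c ϖ κ → unitaryGroup c) :=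
      (Subgroup.isClosed_of_isOpen (maxCompact c ϖ κ)
        (isOpen_congruenceSubgroup _ _)).isClosedEmbedding_subtypeVal
    exact hemb.isCompact_preimage (isCompact_proPIwahori h κ)
  · exact tendsto_subtype_rng.2
      (tendsto_pow_proPIwahori h (val_natCast_lt_one (F := F) (E := E) p) hg)

/-- An irreducible quotient of `ind_K^G σ / (T_σ)` which contains the Steinberg weight has at
least two linearly independent vectors fixed by `I_{1,K}`. -/
theorem two_le_rank_fixedVectors (p : ℕ) [hp : Fact p.Prime] (hp2 : p ≠ 2)
    [CharP 𝓀[F] p] [CharP k p] (hdeg : Module.finrank F E = 2)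
    (h : IsUnramifiedConjugation c ϖ) (hσ : IsWeight σ)
    {π : Representation k (unitaryGroup c) V} (hπ : π.IsIrreducible)
    (q : Representation.IntertwiningMap (universalModule σ) π) (hq : Function.Surjective q)
    (hst : ContainsRep π (steinberg c ϖ κ k)) :
    2 ≤ Module.rank k (fixedVectors π (proPIwahori c ϖ κ)) := by
  have hV : Nontrivial V := nontrivial_of_isIrreducible hπ
  have hW : Nontrivial W := nontrivial_of_isIrreducible hσ.1
  have hJK := proPIwahori_le_maxCompact h κ
  have hKo : IsOpen (maxCompact c ϖ κ : Set (unitaryGroup c)) := isOpen_congruenceSubgroup _ _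
  have hKc : IsCompact (maxCompact c ϖ κ : Set (unitaryGroup c)) := by
    rw [maxCompact_eq]
    exact isCompact_parahoric h _
  obtain ⟨i, hi⟩ := hst
  obtain ⟨w, hw, hw0⟩ := exists_mem_fixedVectors_proPIwahori (σ := σ) h p hσ.2
  -- Frobenius reciprocity: the quotient map restricts to a `K`-map on the functions supported on
  -- `K`. It is nonzero because these functions generate, hence injective because `σ` is
  -- irreducible.
  let ι : Representation.IntertwiningMap σ (π.comp (maxCompact c ϖ κ).subtype) :=
    LinearMap.intertwiningMap_of_isIntertwiningMap _ _
      ((liftUniversalModule q).toLinearMap.comp (cIndSingle hKo hKc hσ.2)) fun a v => by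
        have h1 := (liftUniversalModule q).isIntertwining _ _ (a : unitaryGroup c)
          (cIndSingle hKo hKc hσ.2 v)
        rw [cInd_cIndSingle] at h1
        exact h1
  have hι : Function.Injective ι := by
    have := hσ.1
    refine (Representation.IsIrreducible.injective_or_eq_zero ι).resolve_right fun h0 => ?_
    obtain ⟨f, hf⟩ := exists_liftUniversalModule_ne_zero q hq
    have htop := eq_top_of_cIndSingle_mem (hKo := hKo) (hKc := hKc) (hσ := hσ.2)
      (LinearMap.ker (liftUniversalModule q).toLinearMap) (fun g f hf => by
        have h1 := (liftUniversalModule q).isIntertwining _ _ g f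
        have h2 : liftUniversalModule q f = 0 := hf
        rw [h2, map_zero] at h1
        exact h1) fun v => congrFun (congrArg DFunLike.coe h0) v
    exact hf ((Submodule.eq_top_iff'.1 htop) f)
  by_contra! hlt
  set b := baseVector k ((iwahori c ϖ κ).subgroupOf (maxCompact c ϖ κ))
  have hb : b ∈ fixedVectors (steinberg c ϖ κ k)
      ((proPIwahori c ϖ κ).subgroupOf (maxCompact c ϖ κ)) := baseVector_mem_fixedVectors h
  have hb0 : b ≠ 0 := baseVector_steinberg_ne_zero h
  have hιw := mem_fixedVectors_of_comp_subtype hJK (map_mem_fixedVectors ι hw)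
  have hib := mem_fixedVectors_of_comp_subtype hJK (map_mem_fixedVectors i hb)
  have hιw0 : ι w ≠ 0 := fun h0 => hw0 (hι (h0.trans (map_zero ι).symm))
  have hib0 : i b ≠ 0 := fun h0 => hb0 (hi (h0.trans (map_zero i).symm))
  -- In dimension at most one, the fixed vectors coming from `σ` and from the Steinberg weight are
  -- proportional.
  obtain ⟨r, hr0, hr⟩ : ∃ r : k, r ≠ 0 ∧ ι w = r • i b := by
    have hdep : ¬ LinearIndependent k
        ![(⟨_, hib⟩ : fixedVectors π (proPIwahori c ϖ κ)), ⟨_, hιw⟩] := fun hli => by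
      exact absurd hlt (not_lt.2 (two_le_rank_of_linearIndependent_pair hli))
    rw [LinearIndependent.pair_iff' fun h0 => hib0 (congrArg Subtype.val h0)] at hdep
    push Not at hdep
    obtain ⟨r, hr⟩ := hdep
    have hr' : r • i b = ι w := congrArg Subtype.val hr
    refine ⟨r, ?_, hr'.symm⟩
    rintro rfl
    rw [zero_smul] at hr'
    exact hιw0 hr'.symm
  have hfin := finite_quotient_iwahori h κ
  -- Proportional generators span the same `K`-subrepresentation, so `σ` is Steinberg. On the
  -- Steinberg side the fact that `b` generates suffices; irreducibility is not required.
  obtain ⟨e⟩ := Representation.nonempty_equiv_of_range_eq ι i hι hi (le_antisymm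
    (Representation.range_le_range_of_generates ι i (hσ.1.generates hw0)
      (w' := r • b) (by rw [map_smul, hr]))
    (Representation.range_le_range_of_generates i ι (w := b) baseVector_generates
      (w' := r⁻¹ • w) (by rw [map_smul, hr, inv_smul_smul₀ hr0])))
  have d := isEdgeDatum h (val_natCast_lt_one (F := F) (E := E) p) κ
  have hsv := isSteinbergVector h e hw hw0
  have hli := linearIndependent_invariantFunction p hp2 hdeg h e hw hw0 q hq
  have hfix : ∀ n f, IsInvariantFunction σ w n f →
      q (Submodule.Quotient.mk (invariantFunction σ w n)) ∈
        fixedVectors π (proPIwahori c ϖ κ) := fun n f hf => by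
    rw [hf.eq, ← liftUniversalModule_apply]
    exact map_mem_fixedVectors _ hf.invariant
  have hli' : LinearIndependent k ![(⟨_, hfix 0 _ (isInvariantFunction_f₀ d hsv)⟩ :
      fixedVectors π (proPIwahori c ϖ κ)), ⟨_, hfix 1 _ (isInvariantFunction_f₁ d hsv)⟩] := by
    rw [LinearIndependent.pair_iff] at hli ⊢
    exact fun a a' haa' => hli a a' (congrArg Subtype.val haa')
  exact absurd hlt (not_lt.2 (two_le_rank_of_linearIndependent_pair hli'))

end U21

theorem mainTheorem1 {F E : Type*} [Field F] [ValuativeRel F] [TopologicalSpace F]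
    [IsNonarchimedeanLocalField F] [Field E] [ValuativeRel E] [TopologicalSpace E]
    [IsNonarchimedeanLocalField E] [Algebra F E] [ValuativeExtension F E]
    (p : ℕ) [Fact p.Prime] (hp : p ≠ 2) [CharP 𝓀[F] p]
    (hdeg : Module.finrank F E = 2) (hunr : IsUnramifiedExtension F E)
    (c : QuadraticConjugation F E) (ϖ : Uniformizer F) (κ : MaxCompactKind) :
    (∀ {W V : Type*} [AddCommGroup W] [Module (AlgebraicClosure (ZMod p)) W]
        [AddCommGroup V] [Module (AlgebraicClosure (ZMod p)) V]
        (σ : Representation (AlgebraicClosure (ZMod p)) (U21.maxCompact c ϖ κ) W)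
        (_ : Nonempty (σ.Equiv (U21.steinberg c ϖ κ (AlgebraicClosure (ZMod p)))))
        (v₀ : W) (_ : v₀ ∈ fixedVectors σ
          ((U21.proPIwahori c ϖ κ).subgroupOf (U21.maxCompact c ϖ κ))) (_ : v₀ ≠ 0)
        (π : Representation (AlgebraicClosure (ZMod p)) (U21.unitaryGroup c) V)
        (_ : π.IsIrreducible)
        (q : Representation.IntertwiningMap (U21.universalModule σ) π)
        (_ : Function.Surjective q),
        LinearIndependent (AlgebraicClosure (ZMod p))
          ![q (Submodule.Quotient.mk (U21.invariantFunction σ v₀ 0)),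
            q (Submodule.Quotient.mk (U21.invariantFunction σ v₀ 1))]) ∧
    (∀ {V : Type*} [AddCommGroup V] [Module (AlgebraicClosure (ZMod p)) V]
        (π : Representation (AlgebraicClosure (ZMod p)) (U21.unitaryGroup c) V),
        U21.IsSupersingular c ϖ κ π →
        ContainsRep π (U21.steinberg c ϖ κ (AlgebraicClosure (ZMod p))) →
        2 ≤ Module.rank (AlgebraicClosure (ZMod p))
          (fixedVectors π (U21.proPIwahori c ϖ κ))) := by
  have h := U21.isUnramifiedConjugation hdeg hunr c ϖ
  refine ⟨?_, ?_⟩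
  · intro W V _ _ _ _ σ ⟨e⟩ v₀ hv hv0 π hπ q hq
    have := nontrivial_of_isIrreducible hπ
    exact U21.linearIndependent_invariantFunction p hp hdeg h e hv hv0 q hq
  · rintro V _ _ π ⟨hπ, -, W, _, _, σ, hσ, q, hq⟩ hst
    exact U21.two_le_rank_fixedVectors p hp hdeg h hσ hπ q hq hst
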